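/- All rings are associative and unital. For parallel ring homomorphisms $\alpha,\beta:S\to T$ put $\mathrm{Hom}(\alpha,\beta)=\{t\in T\mid t\alpha(s)=\beta(s)t\ \ \forall s\in S\}$ and $\mathrm{End}(\alpha)=\mathrm{Hom}(\alpha,\alpha)$. For a ring $B$ let $\mathsf{Ring}(B,B)$ be the strict monoidal category of ring endomorphisms of $B$ and intertwiners, with vertical composition the multiplication of $B$, $\alpha\otimes\beta=\alpha\beta$, and $t\otimes s=t\,\alpha(s)$ for $t:\alpha\to\alpha'$, $s:\beta\to\beta'$. Let $\lambda:A\to B$, $\rho:B\to A$ be ring homomorphisms with an adjunction $\lambda\dashv\rho$, i.e. elements $e\in\mathrm{Hom}(\lambda\rho,\mathrm{id}_B)$ and $m\in\mathrm{Hom}(\mathrm{id}_A,\rho\lambda)$ with $\rho(e)m=1_A$ and $e\lambda(m)=1_B$. An endomorphism $\sigma$ of $B$ is implementable in $\rho$ if there are $f^1,\dots,f^n\in\mathrm{Hom}(\rho,\rho\sigma)$ and $\bar f^1,\dots,\bar f^n\in\mathrm{Hom}(\rho\sigma,\rho)$ with $\rho(\sigma(b))=\sum_i f^i\rho(b)\bar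 f^i$ for all $b\in B$. Let $\mathcal C$ be a full monoidal subcategory of $\mathsf{Ring}(B,B)$ all of whose objects are implementable in $\rho$ and which contains the object $\lambda\rho$. Put $R=\mathrm{End}(\rho)$, and let $F:\mathcal C\to\mathsf{Ab}$, $F(\alpha)=\mathrm{Hom}(\rho,\rho\alpha)$, $F(t)x=\rho(t)x$, with monoidal structure $x\otimes y\mapsto xy$, $1\mapsto 1_A$. Let $F^l:\mathcal C^{op}\to\mathsf{Ab}$, $F^l(\alpha)=\mathrm{Hom}(\rho\alpha,\rho)$, $F^l(t)f=f\rho(t)$, with monoidal structure $f\otimes g\mapsto gf$, and $\Upsilon:\mathcal C^{op}\to\mathsf{Ab}$, $\Upsilon(\alpha)=B$, $\Upsilon(t)b=bt$, with monoidal structure $b\otimes b'\mapsto b\,\alpha(b')$ on $\Upsilon(\alpha)\otimes\Upsilon(\beta)$. For monoidal functors $G:\mathcal C^{op}\to\mathsf{Ab}$ and $F':\mathcal C\to\mathsf{Ab}$ let $G\otimes_{\mathcal C}F'$ be the ring $\bigoplus_\alpha G(\alpha)\otimes F'(\alpha)$ modulo $G(t)y\otimes x=y\otimes F'(t)x$,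 with factorwise multiplication; write $y\otimes_\alpha x$ for its generators. For a monoidal functor $F':\mathcal C\to\mathsf{Ab}$ with unit element $1\in F'(\mathrm{id}_B)$, the field algebra extension is the ring homomorphism $\rho_{F'}:B\to\Upsilon\otimes_{\mathcal C}F'$, $b\mapsto b\otimes 1$, and $\eta_{F'}:F'\to\mathrm{Hom}(\rho_{F'},\rho_{F'}-)$ is the natural map $x\mapsto 1\otimes_\alpha x$. For $\alpha\in\mathcal C$, a direct summand diagram consists of $p_i\in\mathrm{Hom}(\rho\alpha,\rho)$, $q_i\in\mathrm{Hom}(\rho,\rho\alpha)$ ($1\le i\le n$) with $\sum_i q_ip_i=1_A$. Then: 1. $F$ is an additive monoidal functor, represented by $\lambda\rho$ (it is isomorphic as a monoidal functor to $\mathrm{Hom}(\lambda\rho,-)$ for a comonoid structure on $\lambda\rho$), it is essentially strong (the maps $F(\alpha)\otimes_RF(\beta)\to F(\alpha\beta)$ are bijective), and $\eta_F$ is an isomorphism of monoidal functors. 2. The map $\varepsilon_\rho:\Upsilon\otimes_{\mathcal C}F\to A$, $b\otimes_\alpha x\mapsto\rho(b)x$, is a ring isomorphism with $\varepsilon_\rho\circ\rho_F=\rho$.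 3. $H=F^l\otimes_{\mathcal C}F$ is a right bialgebroid over $R$ with source $r\mapsto 1\otimes r$, target $r\mapsto r\otimes 1$, coproduct $f\otimes_\alpha x\mapsto\sum_i(f\otimes_\alpha q_i)\otimes_R(p_i\otimes_\alpha x)$ (for any direct summand diagram for $\alpha$) and counit $f\otimes_\alpha x\mapsto fx$. The ring $L=\mathrm{End}(\rho\lambda)$ is a left bialgebroid over $R$ with source $r\mapsto r$, target $r\mapsto\rho(e\lambda(rm))$, coproduct $h\mapsto\sum_i\rho(e)h\rho(e\lambda(q_im))\otimes_Rp_i\rho\lambda(m)$ (for any direct summand diagram for $\lambda\rho$) and counit $h\mapsto\rho(e)hm$. As a right $R$-bialgebroid, $H$ is isomorphic to the opposite of $L$, i.e. to $L^{op}$ with the source and target of $L$ exchanged and the same coproduct and counit. 4. With the $R$-ring structure $r\mapsto 1\otimes r$ and the coaction $b\otimes_\alpha x\mapsto\sum_i(b\otimes_\alpha q_i)\otimes_R(p_i\otimes_\alpha x)$, the ring $\Upsilon\otimes_{\mathcal C}F$ is a right $H$-comodule algebra, and $\rho_F$ is an $H$-Galois extension: the coinvariant subalgebra is $\rho_F(B)$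 (which corresponds to $\rho(B)$ under $\varepsilon_\rho$) and the Galois map $a\otimes_Ba'\mapsto aa'_{(0)}\otimes_Ra'_{(1)}$ is bijective. 5. With the coaction $a\mapsto\sum_i\rho(e\lambda(a))q_i\otimes_Rp_i\rho\lambda(m)$ (for any direct summand diagram for $\lambda\rho$), the $R$-ring $A$ is a right comodule algebra over $L$ (that is, over $L^{op}$: $(aa')_{(0)}\otimes(aa')_{(1)}=a_{(0)}a'_{(0)}\otimes a'_{(1)}a_{(1)}$), and $\rho$ is an $L$-Galois extension: the coinvariant subalgebra is $\rho(B)$ and the Galois map $A\otimes_BA\to A\otimes_RL$ is bijective. -/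

import Mathlib

open CategoryTheory MonoidalCategory Opposite MulOpposite
open scoped TensorProduct DirectSum

universe u

namespace FieldAlg

/-! ## The 2-category of rings -/

/-- The group `Hom(α, β)` of intertwiners between parallel ring homomorphisms. -/
def intertwiner {S T : Type*} [Ring S] [Ring T] (α β : S →+* T) : AddSubgroup T where
  carrier := {t | ∀ s, t * α s = β s * t}
  zero_mem' := by intro s; simp
  add_mem' := by
    intro x y hx hy s
    rw [add_mul, mul_add, hx s, hy s]
  neg_mem' := by
    intro x hx s
    rw [neg_mul, mul_neg, hx s]

/-- The ring `End(φ) = Hom(φ, φ)`. -/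
def endRing {S T : Type*} [Ring S] [Ring T] (φ : S →+* T) : Subring T where
  carrier := {t | ∀ s, t * φ s = φ s * t}
  zero_mem' := by intro s; simp
  one_mem' := by intro s; simp
  add_mem' := by
    intro x y hx hy s
    rw [add_mul, mul_add, hx s, hy s]
  neg_mem' := by
    intro x hx s
    rw [neg_mul, mul_neg, hx s]
  mul_mem' := by
    intro x y hx hy s
    rw [mul_assoc, hy s, ← mul_assoc, hx s, mul_assoc]

/-- An adjunction `l ⊣ r` in the 2-category of rings, with counit `e : l r → id` and unit
`m : id → r l`. -/
structure RingAdjunction {A B : Type*} [Ring A] [Ring B] (l : A →+* B) (r : B →+* A) where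
  e : B
  m : A
  e_mem : e ∈ intertwiner (l.comp r) (RingHom.id B)
  m_mem : m ∈ intertwiner (RingHom.id A) (r.comp l)
  r_e_mul_m : r e * m = 1
  e_mul_l_m : e * l m = 1

/-- The objects of the endo-category `Ring(B, B)`: ring endomorphisms of `B`. -/
@[ext]
structure EndCat (B : Type u) [Ring B] : Type u where
  hom : B →+* B

section EndCat

variable {B : Type u} [Ring B]

/-- Arrows are intertwiners, composition is multiplication in `B`. -/
instance : Category.{u} (EndCat B) where
  Hom α β := intertwiner α.hom β.hom
  id α := ⟨1, by intro s; simp⟩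
  comp f g := ⟨g.1 * f.1, by
    intro s
    rw [mul_assoc, f.2 s, ← mul_assoc, g.2 s, mul_assoc]⟩
  id_comp f := Subtype.ext (mul_one _)
  comp_id f := Subtype.ext (one_mul _)
  assoc f g h := Subtype.ext (mul_assoc _ _ _).symm

instance : Preadditive (EndCat B) where
  homGroup α β := inferInstanceAs (AddCommGroup (intertwiner α.hom β.hom))
  add_comp _ _ _ _ _ _ := Subtype.ext (mul_add _ _ _)
  comp_add _ _ _ _ _ _ := Subtype.ext (add_mul _ _ _)

theorem EndCat.hom_ext {α β : EndCat B} {f g : α ⟶ β} (h : f.1 = g.1) : f = g := Subtype.ext h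

theorem EndCat.comp_val {α β γ : EndCat B} (f : α ⟶ β) (g : β ⟶ γ) :
    (f ≫ g).1 = g.1 * f.1 := rfl

theorem EndCat.id_val (α : EndCat B) : (𝟙 α : α ⟶ α).1 = 1 := rfl

/-- An isomorphism whose underlying element is `1`, between equal endomorphisms. -/
def EndCat.isoOfEq {α β : EndCat B} (h : α.hom = β.hom) : α ≅ β where
  hom := ⟨1, by intro s; simp [h]⟩
  inv := ⟨1, by intro s; simp [h]⟩
  hom_inv_id := Subtype.ext (one_mul _)
  inv_hom_id := Subtype.ext (one_mul _)

/-- `α ⊗ β = α ∘ β` and `t ⊗ s = t α(s)`. -/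
instance : MonoidalCategoryStruct (EndCat B) where
  tensorObj α β := ⟨α.hom.comp β.hom⟩
  tensorUnit := ⟨RingHom.id B⟩
  tensorHom {α α' β β'} t s := ⟨t.1 * α.hom s.1, by
    intro b
    have h1 := s.2 b
    have h2 := t.2
    simp only [RingHom.comp_apply]
    rw [mul_assoc, ← map_mul, h1, map_mul, ← mul_assoc, h2, mul_assoc]⟩
  whiskerLeft α _ _ s := ⟨α.hom s.1, by
    intro b
    simp only [RingHom.comp_apply]
    rw [← map_mul, s.2 b, map_mul]⟩
  whiskerRight t β := ⟨t.1, fun b => t.2 (β.hom b)⟩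
  associator _ _ _ := EndCat.isoOfEq rfl
  leftUnitor _ := EndCat.isoOfEq rfl
  rightUnitor _ := EndCat.isoOfEq rfl

instance : MonoidalCategory (EndCat B) where
  tensorHom_def {α α' β β'} t s := EndCat.hom_ext (t.2 s.1)
  id_tensorHom_id α β := EndCat.hom_ext (by
    change (1 : B) * α.hom 1 = 1
    simp)
  tensorHom_comp_tensorHom {α₁ α₂ α₃ β₁ β₂ β₃} t s t' s' := EndCat.hom_ext (by
    change t'.1 * α₂.hom s'.1 * (t.1 * α₁.hom s.1) = t'.1 * t.1 * α₁.hom (s'.1 * s.1)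
    have h := t.2 s'.1
    rw [map_mul, mul_assoc, ← mul_assoc (α₂.hom s'.1), ← h]
    simp only [mul_assoc])
  whiskerLeft_id α β := EndCat.hom_ext (map_one α.hom)
  id_whiskerRight _ _ := rfl
  associator_naturality {α₁ α₂ α₃ β₁ β₂ β₃} t s w := EndCat.hom_ext (by
    change 1 * (t.1 * α₁.hom s.1 * α₁.hom (α₂.hom w.1)) = t.1 * α₁.hom (s.1 * α₂.hom w.1) * 1
    rw [map_mul, one_mul, mul_one, mul_assoc])
  leftUnitor_naturality t := EndCat.hom_ext ((one_mul t.1).trans (mul_one t.1).symm)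
  rightUnitor_naturality t := EndCat.hom_ext ((one_mul t.1).trans (mul_one t.1).symm)
  pentagon α β γ δ := EndCat.hom_ext (by
    change α.hom (1 : B) * 1 * (1 : B) = (1 : B) * 1
    simp)
  triangle α β := EndCat.hom_ext (by
    change α.hom (1 : B) * 1 = (1 : B)
    simp)

end EndCat

/-! ## Monoidal functors to abelian groups -/

section Monoidal

variable {J : Type u} [Category.{u} J] [MonoidalCategory J]

/-- A (lax) monoidal structure on a functor to abelian groups. The structure maps
`F X ⊗ F Y → F (X ⊗ Y)` and `ℤ → F 𝟙` are written as biadditive maps and as an element. -/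
class AbMonoidal (F : J ⥤ AddCommGrpCat.{u}) where
  μ : ∀ X Y : J, F.obj X →+ F.obj Y →+ F.obj (X ⊗ Y)
  one : F.obj (𝟙_ J)
  μ_natural : ∀ {X X' Y Y' : J} (f : X ⟶ X') (g : Y ⟶ Y') (x : F.obj X) (y : F.obj Y),
    μ X' Y' (F.map f x) (F.map g y) = F.map (f ⊗ₘ g) (μ X Y x y)
  μ_assoc : ∀ {X Y Z : J} (x : F.obj X) (y : F.obj Y) (z : F.obj Z),
    F.map (α_ X Y Z).hom (μ (X ⊗ Y) Z (μ X Y x y) z) = μ X (Y ⊗ Z) x (μ Y Z y z)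
  one_μ : ∀ {X : J} (x : F.obj X), F.map (λ_ X).hom (μ (𝟙_ J) X one x) = x
  μ_one : ∀ {X : J} (x : F.obj X), F.map (ρ_ X).hom (μ X (𝟙_ J) x one) = x

/-- A natural transformation compatible with the monoidal structures. -/
def IsMonoidalNat {F G : J ⥤ AddCommGrpCat.{u}} [AbMonoidal F] [AbMonoidal G] (ν : F ⟶ G) : Prop :=
  (∀ (X Y : J) (x : F.obj X) (y : F.obj Y),
    ν.app (X ⊗ Y) (AbMonoidal.μ X Y x y) = AbMonoidal.μ X Y (ν.app X x) (ν.app Y y)) ∧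
  ν.app (𝟙_ J) AbMonoidal.one = AbMonoidal.one

/-- The monoidal functor `F` is representable, with representing object `γ`: it is isomorphic, as
a monoidal functor, to `Hom(γ, -)` with the monoidal structure given by some comonoid structure
on `γ`. -/
def IsRepresentedBy [Preadditive J] (F : J ⥤ AddCommGrpCat.{u}) [AbMonoidal F] (γ : J) : Prop :=
  ∃ (_ : ComonObj γ) (θ : F ≅ preadditiveCoyoneda.obj (Opposite.op γ)),
    (∀ (X Y : J) (x : F.obj X) (y : F.obj Y),
      (θ.hom.app (X ⊗ Y) (AbMonoidal.μ X Y x y) : γ ⟶ X ⊗ Y) =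
        ComonObj.comul ≫ ((θ.hom.app X x : γ ⟶ X) ⊗ₘ (θ.hom.app Y y : γ ⟶ Y))) ∧
    (θ.hom.app (𝟙_ J) AbMonoidal.one : γ ⟶ 𝟙_ J) = ComonObj.counit

end Monoidal

/-! ## Tensor products over noncommutative rings -/

section BalTensor

variable {R M N P M' N' : Type*} [AddCommGroup M] [AddCommGroup N] [AddCommGroup P]
  [AddCommGroup M'] [AddCommGroup N']

/-- The subgroup of `M ⊗ N` generated by the elements `m r ⊗ n - m ⊗ r n`. -/
def balRel (ra : R → M →+ M) (la : R → N →+ N) : AddSubgroup (M ⊗[ℤ] N) :=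
  AddSubgroup.closure {z | ∃ r m n, z = (ra r m) ⊗ₜ[ℤ] n - m ⊗ₜ[ℤ] (la r n)}

/-- The tensor product `M ⊗_R N` for a right action `ra` of `R` on `M` and a left action `la`
of `R` on `N`. -/
def BalTensor (ra : R → M →+ M) (la : R → N →+ N) : Type _ := (M ⊗[ℤ] N) ⧸ balRel ra la

namespace BalTensor

variable {ra : R → M →+ M} {la : R → N →+ N} {ra' : R → M' →+ M'} {la' : R → N' →+ N'}

instance : AddCommGroup (BalTensor ra la) := inferInstanceAs (AddCommGroup (_ ⧸ balRel ra la))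

/-- The projection `M ⊗ N → M ⊗_R N`. -/
def proj (ra : R → M →+ M) (la : R → N →+ N) : M ⊗[ℤ] N →+ BalTensor ra la :=
  QuotientAddGroup.mk' (balRel ra la)

/-- The elementary tensor `m ⊗_R n`. -/
def tmul (ra : R → M →+ M) (la : R → N →+ N) (m : M) (n : N) : BalTensor ra la :=
  proj ra la (m ⊗ₜ[ℤ] n)

theorem tmul_balanced (r : R) (m : M) (n : N) :
    tmul ra la (ra r m) n = tmul ra la m (la r n) := by
  rw [← sub_eq_zero, tmul, tmul, ← map_sub]
  exact (QuotientAddGroup.eq_zero_iff _).2 (AddSubgroup.subset_closure ⟨r, m, n, rfl⟩)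

theorem tmul_add (m : M) (n n' : N) :
    tmul ra la m (n + n') = tmul ra la m n + tmul ra la m n' := by
  simp [tmul, TensorProduct.tmul_add]

theorem add_tmul (m m' : M) (n : N) :
    tmul ra la (m + m') n = tmul ra la m n + tmul ra la m' n := by
  simp [tmul, TensorProduct.add_tmul]

theorem proj_surjective : Function.Surjective (proj ra la) :=
  QuotientAddGroup.mk'_surjective _

/-- Balanced biadditive maps factor through the tensor product. -/
def lift (f : M →+ N →+ P) (hf : ∀ r m n, f (ra r m) n = f m (la r n)) : BalTensor ra la →+ P :=
  QuotientAddGroup.lift (balRel ra la)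
    (TensorProduct.liftAddHom f (fun k m n => by simp))
    (by
      rw [balRel, AddSubgroup.closure_le]
      rintro _ ⟨r, m, n, rfl⟩
      simp [hf])

@[simp]
theorem lift_tmul (f : M →+ N →+ P) (hf : ∀ r m n, f (ra r m) n = f m (la r n)) (m : M) (n : N) :
    lift f hf (tmul ra la m n) = f m n := rfl

theorem hom_ext {f g : BalTensor ra la →+ P} (h : ∀ m n, f (tmul ra la m n) = g (tmul ra la m n)) :
    f = g := by
  ext z
  obtain ⟨z, rfl⟩ := proj_surjective z
  induction z using TensorProduct.induction_on with
  | zero => simp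
  | tmul m n => exact h m n
  | add x y hx hy => simp [hx, hy]

/-- The biadditive map `(m, n) ↦ m ⊗_R n`. -/
def tmulHom (ra : R → M →+ M) (la : R → N →+ N) : M →+ N →+ BalTensor ra la :=
  AddMonoidHom.mk' (fun m => AddMonoidHom.mk' (fun n => tmul ra la m n) (tmul_add m))
    (fun m m' => by ext n; exact add_tmul m m' n)

@[simp]
theorem tmulHom_apply (m : M) (n : N) : tmulHom ra la m n = tmul ra la m n := rfl

/-- The map `f ⊗_R g` for `R`-linear maps `f` and `g`. -/
def map (f : M →+ M') (g : N →+ N') (hf : ∀ r m, f (ra r m) = ra' r (f m))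
    (hg : ∀ r n, g (la r n) = la' r (g n)) : BalTensor ra la →+ BalTensor ra' la' :=
  lift (((tmulHom ra' la').comp f).compl₂ g)
    (fun r m n => by
      simp [hf, hg, tmul_balanced])

@[simp]
theorem map_tmul (f : M →+ M') (g : N →+ N') (hf : ∀ r m, f (ra r m) = ra' r (f m))
    (hg : ∀ r n, g (la r n) = la' r (g n)) (m : M) (n : N) :
    map f g hf hg (tmul ra la m n) = tmul ra' la' (f m) (g n) := rfl

/-- The map `f ⊗_R id`. -/
def mapLeft (la : R → N →+ N) (f : M →+ M') (hf : ∀ r m, f (ra r m) = ra' r (f m)) :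
    BalTensor ra la →+ BalTensor ra' la :=
  map f (AddMonoidHom.id N) hf (fun _ _ => rfl)

@[simp]
theorem mapLeft_tmul (f : M →+ M') (hf : ∀ r m, f (ra r m) = ra' r (f m)) (m : M) (n : N) :
    mapLeft la f hf (tmul ra la m n) = tmul ra' la (f m) n := rfl

/-- The map `id ⊗_R g`. -/
def mapRight (ra : R → M →+ M) (g : N →+ N') (hg : ∀ r n, g (la r n) = la' r (g n)) :
    BalTensor ra la →+ BalTensor ra la' :=
  map (AddMonoidHom.id M) g (fun _ _ => rfl) hg

@[simp]
theorem mapRight_tmul (g : N →+ N') (hg : ∀ r n, g (la r n) = la' r (g n)) (m : M) (n : N) :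
    mapRight ra g hg (tmul ra la m n) = tmul ra la' m (g n) := rfl

end BalTensor

end BalTensor

/-- Essential strongness: with `R = F 𝟙` acting on the groups `F X` through the monoidal structure
and the unitors, the maps `F X ⊗_R F Y → F (X ⊗ Y)` induced by the monoidal structure are
bijective. -/
def EssentiallyStrong {J : Type u} [Category.{u} J] [MonoidalCategory J]
    (F : J ⥤ AddCommGrpCat.{u}) [AbMonoidal F] : Prop :=
  ∀ X Y : J, ∃ φ : BalTensor
      (fun r : F.obj (𝟙_ J) => (F.map (ρ_ X).hom).hom.comp ((AbMonoidal.μ X (𝟙_ J)).flip r))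
      (fun r : F.obj (𝟙_ J) => (F.map (λ_ Y).hom).hom.comp (AbMonoidal.μ (𝟙_ J) Y r))
        →+ F.obj (X ⊗ Y),
    (∀ x y, φ (BalTensor.tmul _ _ x y) = AbMonoidal.μ X Y x y) ∧ Function.Bijective φ

/-! ## Bimodules, corings and comodules over a noncommutative ring -/

section Coring

/-- A right module structure on an abelian group; `act r m = m r`. -/
structure RightAction (R M : Type*) [Ring R] [AddCommGroup M] where
  act : R → M →+ M
  act_one : ∀ m, act 1 m = m
  act_mul : ∀ r s m, act (r * s) m = act s (act r m)
  act_add : ∀ r s m, act (r + s) m = act r m + act s m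

/-- A left module structure on an abelian group; `act r m = r m`. -/
structure LeftAction (R M : Type*) [Ring R] [AddCommGroup M] where
  act : R → M →+ M
  act_one : ∀ m, act 1 m = m
  act_mul : ∀ r s m, act (r * s) m = act r (act s m)
  act_add : ∀ r s m, act (r + s) m = act r m + act s m

/-- An `R`-`R`-bimodule structure on an abelian group. -/
structure Bimodule (R M : Type*) [Ring R] [AddCommGroup M] where
  left : LeftAction R M
  right : RightAction R M
  comm : ∀ r s m, left.act r (right.act s m) = right.act s (left.act r m)

variable {R M N P : Type*} [Ring R] [AddCommGroup M] [AddCommGroup N] [AddCommGroup P]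

/-- The right action on `M ⊗_R N` coming from a bimodule `N`. -/
def RightAction.tensor (X : RightAction R M) (Y : Bimodule R N) :
    RightAction R (BalTensor X.act Y.left.act) where
  act r := BalTensor.mapRight X.act (Y.right.act r) (fun s n => (Y.comm s r n).symm)
  act_one z := by
    refine DFunLike.congr_fun (BalTensor.hom_ext (g := AddMonoidHom.id _) fun m n => ?_) z
    simp [Y.right.act_one]
  act_mul r s z := by
    rw [← AddMonoidHom.comp_apply]
    refine DFunLike.congr_fun (BalTensor.hom_ext fun m n => ?_) z
    simp [Y.right.act_mul]
  act_add r s z := by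
    rw [← AddMonoidHom.add_apply]
    refine DFunLike.congr_fun (BalTensor.hom_ext fun m n => ?_) z
    simp [Y.right.act_add, BalTensor.tmul_add]

/-- The left action on `M ⊗_R N` coming from a bimodule `M`. -/
def LeftAction.tensor (X : Bimodule R M) (Y : LeftAction R N) :
    LeftAction R (BalTensor X.right.act Y.act) where
  act r := BalTensor.mapLeft Y.act (X.left.act r) (fun s m => X.comm r s m)
  act_one z := by
    refine DFunLike.congr_fun (BalTensor.hom_ext (g := AddMonoidHom.id _) fun m n => ?_) z
    simp [X.left.act_one]
  act_mul r s z := by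
    rw [← AddMonoidHom.comp_apply]
    refine DFunLike.congr_fun (BalTensor.hom_ext fun m n => ?_) z
    simp [X.left.act_mul]
  act_add r s z := by
    rw [← AddMonoidHom.add_apply]
    refine DFunLike.congr_fun (BalTensor.hom_ext fun m n => ?_) z
    simp [X.left.act_add, BalTensor.add_tmul]

/-- The biadditive map `(m ⊗ n, p) ↦ m ⊗ (n ⊗ p)`. -/
def BalTensor.assocAux (X : RightAction R M) (Y : Bimodule R N) (Z : LeftAction R P) :
    BalTensor X.act Y.left.act →+ P →+ BalTensor X.act (LeftAction.tensor Y Z).act :=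
  BalTensor.lift
    (AddMonoidHom.mk' (fun m => (tmulHom Y.right.act Z.act).compr₂
        (tmulHom X.act (LeftAction.tensor Y Z).act m))
      (fun m m' => by ext n p; simp))
    (fun r m n => by
      ext p
      exact BalTensor.tmul_balanced (la := (LeftAction.tensor Y Z).act) r m
        (BalTensor.tmul Y.right.act Z.act n p))

theorem BalTensor.assocAux_tmul (X : RightAction R M) (Y : Bimodule R N) (Z : LeftAction R P)
    (m : M) (n : N) (p : P) : BalTensor.assocAux X Y Z (BalTensor.tmul _ _ m n) p =
      BalTensor.tmul _ _ m (BalTensor.tmul _ _ n p) := rfl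

theorem BalTensor.assocAux_balanced (X : RightAction R M) (Y : Bimodule R N) (Z : LeftAction R P)
    (r : R) (z : BalTensor X.act Y.left.act) (p : P) :
    BalTensor.assocAux X Y Z ((X.tensor Y).act r z) p =
      BalTensor.assocAux X Y Z z (Z.act r p) := by
  have h : ((BalTensor.assocAux X Y Z).flip p).comp ((X.tensor Y).act r) =
      (BalTensor.assocAux X Y Z).flip (Z.act r p) := by
    refine BalTensor.hom_ext fun m n => ?_
    have h1 : (X.tensor Y).act r (BalTensor.tmul _ _ m n) =
        BalTensor.tmul _ _ m (Y.right.act r n) := rfl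
    rw [AddMonoidHom.comp_apply, AddMonoidHom.flip_apply, AddMonoidHom.flip_apply, h1,
      BalTensor.assocAux_tmul, BalTensor.assocAux_tmul, BalTensor.tmul_balanced]
  exact DFunLike.congr_fun h z

/-- The associativity map `(M ⊗_R N) ⊗_R P → M ⊗_R (N ⊗_R P)`. -/
def BalTensor.assoc (X : RightAction R M) (Y : Bimodule R N) (Z : LeftAction R P) :
    BalTensor (X.tensor Y).act Z.act →+ BalTensor X.act (LeftAction.tensor Y Z).act :=
  BalTensor.lift (BalTensor.assocAux X Y Z) (BalTensor.assocAux_balanced X Y Z)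

/-- An `R`-coring: a comonoid in the category of `R`-`R`-bimodules. -/
structure Coring (X : Bimodule R M) where
  comul : M →+ BalTensor X.right.act X.left.act
  comul_left : ∀ r m, comul (X.left.act r m) = (LeftAction.tensor X X.left).act r (comul m)
  comul_right : ∀ r m, comul (X.right.act r m) = (X.right.tensor X).act r (comul m)
  counit : M →+ R
  counit_left : ∀ r m, counit (X.left.act r m) = r * counit m
  counit_right : ∀ r m, counit (X.right.act r m) = counit m * r
  coassoc : ∀ m,
    BalTensor.assoc X.right X X.left
      (BalTensor.mapLeft X.left.act comul comul_right (comul m)) =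
    BalTensor.mapRight X.right.act comul comul_left (comul m)
  counit_comul : ∀ m,
    BalTensor.lift (AddMonoidHom.mk' (fun h => X.left.act (counit h))
        (fun h h' => by ext k; simp [X.left.act_add]))
      (fun r h k => by simp [counit_right, X.left.act_mul]) (comul m) = m
  comul_counit : ∀ m,
    BalTensor.lift (AddMonoidHom.mk' (fun h => X.right.act (counit h))
        (fun h h' => by ext k; simp [X.right.act_add])).flip
      (fun r h k => by simp [counit_left, X.right.act_mul]) (comul m) = m

/-- A right comodule over an `R`-coring. -/
structure Comodule {X : Bimodule R M} (K : Coring X) (Y : RightAction R N) where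
  coact : N →+ BalTensor Y.act X.left.act
  coact_right : ∀ r n, coact (Y.act r n) = (Y.tensor X).act r (coact n)
  coassoc : ∀ n,
    BalTensor.assoc Y X X.left
      (BalTensor.mapLeft X.left.act coact coact_right (coact n)) =
    BalTensor.mapRight Y.act K.comul K.comul_left (coact n)
  coact_counit : ∀ n,
    BalTensor.lift (AddMonoidHom.mk' (fun h => Y.act (K.counit h))
        (fun h h' => by ext k; simp [Y.act_add])).flip
      (fun r h k => by simp [K.counit_left, Y.act_mul]) (coact n) = n

end Coring

/-! ## Bialgebroids -/

section Bialgebroid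

variable {R H A B : Type*} [Ring R] [Ring H] [Ring A] [Ring B]

/-- The bimodule structure `r h r' = s(r) t(r') h` of a left bialgebroid. -/
def leftBimodule (s : R →+* H) (t : Rᵐᵒᵖ →+* H)
    (hst : ∀ r r', s r * t (op r') = t (op r') * s r) : Bimodule R H where
  left :=
    { act := fun r => AddMonoidHom.mulLeft (s r)
      act_one := by simp
      act_mul := by simp [mul_assoc]
      act_add := by simp [add_mul] }
  right :=
    { act := fun r => AddMonoidHom.mulLeft (t (op r))
      act_one := by simp
      act_mul := by simp [mul_assoc]
      act_add := by simp [add_mul] }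
  comm r r' h := by simp [← mul_assoc, hst]

/-- The bimodule structure `r h r' = h s(r') t(r)` of a right bialgebroid. -/
def rightBimodule (s : R →+* H) (t : Rᵐᵒᵖ →+* H)
    (hst : ∀ r r', s r * t (op r') = t (op r') * s r) : Bimodule R H where
  left :=
    { act := fun r => AddMonoidHom.mulRight (t (op r))
      act_one := by simp
      act_mul := by simp [mul_assoc]
      act_add := by simp [mul_add] }
  right :=
    { act := fun r => AddMonoidHom.mulRight (s r)
      act_one := by simp
      act_mul := by simp [mul_assoc]
      act_add := by simp [mul_add] }
  comm r r' h := by simp [mul_assoc, hst]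

/-- A left bialgebroid over `R` with total ring `H`. The condition `takeuchi` says that the
coproduct has values in the Takeuchi product
`{∑ h ⊗ h' | ∑ h t(r) ⊗ h' = ∑ h ⊗ h' s(r) for all r}`, on which the factorwise product is well
defined; the latter is computed on arbitrary representatives in the ring `H ⊗ H`. -/
structure LeftBialgebroid (R H : Type*) [Ring R] [Ring H] where
  source : R →+* H
  target : Rᵐᵒᵖ →+* H
  source_target : ∀ r r', source r * target (op r') = target (op r') * source r
  coring : Coring (leftBimodule source target source_target)
  takeuchi : ∀ (h : H) (z : H ⊗[ℤ] H), BalTensor.proj _ _ z = coring.comul h → ∀ r,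
    BalTensor.proj (leftBimodule source target source_target).right.act
      (leftBimodule source target source_target).left.act (z * (target (op r) ⊗ₜ[ℤ] 1)) =
    BalTensor.proj _ _ (z * (1 ⊗ₜ[ℤ] source r))
  comul_one : coring.comul 1 = BalTensor.tmul _ _ 1 1
  comul_mul : ∀ (h h' : H) (z z' : H ⊗[ℤ] H), BalTensor.proj _ _ z = coring.comul h →
    BalTensor.proj _ _ z' = coring.comul h' → coring.comul (h * h') = BalTensor.proj _ _ (z * z')
  counit_one : coring.counit 1 = 1
  counit_mul_source : ∀ h h',
    coring.counit (h * source (coring.counit h')) = coring.counit (h * h')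
  counit_mul_target : ∀ h h',
    coring.counit (h * target (op (coring.counit h'))) = coring.counit (h * h')

/-- A right bialgebroid over `R` with total ring `H`. The condition `takeuchi` says that the
coproduct has values in the Takeuchi product
`{∑ h ⊗ h' | ∑ s(r) h ⊗ h' = ∑ h ⊗ t(r) h' for all r}`. -/
structure RightBialgebroid (R H : Type*) [Ring R] [Ring H] where
  source : R →+* H
  target : Rᵐᵒᵖ →+* H
  source_target : ∀ r r', source r * target (op r') = target (op r') * source r
  coring : Coring (rightBimodule source target source_target)
  takeuchi : ∀ (h : H) (z : H ⊗[ℤ] H), BalTensor.proj _ _ z = coring.comul h → ∀ r,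
    BalTensor.proj (rightBimodule source target source_target).right.act
      (rightBimodule source target source_target).left.act ((source r ⊗ₜ[ℤ] 1) * z) =
    BalTensor.proj _ _ ((1 ⊗ₜ[ℤ] target (op r)) * z)
  comul_one : coring.comul 1 = BalTensor.tmul _ _ 1 1
  comul_mul : ∀ (h h' : H) (z z' : H ⊗[ℤ] H), BalTensor.proj _ _ z = coring.comul h →
    BalTensor.proj _ _ z' = coring.comul h' → coring.comul (h * h') = BalTensor.proj _ _ (z * z')
  counit_one : coring.counit 1 = 1
  counit_source_mul : ∀ h h',
    coring.counit (source (coring.counit h) * h') = coring.counit (h * h')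
  counit_target_mul : ∀ h h',
    coring.counit (target (op (coring.counit h)) * h') = coring.counit (h * h')

/-- The underlying `R`-`R`-bimodule of a left bialgebroid. -/
abbrev LeftBialgebroid.bimodule (L : LeftBialgebroid R H) : Bimodule R H :=
  leftBimodule L.source L.target L.source_target

/-- The underlying `R`-`R`-bimodule of a right bialgebroid. -/
abbrev RightBialgebroid.bimodule (K : RightBialgebroid R H) : Bimodule R H :=
  rightBimodule K.source K.target K.source_target

/-- The right `R`-module structure `a r = a π(r)` of an `R`-ring `π : R → A`. -/
def ringRightAction (π : R →+* A) : RightAction R A where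
  act r := AddMonoidHom.mulRight (π r)
  act_one := by simp
  act_mul := by simp [mul_assoc]
  act_add := by simp [mul_add]

/-- A structure of right comodule algebra over a right bialgebroid on an `R`-ring `π : R → A`:
a comodule over the underlying coring whose coaction takes values in the Takeuchi product
`{∑ a ⊗ h | ∑ r a ⊗ h = ∑ a ⊗ t(r) h}` and is unital and multiplicative,
`(a a')₀ ⊗ (a a')₁ = a₀ a'₀ ⊗ a₁ a'₁`. -/
structure RightBialgebroid.ComoduleAlgebra (K : RightBialgebroid R H) (π : R →+* A) extends
    Comodule K.coring (ringRightAction π) where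
  takeuchi : ∀ (a : A) (z : A ⊗[ℤ] H), BalTensor.proj _ _ z = coact a → ∀ r,
    BalTensor.proj (ringRightAction π).act K.bimodule.left.act ((π r ⊗ₜ[ℤ] 1) * z) =
    BalTensor.proj _ _ ((1 ⊗ₜ[ℤ] K.target (op r)) * z)
  coact_one : coact 1 = BalTensor.tmul _ _ 1 1
  coact_mul : ∀ (a a' : A) (z z' : A ⊗[ℤ] H), BalTensor.proj _ _ z = coact a →
    BalTensor.proj _ _ z' = coact a' → coact (a * a') = BalTensor.proj _ _ (z * z')

/-- The product `(a ⊗ h)(a' ⊗ h') = a a' ⊗ h' h` on `A ⊗ H`. -/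
noncomputable def twistedMul (A H : Type*) [Ring A] [Ring H] :
    A ⊗[ℤ] H →ₗ[ℤ] A ⊗[ℤ] H →ₗ[ℤ] A ⊗[ℤ] H :=
  TensorProduct.map₂ (LinearMap.mul ℤ A) (LinearMap.mul ℤ H).flip

/-- A structure of right comodule algebra over a left bialgebroid on an `R`-ring `π : R → A`
(that is, over the opposite right bialgebroid): a comodule over the underlying coring whose
coaction takes values in the Takeuchi product `{∑ a ⊗ h | ∑ r a ⊗ h = ∑ a ⊗ h s(r)}` and
satisfies `1 ↦ 1 ⊗ 1` and `(a a')₀ ⊗ (a a')₁ = a₀ a'₀ ⊗ a'₁ a₁`. -/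
structure LeftBialgebroid.ComoduleAlgebra (L : LeftBialgebroid R H) (π : R →+* A) extends
    Comodule L.coring (ringRightAction π) where
  takeuchi : ∀ (a : A) (z : A ⊗[ℤ] H), BalTensor.proj _ _ z = coact a → ∀ r,
    BalTensor.proj (ringRightAction π).act L.bimodule.left.act ((π r ⊗ₜ[ℤ] 1) * z) =
    BalTensor.proj _ _ (z * (1 ⊗ₜ[ℤ] L.source r))
  coact_one : coact 1 = BalTensor.tmul _ _ 1 1
  coact_mul : ∀ (a a' : A) (z z' : A ⊗[ℤ] H), BalTensor.proj _ _ z = coact a →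
    BalTensor.proj _ _ z' = coact a' → coact (a * a') = BalTensor.proj _ _ (twistedMul A H z z')

/-- The coinvariants `{a | δ(a) = a ⊗ 1}` of a coaction `δ : A → A ⊗_R H`. -/
def coinvariants {π : R →+* A} {Y : LeftAction R H}
    (δ : A →+ BalTensor (ringRightAction π).act Y.act) : Set A :=
  {a | δ a = BalTensor.tmul _ _ a 1}

/-- Left multiplication by `a` on the first factor of `A ⊗_R H`. -/
def leftMul (π : R →+* A) (Y : LeftAction R H) (a : A) :
    BalTensor (ringRightAction π).act Y.act →+ BalTensor (ringRightAction π).act Y.act :=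
  BalTensor.mapLeft Y.act (AddMonoidHom.mulLeft a) (fun r a' => (mul_assoc a a' (π r)).symm)

/-- The ring homomorphism `ρ : B → A` is a Galois extension for the coaction `δ` on `A`: the
coinvariants are `ρ(B)` and the Galois map `A ⊗_B A → A ⊗_R H`, `a ⊗ a' ↦ a a'₀ ⊗ a'₁` is
(well defined and) bijective. -/
def IsGalois (ρ : B →+* A) {π : R →+* A} {Y : LeftAction R H}
    (δ : A →+ BalTensor (ringRightAction π).act Y.act) : Prop :=
  coinvariants δ = Set.range ρ ∧
  ∃ Γ : BalTensor (fun b : B => AddMonoidHom.mulRight (ρ b))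
      (fun b : B => AddMonoidHom.mulLeft (ρ b)) →+ BalTensor (ringRightAction π).act Y.act,
    (∀ a a', Γ (BalTensor.tmul _ _ a a') = leftMul π Y a (δ a')) ∧ Function.Bijective Γ

/-- The opposite of a left bialgebroid `(L, R, s, t, Δ, ε)` is the right bialgebroid
`(Lᵒᵖ, R, t, s, Δ, ε)`. The ring isomorphism `Φ : H ≃ Lᵒᵖ` is an isomorphism of right bialgebroids
over `R` from `K` to the opposite of `L`. -/
structure IsIsoToOpposite {L' : Type*} [Ring L'] (K : RightBialgebroid R H)
    (L : LeftBialgebroid R L') (Φ : H ≃+* L'ᵐᵒᵖ) : Prop where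
  source : ∀ r, (Φ (K.source r)).unop = L.target (op r)
  target : ∀ r, (Φ (K.target (op r))).unop = L.source r
  counit : ∀ h, L.coring.counit (Φ h).unop = K.coring.counit h
  comul : ∀ (h : H) (z : H ⊗[ℤ] H), BalTensor.proj _ _ z = K.coring.comul h →
    L.coring.comul (Φ h).unop = BalTensor.proj _ _
      (TensorProduct.map
        ((opAddEquiv.symm : L'ᵐᵒᵖ ≃+ L').toAddMonoidHom.comp
          (Φ.toAddEquiv.toAddMonoidHom)).toIntLinearMap
        ((opAddEquiv.symm : L'ᵐᵒᵖ ≃+ L').toAddMonoidHom.comp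
          (Φ.toAddEquiv.toAddMonoidHom)).toIntLinearMap z)

end Bialgebroid

/-! ## The tensor product of a presheaf and a functor -/

section Coend

variable {J : Type u} [Category.{u} J]

open Classical in
/-- The relations `G(t) y ⊗ x = y ⊗ F(t) x` in `⨁ X, G X ⊗ F X`. -/
def coendRel (G : Jᵒᵖ ⥤ AddCommGrpCat.{u}) (F : J ⥤ AddCommGrpCat.{u}) :
    AddSubgroup (⨁ X : J, (G.obj (Opposite.op X)) ⊗[ℤ] (F.obj X)) :=
  AddSubgroup.closure {z | ∃ (X Y : J) (t : X ⟶ Y) (y : G.obj (Opposite.op Y)) (x : F.obj X),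
    z = DirectSum.of (fun X : J => (G.obj (Opposite.op X)) ⊗[ℤ] (F.obj X)) X
          ((G.map t.op y) ⊗ₜ[ℤ] x) -
        DirectSum.of (fun X : J => (G.obj (Opposite.op X)) ⊗[ℤ] (F.obj X)) Y
          (y ⊗ₜ[ℤ] (F.map t x))}

/-- The tensor product over `J` of a contravariant and a covariant functor to abelian groups. -/
def CoendTensor (G : Jᵒᵖ ⥤ AddCommGrpCat.{u}) (F : J ⥤ AddCommGrpCat.{u}) : Type u :=
  (⨁ X : J, (G.obj (Opposite.op X)) ⊗[ℤ] (F.obj X)) ⧸ coendRel G F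

namespace CoendTensor

variable {G : Jᵒᵖ ⥤ AddCommGrpCat.{u}} {F : J ⥤ AddCommGrpCat.{u}}

noncomputable instance : AddCommGroup (CoendTensor G F) :=
  inferInstanceAs (AddCommGroup (_ ⧸ coendRel G F))

/-- The projection from the direct sum. -/
def proj (G : Jᵒᵖ ⥤ AddCommGrpCat.{u}) (F : J ⥤ AddCommGrpCat.{u}) :
    (⨁ X : J, (G.obj (Opposite.op X)) ⊗[ℤ] (F.obj X)) →+ CoendTensor G F :=
  QuotientAddGroup.mk' (coendRel G F)

open Classical in
/-- The element `y ⊗ x` at the object `X`, as a biadditive map. -/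
noncomputable def mkHom (G : Jᵒᵖ ⥤ AddCommGrpCat.{u}) (F : J ⥤ AddCommGrpCat.{u}) (X : J) :
    G.obj (Opposite.op X) →+ F.obj X →+ CoendTensor G F :=
  AddMonoidHom.mk' (fun y => AddMonoidHom.mk' (fun x => proj G F
      (DirectSum.of (fun X : J => (G.obj (Opposite.op X)) ⊗[ℤ] (F.obj X)) X (y ⊗ₜ[ℤ] x)))
      (fun x x' => by rw [TensorProduct.tmul_add, map_add, map_add]))
    (fun y y' => by
      ext x
      simp only [AddMonoidHom.add_apply, AddMonoidHom.mk'_apply]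
      rw [TensorProduct.add_tmul, map_add, map_add])

/-- The element `y ⊗ x` at the object `X`. -/
noncomputable def mk (G : Jᵒᵖ ⥤ AddCommGrpCat.{u}) (F : J ⥤ AddCommGrpCat.{u}) (X : J)
    (y : G.obj (Opposite.op X)) (x : F.obj X) : CoendTensor G F :=
  mkHom G F X y x

theorem mk_rel {X Y : J} (t : X ⟶ Y) (y : G.obj (Opposite.op Y)) (x : F.obj X) :
    mk G F X (G.map t.op y) x = mk G F Y y (F.map t x) := by
  classical
  rw [← sub_eq_zero]
  change proj G F _ - proj G F _ = 0
  rw [← map_sub]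
  exact (QuotientAddGroup.eq_zero_iff _).2 (AddSubgroup.subset_closure ⟨X, Y, t, y, x, rfl⟩)

theorem hom_ext {P : Type*} [AddCommGroup P] {f g : CoendTensor G F →+ P}
    (h : ∀ X y x, f (mk G F X y x) = g (mk G F X y x)) : f = g := by
  classical
  refine QuotientAddGroup.addMonoidHom_ext _ ?_
  refine DirectSum.addHom_ext' fun X => ?_
  ext z
  induction z using TensorProduct.induction_on with
  | zero => simp
  | tmul y x => exact h X y x
  | add z w hz hw => rw [map_add, map_add, hz, hw]

open Classical in
/-- The universal property of the tensor product over `J`. -/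
noncomputable def lift {P : Type*} [AddCommGroup P]
    (φ : ∀ X : J, G.obj (Opposite.op X) →+ F.obj X →+ P)
    (hφ : ∀ (X Y : J) (t : X ⟶ Y) (y : G.obj (Opposite.op Y)) (x : F.obj X),
      φ X (G.map t.op y) x = φ Y y (F.map t x)) : CoendTensor G F →+ P :=
  QuotientAddGroup.lift (coendRel G F)
    (DirectSum.toAddMonoid fun X => TensorProduct.liftAddHom (φ X) (fun k y x => by simp))
    (by
      rw [coendRel, AddSubgroup.closure_le]
      rintro _ ⟨X, Y, t, y, x, rfl⟩
      simp [hφ])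

theorem lift_mk {P : Type*} [AddCommGroup P]
    (φ : ∀ X : J, G.obj (Opposite.op X) →+ F.obj X →+ P)
    (hφ : ∀ (X Y : J) (t : X ⟶ Y) (y : G.obj (Opposite.op Y)) (x : F.obj X),
      φ X (G.map t.op y) x = φ Y y (F.map t x)) (X : J) (y : G.obj (Opposite.op X))
    (x : F.obj X) : lift φ hφ (mk G F X y x) = φ X y x := by
  classical
  change DirectSum.toAddMonoid (fun X => TensorProduct.liftAddHom (φ X) _) (DirectSum.of _ X _) = _
  rw [DirectSum.toAddMonoid_of, TensorProduct.liftAddHom_tmul]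

theorem mk_add_left (X : J) (y y' : G.obj (Opposite.op X)) (x : F.obj X) :
    mk G F X (y + y') x = mk G F X y x + mk G F X y' x := by
  simp [mk]

theorem mk_add_right (X : J) (y : G.obj (Opposite.op X)) (x x' : F.obj X) :
    mk G F X y (x + x') = mk G F X y x + mk G F X y x' := by
  simp [mk]

variable [MonoidalCategory J] [AbMonoidal G] [AbMonoidal F]

theorem mk_mul_rel {X X' Y Y' : J} (t : X ⟶ X') (s : Y ⟶ Y')
    (y : G.obj (Opposite.op X')) (y' : G.obj (Opposite.op Y')) (x : F.obj X) (x' : F.obj Y) :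
    mk G F (X ⊗ Y) (AbMonoidal.μ (Opposite.op X) (Opposite.op Y) (G.map t.op y) (G.map s.op y'))
      (AbMonoidal.μ X Y x x') =
    mk G F (X' ⊗ Y') (AbMonoidal.μ (Opposite.op X') (Opposite.op Y') y y')
      (AbMonoidal.μ X' Y' (F.map t x) (F.map s x')) := by
  rw [AbMonoidal.μ_natural, AbMonoidal.μ_natural]
  exact mk_rel (t ⊗ₘ s) _ _

/-- Left multiplication by `y ⊗ x`. -/
noncomputable def mulAux (X : J) (y : G.obj (Opposite.op X)) (x : F.obj X) :
    CoendTensor G F →+ CoendTensor G F :=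
  lift (fun Y => ((mkHom G F (X ⊗ Y)).comp
      (AbMonoidal.μ (Opposite.op X) (Opposite.op Y) y)).compl₂ (AbMonoidal.μ X Y x))
    (fun Y Y' s y' x' => by
      have h := mk_mul_rel (G := G) (F := F) (𝟙 X) s y y' x x'
      have hx : F.map (𝟙 X) x = x := by simp
      have hy : G.map (𝟙 X).op y = y := by simp
      rw [hx, hy] at h
      exact h)

theorem mulAux_mk (X Y : J) (y : G.obj (Opposite.op X)) (x : F.obj X)
    (y' : G.obj (Opposite.op Y)) (x' : F.obj Y) :
    mulAux X y x (mk G F Y y' x') =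
      mk G F (X ⊗ Y) (AbMonoidal.μ (Opposite.op X) (Opposite.op Y) y y')
        (AbMonoidal.μ X Y x x') :=
  lift_mk _ _ Y y' x'

/-- Multiplication `(y ⊗ x)(y' ⊗ x') = y y' ⊗ x x'`. -/
noncomputable def mulHom : CoendTensor G F →+ CoendTensor G F →+ CoendTensor G F :=
  lift (fun X => AddMonoidHom.mk' (fun y => AddMonoidHom.mk' (fun x => mulAux X y x)
      (fun x x' => hom_ext fun Y y' w => by
        rw [AddMonoidHom.add_apply, mulAux_mk, mulAux_mk, mulAux_mk, map_add,
          AddMonoidHom.add_apply, mk_add_right]))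
      (fun y₁ y₂ => by
        ext x : 1
        refine hom_ext fun Y y' w => ?_
        simp only [AddMonoidHom.mk'_apply, AddMonoidHom.add_apply]
        rw [mulAux_mk, mulAux_mk, mulAux_mk, map_add, AddMonoidHom.add_apply, mk_add_left]))
    (fun X X' t y x => hom_ext fun Y y' w => by
      simp only [AddMonoidHom.mk'_apply]
      rw [mulAux_mk, mulAux_mk]
      have h := mk_mul_rel (G := G) (F := F) t (𝟙 Y) y y' x w
      have hx : F.map (𝟙 Y) w = w := by simp
      have hy : G.map (𝟙 Y).op y' = y' := by simp
      rw [hx, hy] at h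
      exact h)

theorem mulHom_mk (X Y : J) (y : G.obj (Opposite.op X)) (x : F.obj X)
    (y' : G.obj (Opposite.op Y)) (x' : F.obj Y) :
    mulHom (mk G F X y x) (mk G F Y y' x') =
      mk G F (X ⊗ Y) (AbMonoidal.μ (Opposite.op X) (Opposite.op Y) y y')
        (AbMonoidal.μ X Y x x') := by
  rw [mulHom, lift_mk]
  exact mulAux_mk X Y y x y' x'

theorem mulHom_assoc (a b c : CoendTensor G F) :
    mulHom (mulHom a b) c = mulHom a (mulHom b c) := by
  have h : (mulHom (G := G) (F := F)).compr₂ mulHom =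
      (AddMonoidHom.compHom.comp (mulHom (G := G) (F := F))).compl₂ mulHom := by
    refine hom_ext fun X y x => hom_ext fun Y y' x' => hom_ext fun Z y'' x'' => ?_
    change mulHom (mulHom (mk G F X y x) (mk G F Y y' x')) (mk G F Z y'' x'') =
      mulHom (mk G F X y x) (mulHom (mk G F Y y' x') (mk G F Z y'' x''))
    rw [mulHom_mk, mulHom_mk, mulHom_mk, mulHom_mk, ← AbMonoidal.μ_assoc (F := F), ← mk_rel]
    congr 1
    have h := AbMonoidal.μ_assoc (F := G) y y' y''
    have h2 : (α_ (Opposite.op X) (Opposite.op Y) (Opposite.op Z)).hom ≫ (α_ X Y Z).hom.op = 𝟙 _ :=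
      (α_ (Opposite.op X) (Opposite.op Y) (Opposite.op Z)).hom_inv_id
    refine Eq.trans ?_ (congrArg (fun w => G.map (α_ X Y Z).hom.op w) h)
    rw [← ConcreteCategory.comp_apply, ← G.map_comp, h2]
    simp
  exact DFunLike.congr_fun (DFunLike.congr_fun (DFunLike.congr_fun h a) b) c

theorem one_mulHom (a : CoendTensor G F) :
    mulHom (mk G F (𝟙_ J) (AbMonoidal.one (F := G)) (AbMonoidal.one (F := F))) a = a := by
  have h : mulHom (mk G F (𝟙_ J) (AbMonoidal.one (F := G)) (AbMonoidal.one (F := F))) =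
      AddMonoidHom.id _ := by
    refine hom_ext fun X y x => ?_
    rw [mulHom_mk, AddMonoidHom.id_apply]
    conv_rhs => rw [← AbMonoidal.one_μ (F := F) x, ← mk_rel]
    congr 1
    have h := AbMonoidal.one_μ (F := G) y
    conv_rhs => rw [← h, ← ConcreteCategory.comp_apply, ← G.map_comp]
    have h2 : (λ_ (Opposite.op X)).hom ≫ (λ_ X).hom.op = 𝟙 _ :=
      (λ_ (Opposite.op X)).hom_inv_id
    rw [h2]
    simp
  exact DFunLike.congr_fun h a

theorem mulHom_one (a : CoendTensor G F) :
    mulHom a (mk G F (𝟙_ J) (AbMonoidal.one (F := G)) (AbMonoidal.one (F := F))) = a := by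
  have h : mulHom.flip (mk G F (𝟙_ J) (AbMonoidal.one (F := G)) (AbMonoidal.one (F := F))) =
      AddMonoidHom.id _ := by
    refine hom_ext fun X y x => ?_
    rw [AddMonoidHom.flip_apply, mulHom_mk, AddMonoidHom.id_apply]
    conv_rhs => rw [← AbMonoidal.μ_one (F := F) x, ← mk_rel]
    congr 1
    have h := AbMonoidal.μ_one (F := G) y
    conv_rhs => rw [← h, ← ConcreteCategory.comp_apply, ← G.map_comp]
    have h2 : (ρ_ (Opposite.op X)).hom ≫ (ρ_ X).hom.op = 𝟙 _ :=
      (ρ_ (Opposite.op X)).hom_inv_id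
    rw [h2]
    simp
  exact DFunLike.congr_fun h a

noncomputable instance : Ring (CoendTensor G F) :=
  { (inferInstance : AddCommGroup (CoendTensor G F)) with
    mul := fun a b => mulHom a b
    one := mk G F (𝟙_ J) (AbMonoidal.one (F := G)) (AbMonoidal.one (F := F))
    mul_assoc := mulHom_assoc
    one_mul := one_mulHom
    mul_one := mulHom_one
    left_distrib := fun a b c => map_add (mulHom a) b c
    right_distrib := fun a b c => by
      change mulHom (a + b) c = mulHom a c + mulHom b c
      rw [map_add, AddMonoidHom.add_apply]
    zero_mul := fun a => by
      change mulHom 0 a = 0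
      rw [map_zero, AddMonoidHom.zero_apply]
    mul_zero := fun a => map_zero (mulHom a) }

theorem mk_mul_mk (X Y : J) (y : G.obj (Opposite.op X)) (x : F.obj X)
    (y' : G.obj (Opposite.op Y)) (x' : F.obj Y) :
    mk G F X y x * mk G F Y y' x' =
      mk G F (X ⊗ Y) (AbMonoidal.μ (Opposite.op X) (Opposite.op Y) y y')
        (AbMonoidal.μ X Y x x') := mulHom_mk X Y y x y' x'

theorem mk_eq_mk_mul_mk {X Y Z : J} (t : X ⊗ Y ⟶ Z) {y : G.obj (Opposite.op X)} {x : F.obj X}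
    {y' : G.obj (Opposite.op Y)} {x' : F.obj Y} {w : G.obj (Opposite.op Z)} {v : F.obj Z}
    (hw : G.map t.op w = AbMonoidal.μ (Opposite.op X) (Opposite.op Y) y y')
    (hv : F.map t (AbMonoidal.μ X Y x x') = v) :
    mk G F Z w v = mk G F X y x * mk G F Y y' x' := by
  rw [mk_mul_mk, ← hv, ← mk_rel, hw]

theorem one_def : (1 : CoendTensor G F) =
    mk G F (𝟙_ J) (AbMonoidal.one (F := G)) (AbMonoidal.one (F := F)) := rfl

end CoendTensor
end Coend

/-! ## The basic presheaf, fiber functors and field algebras -/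

section FieldAlgebra

variable {A B : Type u} [Ring A] [Ring B]

/-- `σ` is implementable in the extension `ρ : B → A`. -/
def Implementable (ρ : B →+* A) (σ : B →+* B) : Prop :=
  ∃ (n : ℕ) (f : Fin n → intertwiner ρ (ρ.comp σ)) (f' : Fin n → intertwiner (ρ.comp σ) ρ),
    ∀ b, ρ (σ b) = ∑ i, (f i : A) * ρ b * (f' i : A)

variable (C : ObjectProperty (EndCat B))

/-- The basic presheaf `Υ` on `C`: the constant object map `α ↦ B`, with arrows acting by right
multiplication. -/
def basicPresheaf : (C.FullSubcategory)ᵒᵖ ⥤ AddCommGrpCat.{u} where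
  obj _ := AddCommGrpCat.of B
  map t := AddCommGrpCat.ofHom (AddMonoidHom.mulRight (t.unop.hom.1 : B))
  map_id _ := by
    ext b
    exact mul_one b
  map_comp t s := by
    ext b
    exact (mul_assoc b _ _).symm

/-- The functor `F(α) = Hom(ρ, ρα)`, with `F(t) x = ρ(t) x`. -/
def fiberFunctor (ρ : B →+* A) : C.FullSubcategory ⥤ AddCommGrpCat.{u} where
  obj α := AddCommGrpCat.of (intertwiner ρ (ρ.comp α.obj.hom))
  map {α β} t := AddCommGrpCat.ofHom (AddMonoidHom.mk'
    (fun x => (⟨ρ t.hom.1 * x.1, fun b => by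
      have h := t.hom.2 b
      have hx := x.2 b
      simp only [RingHom.comp_apply] at hx ⊢
      rw [mul_assoc, hx, ← mul_assoc, ← map_mul, h, map_mul, mul_assoc]⟩ :
        intertwiner ρ (ρ.comp β.obj.hom)))
    (fun x y => Subtype.ext (mul_add _ _ _)))
  map_id α := by
    ext x
    change ρ 1 * x.1 = x.1
    rw [map_one, one_mul]
  map_comp t s := by
    ext x
    change ρ (s.hom.1 * t.hom.1) * x.1 = ρ s.hom.1 * (ρ t.hom.1 * x.1)
    rw [map_mul, mul_assoc]

/-- The dual functor `α ↦ Hom(ρα, ρ)`, contravariant, with `t` acting by `f ↦ f ρ(t)`. -/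
def dualFunctor (ρ : B →+* A) : (C.FullSubcategory)ᵒᵖ ⥤ AddCommGrpCat.{u} where
  obj α := AddCommGrpCat.of (intertwiner (ρ.comp α.unop.obj.hom) ρ)
  map {β α} t := AddCommGrpCat.ofHom (AddMonoidHom.mk'
    (fun f => (⟨f.1 * ρ t.unop.hom.1, fun b => by
      have h := t.unop.hom.2 b
      have hf := f.2 b
      simp only [RingHom.comp_apply] at hf ⊢
      rw [mul_assoc, ← map_mul, h, map_mul, ← mul_assoc, hf, mul_assoc]⟩ :
        intertwiner (ρ.comp α.unop.obj.hom) ρ))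
    (fun x y => Subtype.ext (add_mul _ _ _)))
  map_id α := by
    ext f
    change f.1 * ρ 1 = f.1
    rw [map_one, mul_one]
  map_comp t s := by
    ext f
    change f.1 * ρ (t.unop.hom.1 * s.unop.hom.1) = f.1 * ρ t.unop.hom.1 * ρ s.unop.hom.1
    rw [map_mul, mul_assoc]

variable [C.IsMonoidal]

/-- The map `b ⊗ b' ↦ b α(b')`. -/
def mulPresheaf (α : B →+* B) : B →+ B →+ B :=
  AddMonoidHom.mk' (fun b => (AddMonoidHom.mulLeft b).comp (α : B →+ B))
    (fun b b' => by ext c; exact add_mul b b' (α c))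

/-- The map `Hom(ρ, ρα) ⊗ Hom(ρ, ρβ) → Hom(ρ, ραβ)`, `x ⊗ y ↦ x y`. -/
def mulFiber (ρ : B →+* A) (α β : B →+* B) : intertwiner ρ (ρ.comp α) →+
    intertwiner ρ (ρ.comp β) →+ intertwiner ρ (ρ.comp (α.comp β)) :=
  AddMonoidHom.mk' (fun x => AddMonoidHom.mk' (fun y => ⟨x.1 * y.1, fun b => by
      have hx : x.1 * ρ (β b) = ρ (α (β b)) * x.1 := x.2 (β b)
      have hy : y.1 * ρ b = ρ (β b) * y.1 := y.2 b
      change x.1 * y.1 * ρ b = ρ (α (β b)) * (x.1 * y.1)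
      rw [mul_assoc, hy, ← mul_assoc, hx, mul_assoc]⟩)
      (fun y y' => Subtype.ext (mul_add _ _ _)))
    (fun x x' => AddMonoidHom.ext fun y => Subtype.ext (add_mul _ _ _))

/-- The map `Hom(ρα, ρ) ⊗ Hom(ρβ, ρ) → Hom(ραβ, ρ)`, `f ⊗ g ↦ g f`. -/
def mulDual (ρ : B →+* A) (α β : B →+* B) : intertwiner (ρ.comp α) ρ →+
    intertwiner (ρ.comp β) ρ →+ intertwiner (ρ.comp (α.comp β)) ρ :=
  AddMonoidHom.mk' (fun f => AddMonoidHom.mk' (fun g => ⟨g.1 * f.1, fun b => by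
      have hf : f.1 * ρ (α (β b)) = ρ (β b) * f.1 := f.2 (β b)
      have hg : g.1 * ρ (β b) = ρ b * g.1 := g.2 b
      change g.1 * f.1 * ρ (α (β b)) = ρ b * (g.1 * f.1)
      rw [mul_assoc, hf, ← mul_assoc, hg, mul_assoc]⟩)
      (fun y y' => Subtype.ext (add_mul _ _ _)))
    (fun x x' => AddMonoidHom.ext fun y => Subtype.ext (mul_add _ _ _))

/-- The monoidal structure `b ⊗ b' ↦ b α(b')` of the basic presheaf. -/
instance : AbMonoidal (basicPresheaf C) where
  μ α _ := mulPresheaf (B := B) α.unop.obj.hom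
  one := (1 : B)
  μ_natural {α α' β β'} t s := fun (b b' : B) => by
    change b * t.unop.hom.1 * α'.unop.obj.hom (b' * s.unop.hom.1) =
      b * α.unop.obj.hom b' * (t.unop.hom.1 * α'.unop.obj.hom s.unop.hom.1)
    rw [map_mul, mul_assoc, ← mul_assoc t.unop.hom.1, t.unop.hom.2 b']
    simp only [mul_assoc]
  μ_assoc {α β γ} := fun (b b' b'' : B) => by
    change b * α.unop.obj.hom b' * α.unop.obj.hom (β.unop.obj.hom b'') * 1 =
      b * α.unop.obj.hom (b' * β.unop.obj.hom b'')
    rw [map_mul, mul_one, mul_assoc]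
  one_μ {α} := fun (b : B) => by
    change 1 * b * 1 = b
    rw [one_mul, mul_one]
  μ_one {α} := fun (b : B) => by
    change b * α.unop.obj.hom 1 * 1 = b
    rw [map_one, mul_one, mul_one]

/-- The monoidal structure `x ⊗ y ↦ x y` of the fiber functor. -/
instance (ρ : B →+* A) : AbMonoidal (fiberFunctor C ρ) where
  μ α β := mulFiber ρ α.obj.hom β.obj.hom
  one := (⟨1, fun b => (one_mul _).trans (mul_one _).symm⟩ : intertwiner ρ (ρ.comp (RingHom.id B)))
  μ_natural {α α' β β'} t s x y := Subtype.ext (by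
    have hx : x.1 * ρ s.hom.1 = ρ (α.obj.hom s.hom.1) * x.1 := x.2 s.hom.1
    change ρ t.hom.1 * x.1 * (ρ s.hom.1 * y.1) =
      ρ (t.hom.1 * α.obj.hom s.hom.1) * (x.1 * y.1)
    rw [map_mul, mul_assoc, ← mul_assoc x.1, hx]
    simp only [mul_assoc])
  μ_assoc {α β γ} x y z := Subtype.ext (by
    change ρ 1 * (x.1 * y.1 * z.1) = x.1 * (y.1 * z.1)
    rw [map_one, one_mul, mul_assoc])
  one_μ {α} x := Subtype.ext (by
    change ρ 1 * (1 * x.1) = x.1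
    rw [map_one, one_mul, one_mul])
  μ_one {α} x := Subtype.ext (by
    change ρ 1 * (x.1 * 1) = x.1
    rw [map_one, one_mul, mul_one])

/-- The monoidal structure `f ⊗ g ↦ g f` of the dual functor. -/
instance (ρ : B →+* A) : AbMonoidal (dualFunctor C ρ) where
  μ α β := mulDual ρ α.unop.obj.hom β.unop.obj.hom
  one := (⟨1, fun b => (one_mul _).trans (mul_one _).symm⟩ : intertwiner (ρ.comp (RingHom.id B)) ρ)
  μ_natural {α α' β β'} t s f g := Subtype.ext (by
    have hf : f.1 * ρ (α.unop.obj.hom s.unop.hom.1) = ρ s.unop.hom.1 * f.1 := f.2 s.unop.hom.1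
    have ht : t.unop.hom.1 * α'.unop.obj.hom s.unop.hom.1 =
      α.unop.obj.hom s.unop.hom.1 * t.unop.hom.1 := t.unop.hom.2 s.unop.hom.1
    change g.1 * ρ s.unop.hom.1 * (f.1 * ρ t.unop.hom.1) =
      g.1 * f.1 * ρ (t.unop.hom.1 * α'.unop.obj.hom s.unop.hom.1)
    rw [ht, map_mul, mul_assoc, ← mul_assoc (ρ s.unop.hom.1), ← hf]
    simp only [mul_assoc])
  μ_assoc {α β γ} f g h := Subtype.ext (by
    change h.1 * (g.1 * f.1) * ρ 1 = h.1 * g.1 * f.1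
    rw [map_one, mul_one, mul_assoc])
  one_μ {α} f := Subtype.ext (by
    change f.1 * 1 * ρ 1 = f.1
    rw [map_one, mul_one, mul_one])
  μ_one {α} f := Subtype.ext (by
    change 1 * f.1 * ρ 1 = f.1
    rw [map_one, mul_one, one_mul])

/-- The field algebra `Υ ⊗_C F` of a monoidal functor `F`. -/
abbrev FieldAlgebra (F : C.FullSubcategory ⥤ AddCommGrpCat.{u}) : Type u :=
  CoendTensor (basicPresheaf C) F

/-- The element `b ⊗_α x` of a field algebra. -/
noncomputable abbrev fieldMk (F : C.FullSubcategory ⥤ AddCommGrpCat.{u}) (α : C.FullSubcategory)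
    (b : B) (x : F.obj α) : FieldAlgebra C F :=
  CoendTensor.mk (basicPresheaf C) F α b x

/-- The field algebra extension `ρ_F : B → Υ ⊗_C F`, `b ↦ b ⊗ 1`. -/
noncomputable def fieldExt (F : C.FullSubcategory ⥤ AddCommGrpCat.{u}) [AbMonoidal F] :
    B →+* FieldAlgebra C F where
  toFun b := fieldMk C F (𝟙_ C.FullSubcategory) b AbMonoidal.one
  map_one' := rfl
  map_zero' := by
    change CoendTensor.mkHom (basicPresheaf C) F (𝟙_ C.FullSubcategory) (0 : B) _ = 0
    exact (DFunLike.congr_fun (map_zero _) _).trans rfl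
  map_add' b b' := CoendTensor.mk_add_left _ _ _ _
  map_mul' b b' := CoendTensor.mk_eq_mk_mul_mk (λ_ (𝟙_ C.FullSubcategory)).hom
    (mul_one (b * b')) (AbMonoidal.one_μ (F := F) (X := 𝟙_ C.FullSubcategory) AbMonoidal.one)

/-- The element `f ⊗_α x` of `F^l ⊗_C F` for `F = Hom(ρ, ρ-)`. -/
noncomputable abbrev dualMk (ρ : B →+* A) (α : C.FullSubcategory)
    (f : intertwiner (ρ.comp α.obj.hom) ρ) (x : intertwiner ρ (ρ.comp α.obj.hom)) :
    CoendTensor (dualFunctor C ρ) (fiberFunctor C ρ) :=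
  CoendTensor.mk (dualFunctor C ρ) (fiberFunctor C ρ) α f x

/-- The ring homomorphism `π_F : R → Υ ⊗_C F`, `r ↦ 1 ⊗ r`, for `F = Hom(ρ, ρ-)` and
`R = F(ι) = End(ρ)`. -/
noncomputable def fieldBase (ρ : B →+* A) : endRing ρ →+* FieldAlgebra C (fiberFunctor C ρ) where
  toFun r := fieldMk C (fiberFunctor C ρ) (𝟙_ C.FullSubcategory) 1
    (⟨r.1, r.2⟩ : intertwiner ρ (ρ.comp (RingHom.id B)))
  map_one' := rfl
  map_zero' := map_zero (CoendTensor.mkHom (basicPresheaf C) (fiberFunctor C ρ)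
    (𝟙_ C.FullSubcategory) (1 : B))
  map_add' r r' := CoendTensor.mk_add_right (F := fiberFunctor C ρ) _ _ _ _
  map_mul' r r' := CoendTensor.mk_eq_mk_mul_mk (F := fiberFunctor C ρ)
    (λ_ (𝟙_ C.FullSubcategory)).hom
    (by
      change (1 : B) * 1 = 1 * (RingHom.id B) 1
      simp)
    (Subtype.ext (by
      change ρ 1 * (r.1 * r'.1) = r.1 * r'.1
      rw [map_one, one_mul]))

theorem fieldMk_mem (F : C.FullSubcategory ⥤ AddCommGrpCat.{u}) [AbMonoidal F]
    (α : C.FullSubcategory) (x : F.obj α) :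
    fieldMk C F α 1 x ∈ intertwiner (fieldExt C F) ((fieldExt C F).comp α.obj.hom) := by
  intro b
  have h1 : fieldMk C F α (α.obj.hom b) x = fieldMk C F α 1 x * fieldExt C F b :=
    CoendTensor.mk_eq_mk_mul_mk (ρ_ α).hom
      (by
        change α.obj.hom b * 1 = 1 * α.obj.hom b
        simp)
      (AbMonoidal.μ_one x)
  have h2 : fieldMk C F α (α.obj.hom b) x = fieldExt C F (α.obj.hom b) * fieldMk C F α 1 x :=
    CoendTensor.mk_eq_mk_mul_mk (λ_ α).hom
      (by
        change α.obj.hom b * 1 = α.obj.hom b * (RingHom.id B) 1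
        simp)
      (AbMonoidal.one_μ x)
  exact h1.symm.trans h2

/-- The unit `η_F : F → Hom(ρ_F, ρ_F -)`, `x ↦ 1 ⊗_α x`, of the adjunction between monoidal
functors and extensions of `B`. -/
noncomputable def fieldUnit (F : C.FullSubcategory ⥤ AddCommGrpCat.{u}) [AbMonoidal F] :
    F ⟶ fiberFunctor C (fieldExt C F) where
  app α := AddCommGrpCat.ofHom (AddMonoidHom.mk'
    (fun x => (⟨fieldMk C F α 1 x, fieldMk_mem C F α x⟩ :
      intertwiner (fieldExt C F) ((fieldExt C F).comp α.obj.hom)))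
    (fun x y => Subtype.ext (CoendTensor.mk_add_right _ _ _ _)))
  naturality α β t := by
    ext x
    refine Subtype.ext ?_
    change fieldMk C F β 1 (F.map t x) = fieldExt C F t.hom.1 * fieldMk C F α 1 x
    have h : fieldMk C F α t.hom.1 x = fieldExt C F t.hom.1 * fieldMk C F α 1 x :=
      CoendTensor.mk_eq_mk_mul_mk (λ_ α).hom
        (by
          change t.hom.1 * 1 = t.hom.1 * (RingHom.id B) 1
          simp)
        (AbMonoidal.one_μ x)
    refine Eq.trans ?_ h
    refine (CoendTensor.mk_rel (G := basicPresheaf C) t (1 : B) x).symm.trans ?_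
    exact congrArg (fun b : B => fieldMk C F α b x) (one_mul t.hom.1)

/-- The biadditive map `b ⊗ x ↦ ρ(b) x`. -/
def counitAux (ρ : B →+* A) (α : B →+* B) : B →+ intertwiner ρ (ρ.comp α) →+ A :=
  AddMonoidHom.mk' (fun b => (AddMonoidHom.mulLeft (ρ b)).comp
      (intertwiner ρ (ρ.comp α)).subtype)
    (fun b b' => by
      ext x
      change ρ (b + b') * x.1 = ρ b * x.1 + ρ b' * x.1
      rw [map_add, add_mul])

/-- The additive map underlying the counit. -/
noncomputable def fieldCounitHom (ρ : B →+* A) : FieldAlgebra C (fiberFunctor C ρ) →+ A :=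
  CoendTensor.lift (G := basicPresheaf C) (F := fiberFunctor C ρ)
    (fun α => counitAux ρ α.obj.hom)
    (fun α β t => fun (b : B) x => by
      change ρ (b * t.hom.1) * x.1 = ρ b * (ρ t.hom.1 * x.1)
      rw [map_mul, mul_assoc])

theorem fieldCounitHom_mk (ρ : B →+* A) (α : C.FullSubcategory) (b : B)
    (x : intertwiner ρ (ρ.comp α.obj.hom)) :
    fieldCounitHom C ρ (fieldMk C (fiberFunctor C ρ) α b x) = ρ b * x.1 :=
  CoendTensor.lift_mk (G := basicPresheaf C) (F := fiberFunctor C ρ) _ _ α b x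

/-- The counit `ε_ρ : Υ ⊗_C F → A`, `b ⊗_α x ↦ ρ(b) x`, for `F = Hom(ρ, ρ-)`. -/
noncomputable def fieldCounit (ρ : B →+* A) : FieldAlgebra C (fiberFunctor C ρ) →+* A where
  __ := fieldCounitHom C ρ
  map_one' := by
    change fieldCounitHom C ρ (fieldMk C (fiberFunctor C ρ) _ 1 _) = 1
    refine (fieldCounitHom_mk C ρ _ _ _).trans ?_
    change ρ 1 * 1 = 1
    simp
  map_mul' a a' := by
    have h : (CoendTensor.mulHom).compr₂ (fieldCounitHom C ρ) =
        (AddMonoidHom.mul.comp (fieldCounitHom C ρ)).compl₂ (fieldCounitHom C ρ) := by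
      refine CoendTensor.hom_ext fun α (b : B) x => CoendTensor.hom_ext fun β (b' : B) x' => ?_
      have hx : x.1 * ρ b' = ρ (α.obj.hom b') * x.1 := x.2 b'
      change fieldCounitHom C ρ (CoendTensor.mulHom (fieldMk C (fiberFunctor C ρ) α b x)
        (fieldMk C (fiberFunctor C ρ) β b' x')) =
        fieldCounitHom C ρ (fieldMk C (fiberFunctor C ρ) α b x) *
          fieldCounitHom C ρ (fieldMk C (fiberFunctor C ρ) β b' x')
      refine Eq.trans ?_ (congrArg₂ (· * ·) (fieldCounitHom_mk C ρ α b x)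
        (fieldCounitHom_mk C ρ β b' x')).symm
      refine (congrArg (fieldCounitHom C ρ) (CoendTensor.mulHom_mk α β _ _ _ _)).trans ?_
      refine (fieldCounitHom_mk C ρ (α ⊗ β) (b * α.obj.hom b')
        (mulFiber ρ α.obj.hom β.obj.hom x x')).trans ?_
      change ρ (b * α.obj.hom b') * (x.1 * x'.1) = ρ b * x.1 * (ρ b' * x'.1)
      rw [map_mul, mul_assoc (ρ b) x.1, ← mul_assoc x.1, hx]
      simp only [mul_assoc]
    exact DFunLike.congr_fun (DFunLike.congr_fun h a) a'

theorem fieldCounit_mk (ρ : B →+* A) (α : C.FullSubcategory) (b : B)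
    (x : intertwiner ρ (ρ.comp α.obj.hom)) :
    fieldCounit C ρ (fieldMk C (fiberFunctor C ρ) α b x) = ρ b * x.1 :=
  fieldCounitHom_mk C ρ α b x

/-! ## The bialgebroids and coactions -/

/-- A direct summand diagram `ρα → ρ → ρα`, with arrows `p i` and `q i` and `∑ q i p i = 1`. -/
def IsSummandDiagram {ρ : B →+* A} {α : B →+* B} {n : ℕ}
    (p : Fin n → intertwiner (ρ.comp α) ρ) (q : Fin n → intertwiner ρ (ρ.comp α)) : Prop :=
  ∑ i, (q i : A) * (p i : A) = 1

/-- The total ring `F^l ⊗_C F` for `F = Hom(ρ, ρ-)`. -/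
abbrev DualCoend (ρ : B →+* A) : Type u := CoendTensor (dualFunctor C ρ) (fiberFunctor C ρ)

/-- The structure maps of the right bialgebroid `F^l ⊗_C F` over `R = End(ρ)`: source
`r ↦ 1 ⊗ r`, target `r ↦ r ⊗ 1`, counit `f ⊗ x ↦ f x` and coproduct
`f ⊗_α x ↦ ∑ (f ⊗_α q i) ⊗ (p i ⊗_α x)`, for any direct summand diagram `ρα → ρ → ρα`. -/
structure IsDualBialgebroid (ρ : B →+* A)
    (K : RightBialgebroid (endRing ρ) (DualCoend C ρ)) : Prop where
  source : ∀ r : endRing ρ, K.source r = dualMk C ρ (𝟙_ C.FullSubcategory)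
    ⟨1, (one_mem (endRing ρ))⟩ ⟨r.1, r.2⟩
  target : ∀ r : endRing ρ, K.target (op r) = dualMk C ρ (𝟙_ C.FullSubcategory)
    ⟨r.1, r.2⟩ ⟨1, (one_mem (endRing ρ))⟩
  counit : ∀ (α : C.FullSubcategory) (f : intertwiner (ρ.comp α.obj.hom) ρ)
    (x : intertwiner ρ (ρ.comp α.obj.hom)),
    (K.coring.counit (dualMk C ρ α f x) : A) = f.1 * x.1
  comul : ∀ (α : C.FullSubcategory) (n : ℕ) (p : Fin n → intertwiner (ρ.comp α.obj.hom) ρ)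
    (q : Fin n → intertwiner ρ (ρ.comp α.obj.hom)), IsSummandDiagram p q →
    ∀ (f : intertwiner (ρ.comp α.obj.hom) ρ) (x : intertwiner ρ (ρ.comp α.obj.hom)),
    K.coring.comul (dualMk C ρ α f x) =
      ∑ i, BalTensor.tmul _ _ (dualMk C ρ α f (q i)) (dualMk C ρ α (p i) x)

/-- The coaction `b ⊗_α x ↦ ∑ (b ⊗_α q i) ⊗ (p i ⊗_α x)` of `F^l ⊗_C F` on the field algebra. -/
def IsFieldCoaction (ρ : B →+* A) (K : RightBialgebroid (endRing ρ) (DualCoend C ρ))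
    (δ : K.ComoduleAlgebra (fieldBase C ρ)) : Prop :=
  ∀ (α : C.FullSubcategory) (n : ℕ) (p : Fin n → intertwiner (ρ.comp α.obj.hom) ρ)
    (q : Fin n → intertwiner ρ (ρ.comp α.obj.hom)), IsSummandDiagram p q →
    ∀ (b : B) (x : intertwiner ρ (ρ.comp α.obj.hom)),
    δ.coact (fieldMk C (fiberFunctor C ρ) α b x) =
      ∑ i, BalTensor.tmul _ _ (fieldMk C (fiberFunctor C ρ) α b (q i)) (dualMk C ρ α (p i) x)

variable {l : A →+* B} {r : B →+* A}

/-- The element `ρ(e) h ρ(e λ(q m))` of `End(ρλ)`. -/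
def comulFst (adj : RingAdjunction l r) (h : endRing (r.comp l))
    (q : intertwiner r (r.comp (l.comp r))) : endRing (r.comp l) :=
  ⟨r adj.e * h.1 * r (adj.e * l (q.1 * adj.m)), fun a => by
    have he : ∀ b, adj.e * l (r b) = b * adj.e := adj.e_mem
    have hm : adj.m * a = r (l a) * adj.m := adj.m_mem a
    have hq : q.1 * r (l a) = r (l (r (l a))) * q.1 := q.2 (l a)
    have hh : h.1 * r (l (r (l a))) = r (l (r (l a))) * h.1 := h.2 (r (l a))
    have hu : adj.e * l (q.1 * adj.m) * l a = l (r (l a)) * (adj.e * l (q.1 * adj.m)) := by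
      rw [mul_assoc, ← map_mul, mul_assoc q.1, hm, ← mul_assoc q.1, hq, mul_assoc, map_mul,
        ← mul_assoc, he, mul_assoc]
    change r adj.e * h.1 * r (adj.e * l (q.1 * adj.m)) * r (l a) =
      r (l a) * (r adj.e * h.1 * r (adj.e * l (q.1 * adj.m)))
    rw [mul_assoc, ← map_mul, hu, map_mul, ← mul_assoc, mul_assoc (r adj.e), hh, ← mul_assoc,
      ← map_mul, he, map_mul]
    simp only [mul_assoc]⟩

/-- The element `p ρλ(m)` of `End(ρλ)`. -/
def comulSnd (adj : RingAdjunction l r) (p : intertwiner (r.comp (l.comp r)) r) :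
    endRing (r.comp l) :=
  ⟨p.1 * r (l adj.m), fun a => by
    have hm : adj.m * a = r (l a) * adj.m := adj.m_mem a
    have hp : p.1 * r (l (r (l a))) = r (l a) * p.1 := p.2 (l a)
    change p.1 * r (l adj.m) * r (l a) = r (l a) * (p.1 * r (l adj.m))
    rw [mul_assoc, ← map_mul, ← map_mul, hm, map_mul, map_mul, ← mul_assoc, hp, mul_assoc]⟩

/-- The structure maps of the left bialgebroid `End(ρλ)` over `R = End(ρ)`: source `r ↦ r`, target
`r ↦ ρ(e λ(r m))`, counit `h ↦ ρ(e) h m` and coproduct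
`h ↦ ∑ ρ(e) h ρ(e λ(q i m)) ⊗ p i ρλ(m)`, for any direct summand diagram `ρλρ → ρ → ρλρ`. -/
structure IsEndBialgebroid (adj : RingAdjunction l r)
    (L : LeftBialgebroid (endRing r) (endRing (r.comp l))) : Prop where
  source : ∀ a : endRing r, (L.source a : A) = a
  target : ∀ a : endRing r, (L.target (op a) : A) = r (adj.e * l (a * adj.m))
  counit : ∀ h : endRing (r.comp l), (L.coring.counit h : A) = r adj.e * h * adj.m
  comul : ∀ (n : ℕ) (p : Fin n → intertwiner (r.comp (l.comp r)) r)
    (q : Fin n → intertwiner r (r.comp (l.comp r))), IsSummandDiagram p q →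
    ∀ h : endRing (r.comp l), L.coring.comul h =
      ∑ i, BalTensor.tmul _ _ (comulFst adj h (q i)) (comulSnd adj (p i))

/-- The coaction `a ↦ ∑ ρ(e λ(a)) q i ⊗ p i ρλ(m)` of `End(ρλ)` on `A`. -/
def IsEndCoaction (adj : RingAdjunction l r)
    (L : LeftBialgebroid (endRing r) (endRing (r.comp l)))
    (δ : L.ComoduleAlgebra (endRing r).subtype) : Prop :=
  ∀ (n : ℕ) (p : Fin n → intertwiner (r.comp (l.comp r)) r)
    (q : Fin n → intertwiner r (r.comp (l.comp r))), IsSummandDiagram p q →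
    ∀ a : A, δ.coact a =
      ∑ i, BalTensor.tmul _ _ (r (adj.e * l a) * (q i).1) (comulSnd adj (p i))

end FieldAlgebra

end FieldAlg

/-! The adjunction embeds the balanced tensor products over `R = End(ρ)` that matter here in the
ring `A`, where the axioms become short computations with `e` and `m`.

Put `L = End(ρλ)`. Implementability of `λρ` gives `p i`, `q i` with `∑ q i p i = 1`. The elements `p
i ρλ(m)` and the functionals `h ↦ ρ(e) h q i` then form a finite dual basis of `L` as a left
`R`-module (`sum_endPairing`). A tensor in `M ⊗_R L` is therefore determined by finitely many
coefficients (`BalTensor.ext_coeff`). These can be read off from its image in `A`, so the maps `L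
⊗_R L → A`, `h ⊗ h' ↦ ρ(e) h ρλ(h')`, and `A ⊗_R L → A`, `a ⊗ h ↦ a ρ(e) h`, are injective
(`endTensorEmb_injective`, `coactionEmb_injective`). Under them the coproduct of `h` becomes `h
ρ(e)` and the coaction on `a` becomes `ρ(e λ(a))` (`endTensorEmb_endComul`, `coactionEmb_endCoact`).
Neither image mentions the diagram, so every diagram gives the same maps, and linearity, the
Takeuchi condition and multiplicativity are checked in `A`. Coassociativity is reduced to an
identity of this kind by `coassoc_of_components`, which avoids threefold tensor products. The Galois
map becomes `a ⊗ a' ↦ a ρ(e λ(a'))`, with an inverse built from `m` (`galoisMap_bijective`).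

The functor `F` is represented by `λρ`, with universal element `m`. By the co-Yoneda argument each
element of `G ⊗_C F` has the form `y ⊗ m` at the object `λρ` (`coendTensor_mk_eq`). For `G = Υ` this
yields `Υ ⊗_C F ≅ A`, and the statement about `η_F` follows from it. For `G = F^l` it yields a ring
isomorphism of `F^l ⊗_C F` with the opposite of `L`, given by `f ⊗ x ↦ f ρ(e λ(x m))`
(`dualEndEquiv`).

The bialgebroid `F^l ⊗_C F`, its coaction on `Υ ⊗_C F` and the Galois property are obtained from `L`
and `A` by transport along these two isomorphisms. That the transported maps have the stated form
for a diagram of any object `α` is the content of `endComul_dualEndElem` and `endCoact_r_mul`. -/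

namespace FieldAlg

/-! ## Functoriality of balanced tensor products -/

namespace BalTensor

theorem tmul_sum {S M N : Type*} [AddCommGroup M] [AddCommGroup N]
    {ra : S → M →+ M} {la : S → N →+ N} {ι : Type*} (s : Finset ι) (m : M)
    (n : ι → N) : tmul ra la m (∑ i ∈ s, n i) = ∑ i ∈ s, tmul ra la m (n i) :=
  map_sum (tmulHom ra la m) n s

/-! ### Finite dual bases and coefficients of tensors -/

section Coefficients

variable {R M N : Type*} [Ring R] [AddCommGroup M] [AddCommGroup N]

/-- The map `M ⊗_R N → M`, `m ⊗ n ↦ m φ(n)`, for a left linear functional `φ : N → R`. -/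
def coeff (X : RightAction R M) (Y : LeftAction R N) (φ : N →+ R)
    (hφ : ∀ s n, φ (Y.act s n) = s * φ n) : BalTensor X.act Y.act →+ M :=
  lift (AddMonoidHom.mk' (fun n => X.act (φ n))
    (fun n n' => by ext m; simp [X.act_add])).flip
    (fun s m n => by simp [hφ, X.act_mul])

@[simp]
theorem coeff_tmul (X : RightAction R M) (Y : LeftAction R N) (φ : N →+ R)
    (hφ : ∀ s n, φ (Y.act s n) = s * φ n) (m : M) (n : N) :
    coeff X Y φ hφ (tmul _ _ m n) = X.act (φ n) m := rfl

/-- Expansion of a tensor with respect to a finite dual basis of the left module `N`. -/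
theorem eq_sum_coeff {ι : Type*} [Fintype ι] (X : RightAction R M) (Y : LeftAction R N)
    (φ : ι → N →+ R) (hφ : ∀ i s n, φ i (Y.act s n) = s * φ i n) (P : ι → N)
    (hP : ∀ n, ∑ i, Y.act (φ i n) (P i) = n) (z : BalTensor X.act Y.act) :
    z = ∑ i, tmul _ _ (coeff X Y (φ i) (hφ i) z) (P i) := by
  have h : AddMonoidHom.id (BalTensor X.act Y.act) =
      ∑ i, ((tmulHom X.act Y.act).flip (P i)).comp (coeff X Y (φ i) (hφ i)) := by
    refine hom_ext fun m n => ?_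
    rw [AddMonoidHom.finsetSum_apply, AddMonoidHom.id_apply]
    -- Expand `n` in the dual basis; the scalars `φ i n` then cross the tensor sign and act on `m`.
    conv_lhs => rw [← hP n, tmul_sum]
    exact Finset.sum_congr rfl fun i _ => (tmul_balanced (φ i n) m (P i)).symm
  have h' := DFunLike.congr_fun h z
  rwa [AddMonoidHom.finsetSum_apply] at h'

/-- Both tensors equal their dual basis expansions. This is the source of injectivity for the maps
into `A`: it suffices to recover the coefficients of a tensor from its image. -/
theorem ext_coeff {ι : Type*} [Fintype ι] (X : RightAction R M) (Y : LeftAction R N)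
    (φ : ι → N →+ R) (hφ : ∀ i s n, φ i (Y.act s n) = s * φ i n) (P : ι → N)
    (hP : ∀ n, ∑ i, Y.act (φ i n) (P i) = n) {z w : BalTensor X.act Y.act}
    (h : ∀ i, coeff X Y (φ i) (hφ i) z = coeff X Y (φ i) (hφ i) w) : z = w := by
  rw [eq_sum_coeff X Y φ hφ P hP z, eq_sum_coeff X Y φ hφ P hP w]
  simp only [h]

end Coefficients

/-! ### Induced maps and a criterion for bijectivity -/

section Map

variable {R M N M' N' : Type*} [AddCommGroup M] [AddCommGroup N]
  [AddCommGroup M'] [AddCommGroup N']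
  {ra : R → M →+ M} {la : R → N →+ N} {ra' : R → M' →+ M'} {la' : R → N' →+ N'}

theorem induction_on {p : BalTensor ra la → Prop} (z : BalTensor ra la) (zero : p 0)
    (tmul : ∀ m n, p (tmul ra la m n)) (add : ∀ z w, p z → p w → p (z + w)) : p z := by
  obtain ⟨z, rfl⟩ := proj_surjective z
  induction z using TensorProduct.induction_on with
  | zero => simpa using zero
  | tmul m n => exact tmul m n
  | add x y hx hy => rw [map_add]; exact add _ _ hx hy

theorem map_leftInverse (f : M →+ M') (g : N →+ N') (hf : ∀ r m, f (ra r m) = ra' r (f m))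
    (hg : ∀ r n, g (la r n) = la' r (g n)) (f' : M' →+ M) (g' : N' →+ N)
    (hf' : ∀ r m, f' (ra' r m) = ra r (f' m)) (hg' : ∀ r n, g' (la' r n) = la r (g' n))
    (h₁ : Function.LeftInverse f' f) (h₂ : Function.LeftInverse g' g) :
    Function.LeftInverse (map f' g' hf' hg') (map f g hf hg) := fun z => by
  induction z using induction_on with
  | zero => simp
  | tmul m n => rw [map_tmul, map_tmul, h₁, h₂]
  | add z w hz hw => rw [map_add, map_add, hz, hw]

theorem map_proj (f : M →+ M') (g : N →+ N') (hf : ∀ r m, f (ra r m) = ra' r (f m))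
    (hg : ∀ r n, g (la r n) = la' r (g n)) (z : M ⊗[ℤ] N) :
    map f g hf hg (proj ra la z) =
      proj ra' la' (TensorProduct.map f.toIntLinearMap g.toIntLinearMap z) := by
  induction z using TensorProduct.induction_on with
  | zero => simp
  | tmul m n => rfl
  | add z w hz hw => simp only [map_add, hz, hw]

/-- A criterion for a balanced biadditive map to exhibit `P` as the tensor product `M ⊗_R N`. -/
theorem lift_bijective {P ι : Type*} [AddCommGroup P] [Fintype ι] (f : M →+ N →+ P)
    (hf : ∀ r m n, f (ra r m) n = f m (la r n)) (q : ι → M) (c : ι → P →+ N) (d : ι → M → R)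
    (hP : ∀ w, ∑ i, f (q i) (c i w) = w) (hc : ∀ i m n, c i (f m n) = la (d i m) n)
    (hd : ∀ m, ∑ i, ra (d i m) (q i) = m) : Function.Bijective (lift f hf) := by
  constructor
  -- The inverse is `w ↦ ∑ q i ⊗ c i w`. On `f x y` it gives `∑ q i ⊗ d i x · y`, and the scalars `d
  -- i x` move back to the left to reassemble `x`.
  · refine Function.LeftInverse.injective
      (g := ⇑(∑ i, (tmulHom ra la (q i)).comp (c i))) fun z => ?_
    induction z using induction_on with
    | zero => rw [map_zero, map_zero]
    | add z w hz hw => rw [map_add, map_add, hz, hw]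
    | tmul x y =>
      rw [lift_tmul, AddMonoidHom.finsetSum_apply]
      simp only [AddMonoidHom.comp_apply, hc, tmulHom_apply, ← tmul_balanced]
      conv_rhs => rw [← hd x]
      exact (map_sum ((tmulHom ra la).flip y) _ _).symm
  · intro w
    refine ⟨∑ i, tmul ra la (q i) (c i w), ?_⟩
    rw [map_sum]
    exact hP w

end Map

/-! ### Naturality of the associativity map -/

section Assoc

variable {R M N P M' N' P' : Type*} [Ring R] [AddCommGroup M] [AddCommGroup N] [AddCommGroup P]
  [AddCommGroup M'] [AddCommGroup N'] [AddCommGroup P']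

theorem assoc_tmul (X : RightAction R M) (Y : Bimodule R N) (Z : LeftAction R P)
    (w : BalTensor X.act Y.left.act) (p : P) :
    assoc X Y Z (tmul _ _ w p) = assocAux X Y Z w p := rfl

theorem assoc_map {X : RightAction R M} {Y : Bimodule R N} {Z : LeftAction R P}
    {X' : RightAction R M'} {Y' : Bimodule R N'} {Z' : LeftAction R P'}
    (f : M →+ M') (g : N →+ N') (k : P →+ P')
    (hf : ∀ r m, f (X.act r m) = X'.act r (f m))
    (hgl : ∀ r n, g (Y.left.act r n) = Y'.left.act r (g n))
    (hgr : ∀ r n, g (Y.right.act r n) = Y'.right.act r (g n))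
    (hk : ∀ r n, k (Z.act r n) = Z'.act r (k n))
    (h₁ : ∀ r w, map f g hf hgl ((X.tensor Y).act r w) = (X'.tensor Y').act r (map f g hf hgl w))
    (h₂ : ∀ r w, map g k hgr hk ((LeftAction.tensor Y Z).act r w) =
      (LeftAction.tensor Y' Z').act r (map g k hgr hk w))
    (z : BalTensor (X.tensor Y).act Z.act) :
    assoc X' Y' Z' (map (map f g hf hgl) k h₁ hk z) =
      map f (map g k hgr hk) hf h₂ (assoc X Y Z z) := by
  induction z using induction_on with
  | zero => simp
  | tmul w p =>
    induction w using induction_on with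
    | zero => rw [map_tmul, assoc_tmul, assoc_tmul]; simp
    | tmul m n => rfl
    | add w v hw hv =>
      rw [map_tmul, assoc_tmul, assoc_tmul] at hw hv ⊢
      simp only [map_add, AddMonoidHom.add_apply, hw, hv]
  | add z w hz hw => simp only [map_add, hz, hw]

theorem tensor_right_map {X : RightAction R M} {Y : Bimodule R N}
    {X' : RightAction R M'} {Y' : Bimodule R N'}
    (f : M →+ M') (g : N →+ N')
    (hf : ∀ r m, f (X.act r m) = X'.act r (f m))
    (hgl : ∀ r n, g (Y.left.act r n) = Y'.left.act r (g n))
    (hgr : ∀ r n, g (Y.right.act r n) = Y'.right.act r (g n)) (r : R)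
    (w : BalTensor X.act Y.left.act) :
    map f g hf hgl ((X.tensor Y).act r w) = (X'.tensor Y').act r (map f g hf hgl w) := by
  induction w using induction_on with
  | zero => simp
  | tmul m n => exact congrArg (tmul _ _ (f m)) (hgr r n)
  | add z w hz hw => simp only [map_add, hz, hw]

theorem tensor_left_map {Y : Bimodule R N} {Z : LeftAction R P}
    {Y' : Bimodule R N'} {Z' : LeftAction R P'}
    (g : N →+ N') (k : P →+ P')
    (hgl : ∀ r n, g (Y.left.act r n) = Y'.left.act r (g n))
    (hgr : ∀ r n, g (Y.right.act r n) = Y'.right.act r (g n))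
    (hk : ∀ r n, k (Z.act r n) = Z'.act r (k n)) (r : R)
    (w : BalTensor Y.right.act Z.act) :
    map g k hgr hk ((LeftAction.tensor Y Z).act r w) =
      (LeftAction.tensor Y' Z').act r (map g k hgr hk w) := by
  induction w using induction_on with
  | zero => simp
  | tmul m n => exact congrArg (fun x => tmul _ _ x (k n)) (hgl r m)
  | add z w hz hw => simp only [map_add, hz, hw]

end Assoc

end BalTensor

/-! ## Transport of corings, bialgebroids and comodule algebras -/

section Transport

variable {R M M' N N' : Type*} [Ring R] [AddCommGroup M'] [AddCommGroup N']
  [AddCommGroup M] [AddCommGroup N]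

/-- An isomorphism of right modules. -/
structure RightIso (Y' : RightAction R N') (Y : RightAction R N) where
  hom : N' →+ N
  inv : N →+ N'
  inv_hom : Function.LeftInverse inv hom
  hom_inv : Function.LeftInverse hom inv
  hom_act : ∀ r n, hom (Y'.act r n) = Y.act r (hom n)

theorem RightIso.inv_act {Y' : RightAction R N'} {Y : RightAction R N} (ψ : RightIso Y' Y) (r : R)
    (n : N) : ψ.inv (Y.act r n) = Y'.act r (ψ.inv n) := by
  conv_lhs => rw [← ψ.hom_inv n, ← ψ.hom_act, ψ.inv_hom]

/-- An isomorphism of bimodules. -/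
structure BimoduleIso (X' : Bimodule R M') (X : Bimodule R M) extends
    RightIso X'.right X.right where
  hom_left : ∀ r n, hom (X'.left.act r n) = X.left.act r (hom n)

variable {X' : Bimodule R M'} {X : Bimodule R M} {Y' : RightAction R N'} {Y : RightAction R N}

theorem BimoduleIso.inv_left (φ : BimoduleIso X' X) (r : R)
    (n : M) : φ.inv (X.left.act r n) = X'.left.act r (φ.inv n) := by
  conv_lhs => rw [← φ.hom_inv n, ← φ.hom_left, φ.inv_hom]

/-- The isomorphism `N' ⊗_R M' → N ⊗_R M`. -/
def tensorHom (ψ : RightIso Y' Y) (φ : BimoduleIso X' X) :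
    BalTensor Y'.act X'.left.act →+ BalTensor Y.act X.left.act :=
  BalTensor.map ψ.hom φ.hom ψ.hom_act φ.hom_left

/-- The isomorphism `N ⊗_R M → N' ⊗_R M'`. -/
def tensorInv (ψ : RightIso Y' Y) (φ : BimoduleIso X' X) :
    BalTensor Y.act X.left.act →+ BalTensor Y'.act X'.left.act :=
  BalTensor.map ψ.inv φ.inv ψ.inv_act φ.inv_left

@[simp]
theorem tensorHom_tmul (ψ : RightIso Y' Y) (φ : BimoduleIso X' X) (n : N') (m : M') :
    tensorHom ψ φ (BalTensor.tmul _ _ n m) = BalTensor.tmul _ _ (ψ.hom n) (φ.hom m) := rfl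

@[simp]
theorem tensorInv_tmul (ψ : RightIso Y' Y) (φ : BimoduleIso X' X) (n : N) (m : M) :
    tensorInv ψ φ (BalTensor.tmul _ _ n m) = BalTensor.tmul _ _ (ψ.inv n) (φ.inv m) := rfl

@[simp]
theorem tensorInv_tensorHom (ψ : RightIso Y' Y) (φ : BimoduleIso X' X)
    (z : BalTensor Y'.act X'.left.act) : tensorInv ψ φ (tensorHom ψ φ z) = z :=
  BalTensor.map_leftInverse _ _ _ _ _ _ _ _ ψ.inv_hom φ.inv_hom z

@[simp]
theorem tensorHom_tensorInv (ψ : RightIso Y' Y) (φ : BimoduleIso X' X)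
    (z : BalTensor Y.act X.left.act) : tensorHom ψ φ (tensorInv ψ φ z) = z :=
  BalTensor.map_leftInverse _ _ _ _ _ _ _ _ ψ.hom_inv φ.hom_inv z

theorem tensorHom_injective (ψ : RightIso Y' Y) (φ : BimoduleIso X' X) :
    Function.Injective (tensorHom ψ φ) :=
  Function.LeftInverse.injective (tensorInv_tensorHom ψ φ)

theorem tensorHom_proj (ψ : RightIso Y' Y) (φ : BimoduleIso X' X) (z : N' ⊗[ℤ] M') :
    tensorHom ψ φ (BalTensor.proj _ _ z) = BalTensor.proj _ _
      (TensorProduct.map ψ.hom.toIntLinearMap φ.hom.toIntLinearMap z) :=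
  BalTensor.map_proj _ _ _ _ z

theorem tensorHom_right (ψ : RightIso Y' Y) (φ : BimoduleIso X' X) (r : R)
    (z : BalTensor Y'.act X'.left.act) :
    tensorHom ψ φ ((Y'.tensor X').act r z) = (Y.tensor X).act r (tensorHom ψ φ z) :=
  BalTensor.tensor_right_map _ _ _ _ φ.hom_act r z

theorem tensorHom_left (φ : BimoduleIso X' X) (r : R)
    (z : BalTensor X'.right.act X'.left.act) :
    tensorHom φ.toRightIso φ ((LeftAction.tensor X' X'.left).act r z) =
      (LeftAction.tensor X X.left).act r (tensorHom φ.toRightIso φ z) :=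
  BalTensor.tensor_left_map _ _ φ.hom_left _ _ r z

/-- The transport of coassociativity. -/
theorem coassoc_transport (ψ : RightIso Y' Y) (φ : BimoduleIso X' X)
    {δ : N →+ BalTensor Y.act X.left.act} {δ' : N' →+ BalTensor Y'.act X'.left.act}
    {Δ : M →+ BalTensor X.right.act X.left.act} {Δ' : M' →+ BalTensor X'.right.act X'.left.act}
    (hδ : ∀ n, tensorHom ψ φ (δ' n) = δ (ψ.hom n))
    (hΔ : ∀ n, tensorHom φ.toRightIso φ (Δ' n) = Δ (φ.hom n))
    (dr : ∀ r n, δ (Y.act r n) = (Y.tensor X).act r (δ n))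
    (dr' : ∀ r n, δ' (Y'.act r n) = (Y'.tensor X').act r (δ' n))
    (Dl : ∀ r m, Δ (X.left.act r m) = (LeftAction.tensor X X.left).act r (Δ m))
    (Dl' : ∀ r m, Δ' (X'.left.act r m) = (LeftAction.tensor X' X'.left).act r (Δ' m))
    (n : N')
    (h : BalTensor.assoc Y X X.left (BalTensor.mapLeft X.left.act δ dr (δ (ψ.hom n))) =
      BalTensor.mapRight Y.act Δ Dl (δ (ψ.hom n))) :
    BalTensor.assoc Y' X' X'.left (BalTensor.mapLeft X'.left.act δ' dr' (δ' n)) =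
      BalTensor.mapRight Y'.act Δ' Dl' (δ' n) := by
  -- The two sides are compared after applying the isomorphism `ψ ⊗ (φ ⊗ φ)`, which turns them into
  -- the two sides of `h`.
  have inj : Function.Injective (BalTensor.map (ra := Y'.act) (ra' := Y.act) ψ.hom
      (tensorHom φ.toRightIso φ) ψ.hom_act (tensorHom_left φ)) := by
    refine Function.LeftInverse.injective (BalTensor.map_leftInverse _ _ _ _ ψ.inv
      (tensorInv φ.toRightIso φ) ψ.inv_act ?_ ψ.inv_hom (tensorInv_tensorHom φ.toRightIso φ))
    intro r z
    refine tensorHom_injective φ.toRightIso φ ?_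
    rw [tensorHom_left]
    simp
  apply inj
  have e₁ : ∀ z : BalTensor Y'.act X'.left.act,
      BalTensor.map (tensorHom ψ φ) φ.hom (tensorHom_right ψ φ) φ.hom_left
        (BalTensor.mapLeft X'.left.act δ' dr' z) =
      BalTensor.mapLeft X.left.act δ dr (tensorHom ψ φ z) := by
    intro z
    induction z using BalTensor.induction_on with
    | zero => simp
    | tmul a b => simp [hδ]
    | add z w hz hw => simp only [map_add, hz, hw]
  have e₂ : ∀ z : BalTensor Y'.act X'.left.act,
      BalTensor.map ψ.hom (tensorHom φ.toRightIso φ) ψ.hom_act (tensorHom_left φ)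
        (BalTensor.mapRight Y'.act Δ' Dl' z) =
      BalTensor.mapRight Y.act Δ Dl (tensorHom ψ φ z) := by
    intro z
    induction z using BalTensor.induction_on with
    | zero => simp
    | tmul a b => simp [hΔ]
    | add z w hz hw => simp only [map_add, hz, hw]
  have e₃ := BalTensor.assoc_map (Z := X'.left) (Z' := X.left) ψ.hom φ.hom φ.hom ψ.hom_act
    φ.hom_left φ.hom_act φ.hom_left (tensorHom_right ψ φ) (tensorHom_left φ)
    (BalTensor.mapLeft X'.left.act δ' dr' (δ' n))
  refine e₃.symm.trans ((congrArg _ (e₁ _)).trans ?_)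
  rw [hδ, h, e₂, hδ]

/-- Coassociativity of a coaction given by finitely many generators `P i` of the coring, with
components `D i` of the coaction and `E i` of the coproduct. -/
theorem coassoc_of_components {ι : Type*} [Fintype ι] (P : ι → M) (D : ι → N → N)
    (E : ι → M →+ M) (hE : ∀ i r m, E i (X.left.act r m) = X.left.act r (E i m))
    {δ : N →+ BalTensor Y.act X.left.act} {Δ : M →+ BalTensor X.right.act X.left.act}
    (hδ : ∀ n, δ n = ∑ i, BalTensor.tmul _ _ (D i n) (P i))
    (hΔ : ∀ m, Δ m = ∑ i, BalTensor.tmul _ _ (E i m) (P i))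
    (dr : ∀ r n, δ (Y.act r n) = (Y.tensor X).act r (δ n))
    (Dl : ∀ r m, Δ (X.left.act r m) = (LeftAction.tensor X X.left).act r (Δ m))
    (h : ∀ i n, δ (D i n) = BalTensor.mapRight Y.act (E i) (hE i) (δ n)) (n : N) :
    BalTensor.assoc Y X X.left (BalTensor.mapLeft X.left.act δ dr (δ n)) =
      BalTensor.mapRight Y.act Δ Dl (δ n) := by
  -- Writing `Δ` through its components makes `P i` the last tensor factor and leaves `(id ⊗ E i) z`
  -- in the first two.
  have hR : ∀ z : BalTensor Y.act X.left.act, BalTensor.mapRight Y.act Δ Dl z =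
      ∑ i, BalTensor.assocAux Y X X.left (BalTensor.mapRight Y.act (E i) (hE i) z) (P i) := by
    intro z
    induction z using BalTensor.induction_on with
    | zero => simp
    | add z w hz hw =>
      simp only [map_add, hz, hw, AddMonoidHom.add_apply, Finset.sum_add_distrib]
    | tmul a b =>
      rw [BalTensor.mapRight_tmul, hΔ, BalTensor.tmul_sum]
      rfl
  rw [hR]
  -- Only the outer coaction is expanded, so the `i`-th term is `δ (D i n) ⊗ P i` reassociated. The
  -- two sides then match term by term through `h`.
  conv_lhs => rw [hδ n, map_sum, map_sum]
  refine Finset.sum_congr rfl fun i _ => ?_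
  rw [BalTensor.mapLeft_tmul, BalTensor.assoc_tmul, h]

/-- Transport of a coring along an isomorphism of bimodules. -/
def Coring.transport (K : Coring X) (φ : BimoduleIso X' X) : Coring X' where
  comul := (tensorInv φ.toRightIso φ).comp (K.comul.comp φ.hom)
  comul_left r m := by
    refine tensorHom_injective φ.toRightIso φ ?_
    rw [tensorHom_left]
    simp [φ.hom_left, K.comul_left]
  comul_right r m := by
    refine tensorHom_injective φ.toRightIso φ ?_
    rw [tensorHom_right]
    simp [φ.hom_act, K.comul_right]
  counit := K.counit.comp φ.hom
  counit_left r m := by simp [φ.hom_left, K.counit_left]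
  counit_right r m := by simp [φ.hom_act, K.counit_right]
  coassoc m := coassoc_transport φ.toRightIso φ (fun n => by simp) (fun n => by simp) K.comul_right
    _ K.comul_left _ m (K.coassoc _)
  counit_comul m := by
    conv_rhs => rw [← φ.inv_hom m, ← K.counit_comul (φ.hom m)]
    simp only [AddMonoidHom.comp_apply]
    generalize K.comul (φ.hom m) = z
    induction z using BalTensor.induction_on with
    | zero => simp
    | tmul a b => simp [φ.inv_left, φ.hom_inv a]
    | add z w hz hw => simp only [map_add, hz, hw]
  comul_counit m := by
    conv_rhs => rw [← φ.inv_hom m, ← K.comul_counit (φ.hom m)]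
    simp only [AddMonoidHom.comp_apply]
    generalize K.comul (φ.hom m) = z
    induction z using BalTensor.induction_on with
    | zero => simp
    | tmul a b => simp [φ.inv_act, φ.hom_inv b]
    | add z w hz hw => simp only [map_add, hz, hw]

/-- Since `tensorHom` is injective, this characterizes the transported coproduct, and identities for
it can be checked in the original coring. -/
theorem Coring.tensorHom_transport_comul (K : Coring X) (φ : BimoduleIso X' X) (m : M') :
    tensorHom φ.toRightIso φ ((K.transport φ).comul m) = K.comul (φ.hom m) :=
  tensorHom_tensorInv _ _ _

/-- Transport of a comodule along isomorphisms of bimodules and of right modules. -/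
def Comodule.transport {K : Coring X} (D : Comodule K Y) (φ : BimoduleIso X' X)
    (ψ : RightIso Y' Y) : Comodule (K.transport φ) Y' where
  coact := (tensorInv ψ φ).comp (D.coact.comp ψ.hom)
  coact_right r m := by
    refine tensorHom_injective ψ φ ?_
    rw [tensorHom_right]
    simp [ψ.hom_act, D.coact_right]
  coassoc m := coassoc_transport ψ φ (fun n => by simp) (K.tensorHom_transport_comul φ)
    D.coact_right _ K.comul_left _ m (D.coassoc _)
  coact_counit m := by
    conv_rhs => rw [← ψ.inv_hom m, ← D.coact_counit (ψ.hom m)]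
    simp only [AddMonoidHom.comp_apply]
    generalize D.coact (ψ.hom m) = z
    induction z using BalTensor.induction_on with
    | zero => simp
    | tmul a b => simp [ψ.inv_act, Coring.transport, φ.hom_inv b]
    | add z w hz hw => simp only [map_add, hz, hw]

theorem Comodule.tensorHom_transport_coact {K : Coring X} (D : Comodule K Y)
    (φ : BimoduleIso X' X) (ψ : RightIso Y' Y) (n : N') :
    tensorHom ψ φ ((D.transport φ ψ).coact n) = D.coact (ψ.hom n) :=
  tensorHom_tensorInv _ _ _

end Transport

/-! ### Opposite bialgebroids, comodule algebras and Galois extensions under transport -/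

section TransportBialgebroid

variable {R H L' A A' B : Type*} [Ring R] [Ring H] [Ring L'] [Ring A'] [Ring A] [Ring B]

/-- The source `r ↦ Φ⁻¹(t(r))` of the right bialgebroid opposite to `L`. -/
def LeftBialgebroid.oppositeSource (L : LeftBialgebroid R L') (Φ : H ≃+* L'ᵐᵒᵖ) : R →+* H where
  toFun r := Φ.symm (op (L.target (op r)))
  map_one' := by simp
  map_zero' := by simp
  map_add' r s := by simp
  map_mul' r s := by simp

/-- The target `r ↦ Φ⁻¹(s(r))` of the right bialgebroid opposite to `L`. -/
def LeftBialgebroid.oppositeTarget (L : LeftBialgebroid R L') (Φ : H ≃+* L'ᵐᵒᵖ) :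
    Rᵐᵒᵖ →+* H where
  toFun r := Φ.symm (op (L.source r.unop))
  map_one' := by simp
  map_zero' := by simp
  map_add' r s := by simp
  map_mul' r s := by simp

theorem LeftBialgebroid.opposite_source_target (L : LeftBialgebroid R L') (Φ : H ≃+* L'ᵐᵒᵖ)
    (r r' : R) : L.oppositeSource Φ r * L.oppositeTarget Φ (op r') =
      L.oppositeTarget Φ (op r') * L.oppositeSource Φ r := by
  change Φ.symm _ * Φ.symm _ = Φ.symm _ * Φ.symm _
  rw [← map_mul, ← map_mul, ← op_mul, ← op_mul, MulOpposite.unop_op, L.source_target]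

/-- The isomorphism of bimodules underlying `Φ`. -/
def LeftBialgebroid.oppositeIso (L : LeftBialgebroid R L') (Φ : H ≃+* L'ᵐᵒᵖ) :
    BimoduleIso (rightBimodule _ _ (L.opposite_source_target Φ)) L.bimodule where
  hom := (opAddEquiv.symm : L'ᵐᵒᵖ ≃+ L').toAddMonoidHom.comp Φ.toAddEquiv.toAddMonoidHom
  inv := Φ.symm.toAddEquiv.toAddMonoidHom.comp (opAddEquiv : L' ≃+ L'ᵐᵒᵖ).toAddMonoidHom
  inv_hom h := by simp
  hom_inv h := by simp
  hom_act r h := by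
    simp [rightBimodule, leftBimodule, LeftBialgebroid.oppositeSource]
  hom_left r h := by
    simp [rightBimodule, leftBimodule, LeftBialgebroid.oppositeTarget]

theorem LeftBialgebroid.oppositeIso_hom (L : LeftBialgebroid R L') (Φ : H ≃+* L'ᵐᵒᵖ) (h : H) :
    (L.oppositeIso Φ).hom h = (Φ h).unop := rfl

theorem LeftBialgebroid.oppositeIso_hom_mul (L : LeftBialgebroid R L') (Φ : H ≃+* L'ᵐᵒᵖ)
    (h h' : H) : (L.oppositeIso Φ).hom (h * h') =
      (L.oppositeIso Φ).hom h' * (L.oppositeIso Φ).hom h := by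
  simp [LeftBialgebroid.oppositeIso_hom]

theorem LeftBialgebroid.oppositeIso_hom_source (L : LeftBialgebroid R L') (Φ : H ≃+* L'ᵐᵒᵖ)
    (r : R) : (L.oppositeIso Φ).hom (L.oppositeSource Φ r) = L.target (op r) := by
  simp [LeftBialgebroid.oppositeIso_hom, LeftBialgebroid.oppositeSource]

theorem LeftBialgebroid.oppositeIso_hom_target (L : LeftBialgebroid R L') (Φ : H ≃+* L'ᵐᵒᵖ)
    (r : R) : (L.oppositeIso Φ).hom (L.oppositeTarget Φ (op r)) = L.source r := by
  simp [LeftBialgebroid.oppositeIso_hom, LeftBialgebroid.oppositeTarget]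

theorem LeftBialgebroid.oppositeIso_hom_one (L : LeftBialgebroid R L') (Φ : H ≃+* L'ᵐᵒᵖ) :
    (L.oppositeIso Φ).hom 1 = 1 := by
  simp [LeftBialgebroid.oppositeIso_hom]

/-- As a map to `L'`, the isomorphism `Φ` reverses products in each factor. This exchanges
multiplication on the right in the left Takeuchi condition for multiplication on the left in the
right one. -/
theorem LeftBialgebroid.map_oppositeIso_mul (L : LeftBialgebroid R L') (Φ : H ≃+* L'ᵐᵒᵖ)
    (z z' : H ⊗[ℤ] H) :
    TensorProduct.map (L.oppositeIso Φ).hom.toIntLinearMap (L.oppositeIso Φ).hom.toIntLinearMap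
      (z * z') =
    TensorProduct.map (L.oppositeIso Φ).hom.toIntLinearMap (L.oppositeIso Φ).hom.toIntLinearMap z' *
    TensorProduct.map (L.oppositeIso Φ).hom.toIntLinearMap (L.oppositeIso Φ).hom.toIntLinearMap z
    := by
  induction z using TensorProduct.induction_on with
  | zero => simp
  | add x y hx hy => rw [add_mul, map_add, hx, hy, map_add, mul_add]
  | tmul a b =>
    induction z' using TensorProduct.induction_on with
    | zero => simp
    | add x y hx hy => rw [mul_add, map_add, hx, hy, map_add, add_mul]
    | tmul c d => simp [LeftBialgebroid.oppositeIso_hom_mul]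

/-- The right bialgebroid structure on `H` for which `Φ` is an isomorphism to the opposite of the
left bialgebroid `L`. -/
def LeftBialgebroid.opposite (L : LeftBialgebroid R L') (Φ : H ≃+* L'ᵐᵒᵖ) :
    RightBialgebroid R H where
  source := L.oppositeSource Φ
  target := L.oppositeTarget Φ
  source_target := L.opposite_source_target Φ
  coring := L.coring.transport (L.oppositeIso Φ)
  takeuchi h z hz r := by
    refine tensorHom_injective (L.oppositeIso Φ).toRightIso (L.oppositeIso Φ) ?_
    have hz' := congrArg (tensorHom (L.oppositeIso Φ).toRightIso (L.oppositeIso Φ)) hz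
    rw [L.coring.tensorHom_transport_comul, tensorHom_proj] at hz'
    have := L.takeuchi _ _ hz' r
    refine (tensorHom_proj _ _ _).trans (Eq.trans ?_ (tensorHom_proj _ _ _).symm)
    rw [L.map_oppositeIso_mul, L.map_oppositeIso_mul]
    simp only [TensorProduct.map_tmul, AddMonoidHom.coe_toIntLinearMap, L.oppositeIso_hom_source,
      L.oppositeIso_hom_target, L.oppositeIso_hom_one]
    exact this
  comul_one := by
    refine tensorHom_injective (L.oppositeIso Φ).toRightIso (L.oppositeIso Φ) ?_
    rw [L.coring.tensorHom_transport_comul, tensorHom_tmul, L.oppositeIso_hom_one, L.comul_one]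
  comul_mul h h' z z' hz hz' := by
    refine tensorHom_injective (L.oppositeIso Φ).toRightIso (L.oppositeIso Φ) ?_
    have hz₁ := congrArg (tensorHom (L.oppositeIso Φ).toRightIso (L.oppositeIso Φ)) hz
    have hz₂ := congrArg (tensorHom (L.oppositeIso Φ).toRightIso (L.oppositeIso Φ)) hz'
    rw [L.coring.tensorHom_transport_comul, tensorHom_proj] at hz₁ hz₂
    rw [L.coring.tensorHom_transport_comul, tensorHom_proj, L.map_oppositeIso_mul,
      L.oppositeIso_hom_mul]
    -- The two representatives change places because `Φ` reverses products.
    exact L.comul_mul _ _ _ _ hz₂ hz₁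
  counit_one := by
    change L.coring.counit ((L.oppositeIso Φ).hom 1) = 1
    rw [L.oppositeIso_hom_one, L.counit_one]
  -- Source and target are exchanged and products reversed, so this axiom comes from
  -- `counit_mul_target` of `L`, and the next one from `counit_mul_source`.
  counit_source_mul h h' := by
    change L.coring.counit ((L.oppositeIso Φ).hom
      (L.oppositeSource Φ (L.coring.counit ((L.oppositeIso Φ).hom h)) * h')) =
      L.coring.counit ((L.oppositeIso Φ).hom (h * h'))
    rw [L.oppositeIso_hom_mul, L.oppositeIso_hom_mul, L.oppositeIso_hom_source,
      L.counit_mul_target]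
  counit_target_mul h h' := by
    change L.coring.counit ((L.oppositeIso Φ).hom
      (L.oppositeTarget Φ (op (L.coring.counit ((L.oppositeIso Φ).hom h))) * h')) =
      L.coring.counit ((L.oppositeIso Φ).hom (h * h'))
    rw [L.oppositeIso_hom_mul, L.oppositeIso_hom_mul, L.oppositeIso_hom_target,
      L.counit_mul_source]

theorem LeftBialgebroid.opposite_tensorHom_comul (L : LeftBialgebroid R L') (Φ : H ≃+* L'ᵐᵒᵖ)
    (h : H) : tensorHom (L.oppositeIso Φ).toRightIso (L.oppositeIso Φ)
      ((L.opposite Φ).coring.comul h) = L.coring.comul (Φ h).unop :=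
  L.coring.tensorHom_transport_comul _ _

theorem LeftBialgebroid.opposite_isIsoToOpposite (L : LeftBialgebroid R L') (Φ : H ≃+* L'ᵐᵒᵖ) :
    IsIsoToOpposite (L.opposite Φ) L Φ where
  source := L.oppositeIso_hom_source Φ
  target := L.oppositeIso_hom_target Φ
  counit _ := rfl
  comul h z hz := by
    rw [← L.opposite_tensorHom_comul Φ h, ← hz]
    exact tensorHom_proj _ _ _

/-- The isomorphism of right `R`-modules underlying an isomorphism of `R`-rings. -/
def ringRightIso (ε : A' ≃+* A) {π : R →+* A} {π' : R →+* A'} (h : ∀ r, ε (π' r) = π r) :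
    RightIso (ringRightAction π') (ringRightAction π) where
  hom := ε.toAddEquiv.toAddMonoidHom
  inv := ε.symm.toAddEquiv.toAddMonoidHom
  inv_hom a := by simp
  hom_inv a := by simp
  hom_act r a := by simp [ringRightAction, h]

theorem ringRightIso_hom (ε : A' ≃+* A) {π : R →+* A} {π' : R →+* A'} (h : ∀ r, ε (π' r) = π r)
    (a : A') : (ringRightIso ε h).hom a = ε a := rfl

@[simp]
theorem twistedMul_tmul_tmul (a a' : A) (h h' : L') :
    twistedMul A L' (a ⊗ₜ[ℤ] h) (a' ⊗ₜ[ℤ] h') = (a * a') ⊗ₜ[ℤ] (h' * h) := rfl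

theorem leftMul_tensorHom (ε : A' ≃+* A) {π : R →+* A} {π' : R →+* A'} (h : ∀ r, ε (π' r) = π r)
    {X' : Bimodule R H} {X : Bimodule R L'} (φ : BimoduleIso X' X) (a : A')
    (z : BalTensor (ringRightAction π').act X'.left.act) :
    leftMul π X.left (ε a) (tensorHom (ringRightIso ε h) φ z) =
      tensorHom (ringRightIso ε h) φ (leftMul π' X'.left a z) := by
  induction z using BalTensor.induction_on with
  | zero => simp
  | add z w hz hw => simp only [map_add, hz, hw]
  | tmul c k => exact congrArg (fun x => BalTensor.tmul _ _ x _) (map_mul ε a c).symm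

/-- The first factor preserves products and the second reverses them, which is exactly the twist in
`twistedMul`. -/
theorem LeftBialgebroid.map_ringRightIso_mul (L : LeftBialgebroid R L') (Φ : H ≃+* L'ᵐᵒᵖ)
    (ε : A' ≃+* A) {π : R →+* A} {π' : R →+* A'} (h : ∀ r, ε (π' r) = π r)
    (z z' : A' ⊗[ℤ] H) :
    TensorProduct.map (ringRightIso ε h).hom.toIntLinearMap (L.oppositeIso Φ).hom.toIntLinearMap
      (z * z') = twistedMul A L'
    (TensorProduct.map (ringRightIso ε h).hom.toIntLinearMap
      (L.oppositeIso Φ).hom.toIntLinearMap z)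
    (TensorProduct.map (ringRightIso ε h).hom.toIntLinearMap
      (L.oppositeIso Φ).hom.toIntLinearMap z') := by
  induction z using TensorProduct.induction_on with
  | zero => simp
  | add x y hx hy => rw [add_mul, map_add, hx, hy, map_add, map_add, LinearMap.add_apply]
  | tmul a b =>
    induction z' using TensorProduct.induction_on with
    | zero => simp
    | add x y hx hy => rw [mul_add, map_add, hx, hy, map_add, map_add]
    | tmul c d => simp [LeftBialgebroid.oppositeIso_hom_mul, ringRightIso_hom]

/-- Together with `twistedMul_one_tmul`, this rewrites the twisted products that arise in the
transported Takeuchi condition as the ordinary products used for left bialgebroids. -/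
theorem twistedMul_tmul_left (a : A) (z : A ⊗[ℤ] L') :
    twistedMul A L' (a ⊗ₜ[ℤ] 1) z = (a ⊗ₜ[ℤ] 1) * z := by
  induction z using TensorProduct.induction_on with
  | zero => simp
  | add x y hx hy => rw [map_add, hx, hy, mul_add]
  | tmul c d => simp

theorem twistedMul_one_tmul (h : L') (z : A ⊗[ℤ] L') :
    twistedMul A L' (1 ⊗ₜ[ℤ] h) z = z * (1 ⊗ₜ[ℤ] h) := by
  induction z using TensorProduct.induction_on with
  | zero => simp
  | add x y hx hy => rw [map_add, hx, hy, add_mul]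
  | tmul c d => simp

/-- Transport of a comodule algebra over a left bialgebroid to the opposite right bialgebroid,
along an isomorphism of `R`-rings. -/
def LeftBialgebroid.ComoduleAlgebra.transport {L : LeftBialgebroid R L'} {π : R →+* A}
    (δ : L.ComoduleAlgebra π) (Φ : H ≃+* L'ᵐᵒᵖ) (ε : A' ≃+* A) {π' : R →+* A'}
    (h : ∀ r, ε (π' r) = π r) : (L.opposite Φ).ComoduleAlgebra π' where
  __ := δ.toComodule.transport (L.oppositeIso Φ) (ringRightIso ε h)
  takeuchi a z hz r := by
    refine tensorHom_injective (ringRightIso ε h) (L.oppositeIso Φ) ?_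
    have hz' := congrArg (tensorHom (ringRightIso ε h) (L.oppositeIso Φ)) hz
    have hc : tensorHom (ringRightIso ε h) (L.oppositeIso Φ) ((δ.toComodule.transport
      (L.oppositeIso Φ) (ringRightIso ε h)).coact a) = _ :=
        δ.toComodule.tensorHom_transport_coact _ _ _
    have hz₁ := (tensorHom_proj (ringRightIso ε h) (L.oppositeIso Φ) z).symm.trans
      (hz'.trans hc)
    have := δ.takeuchi _ _ hz₁ r
    refine (tensorHom_proj _ _ _).trans (Eq.trans ?_ (tensorHom_proj _ _ _).symm)
    rw [L.map_ringRightIso_mul, L.map_ringRightIso_mul]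
    simp only [TensorProduct.map_tmul, AddMonoidHom.coe_toIntLinearMap, ringRightIso_hom, h,
      map_one, L.oppositeIso_hom_one]
    rw [twistedMul_tmul_left, twistedMul_one_tmul]
    exact this.trans (congrArg (fun t => BalTensor.proj _ _ (_ * (1 ⊗ₜ[ℤ] t)))
      (L.oppositeIso_hom_target Φ r).symm)
  coact_one := by
    refine tensorHom_injective (ringRightIso ε h) (L.oppositeIso Φ) ?_
    refine (δ.toComodule.tensorHom_transport_coact _ _ _).trans ?_
    refine Eq.trans ?_ (tensorHom_tmul (ringRightIso ε h) (L.oppositeIso Φ) _ _).symm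
    rw [ringRightIso_hom, map_one, L.oppositeIso_hom_one]
    exact δ.coact_one
  coact_mul a a' z z' hz hz' := by
    refine tensorHom_injective (ringRightIso ε h) (L.oppositeIso Φ) ?_
    refine (δ.toComodule.tensorHom_transport_coact _ _ _).trans ?_
    refine Eq.trans ?_ (tensorHom_proj (ringRightIso ε h) (L.oppositeIso Φ) _).symm
    rw [L.map_ringRightIso_mul, ringRightIso_hom, map_mul]
    refine δ.coact_mul _ _ _ _ ?_ ?_
    · refine (tensorHom_proj (ringRightIso ε h) (L.oppositeIso Φ) z).symm.trans ?_
      exact (congrArg (tensorHom (ringRightIso ε h) (L.oppositeIso Φ)) hz).trans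
        (δ.toComodule.tensorHom_transport_coact _ _ _)
    · refine (tensorHom_proj (ringRightIso ε h) (L.oppositeIso Φ) z').symm.trans ?_
      exact (congrArg (tensorHom (ringRightIso ε h) (L.oppositeIso Φ)) hz').trans
        (δ.toComodule.tensorHom_transport_coact _ _ _)

theorem LeftBialgebroid.ComoduleAlgebra.tensorHom_transport {L : LeftBialgebroid R L'}
    {π : R →+* A}
    (δ : L.ComoduleAlgebra π) (Φ : H ≃+* L'ᵐᵒᵖ) (ε : A' ≃+* A) {π' : R →+* A'}
    (h : ∀ r, ε (π' r) = π r) (a : A') :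
    tensorHom (ringRightIso ε h) (L.oppositeIso Φ) ((δ.transport Φ ε h).coact a) =
      δ.coact (ε a) :=
  δ.toComodule.tensorHom_transport_coact _ _ _

/-- The isomorphism `A' ⊗_B A' → A ⊗_B A` for an isomorphism of extensions of `B`. -/
def extensionTensorMap (ε : A' →+* A) {ρ : B →+* A} {ρ' : B →+* A'} (h : ∀ b, ε (ρ' b) = ρ b) :
    BalTensor (fun b : B => AddMonoidHom.mulRight (ρ' b))
      (fun b : B => AddMonoidHom.mulLeft (ρ' b)) →+
    BalTensor (fun b : B => AddMonoidHom.mulRight (ρ b))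
      (fun b : B => AddMonoidHom.mulLeft (ρ b)) :=
  BalTensor.map (ε : A' →+ A) (ε : A' →+ A) (fun b a => by simp [h]) (fun b a => by simp [h])

/-- Galois extensions are stable under isomorphisms. -/
theorem LeftBialgebroid.ComoduleAlgebra.isGalois_transport {L : LeftBialgebroid R L'}
    {π : R →+* A} (δ : L.ComoduleAlgebra π) (Φ : H ≃+* L'ᵐᵒᵖ) (ε : A' ≃+* A) {π' : R →+* A'}
    (h : ∀ r, ε (π' r) = π r) {ρ : B →+* A} {ρ' : B →+* A'} (hρ : ∀ b, ε (ρ' b) = ρ b)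
    (hG : IsGalois ρ δ.coact) : IsGalois ρ' (δ.transport Φ ε h).coact := by
  obtain ⟨hco, Γ, hΓ, hbij⟩ := hG
  have inj := tensorHom_injective (ringRightIso ε h) (L.oppositeIso Φ)
  constructor
  · ext a
    -- The isomorphism `ε ⊗ Φ` sends `a ⊗ 1` to `ε a ⊗ 1` and one coaction to the other, so
    -- coinvariants correspond under `ε`.
    have h₁ : a ∈ coinvariants (δ.transport Φ ε h).coact ↔ ε a ∈ coinvariants δ.coact := by
      change (δ.transport Φ ε h).coact a = BalTensor.tmul _ _ a 1 ↔
        δ.coact (ε a) = BalTensor.tmul _ _ (ε a) 1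
      refine inj.eq_iff.symm.trans ?_
      have e₁ := δ.tensorHom_transport Φ ε h a
      have e₂ := tensorHom_tmul (ringRightIso ε h) (L.oppositeIso Φ) a 1
      rw [ringRightIso_hom, L.oppositeIso_hom_one] at e₂
      exact ⟨fun w => e₁.symm.trans (w.trans e₂), fun w => e₁.trans (w.trans e₂.symm)⟩
    rw [h₁, hco]
    constructor
    · rintro ⟨b, hb⟩
      exact ⟨b, ε.injective (by rw [hρ, hb])⟩
    · rintro ⟨b, rfl⟩
      exact ⟨b, (hρ b).symm⟩
  · have hρ' : ∀ b, (ε.symm : A →+* A') (ρ b) = ρ' b := fun b => by simp [← hρ]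
    have bij : Function.Bijective (extensionTensorMap (ε : A' →+* A) hρ) :=
      Function.bijective_iff_has_inverse.2 ⟨extensionTensorMap (ε.symm : A →+* A') hρ',
        BalTensor.map_leftInverse _ _ _ _ _ _ _ _ (fun a => by simp) (fun a => by simp),
        BalTensor.map_leftInverse _ _ _ _ _ _ _ _ (fun a => by simp) (fun a => by simp)⟩
    have bij' : Function.Bijective (tensorInv (ringRightIso ε h) (L.oppositeIso Φ)) :=
      Function.bijective_iff_has_inverse.2 ⟨tensorHom (ringRightIso ε h) (L.oppositeIso Φ),
        tensorHom_tensorInv _ _, tensorInv_tensorHom _ _⟩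
    -- The new Galois map is the old one conjugated by the isomorphisms of its source and target;
    -- its formula is checked after applying `tensorHom`.
    refine ⟨(tensorInv (ringRightIso ε h) (L.oppositeIso Φ)).comp
      (Γ.comp (extensionTensorMap (ε : A' →+* A) hρ)), fun a a' => inj ?_,
      bij'.comp (hbij.comp bij)⟩
    refine (tensorHom_tensorInv _ _ _).trans ((hΓ (ε a) (ε a')).trans ?_)
    rw [← δ.tensorHom_transport Φ ε h a']
    exact leftMul_tensorHom ε h (L.oppositeIso Φ) a _

end TransportBialgebroid

variable {A B : Type u} [Ring A] [Ring B] {l : A →+* B} {r : B →+* A}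

/-! ## Computations with an adjunction -/

section Adjunction

variable (adj : RingAdjunction l r)

namespace RingAdjunction

theorem e_mul (b : B) : adj.e * l (r b) = b * adj.e := adj.e_mem b

theorem m_mul (a : A) : adj.m * a = r (l a) * adj.m := adj.m_mem a

theorem r_e_mul (b : B) : r adj.e * r (l (r b)) = r b * r adj.e := by
  rw [← map_mul, adj.e_mul, map_mul]

theorem r_e_mul_r_l_m : r adj.e * r (l adj.m) = 1 := by
  rw [← map_mul, adj.e_mul_l_m, map_one]

/-- `ρ(e λ(a)) m = a`. -/
theorem transpose_mul_m (a : A) : r (adj.e * l a) * adj.m = a := by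
  rw [map_mul, mul_assoc, ← adj.m_mul, ← mul_assoc, adj.r_e_mul_m, one_mul]

/-- `e λ(ρ(b) a) = b e λ(a)`. -/
theorem transpose_r_mul (b : B) (a : A) : adj.e * l (r b * a) = b * (adj.e * l a) := by
  rw [map_mul, ← mul_assoc, adj.e_mul, mul_assoc]

/-- `e λ(x m)` commutes with `λ(a)` for `x` in `End(ρ)`. -/
theorem transpose_mul_l (x : endRing r) (a : A) :
    adj.e * l (x.1 * adj.m) * l a = l a * (adj.e * l (x.1 * adj.m)) := by
  have hx : x.1 * r (l a) = r (l a) * x.1 := x.2 (l a)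
  rw [mul_assoc, ← map_mul, mul_assoc x.1, adj.m_mul, ← mul_assoc x.1, hx, mul_assoc,
    adj.transpose_r_mul]

/-- The left factor `e` is absorbed into the argument of `λ` as `ρ(e)`. It commutes with `x`, so it
reaches `m`, where `ρ(e) m = 1`. -/
theorem e_mul_transpose (x : endRing r) :
    adj.e * (adj.e * l (x.1 * adj.m)) = adj.e * l x.1 := by
  have hx : x.1 * r adj.e = r adj.e * x.1 := x.2 adj.e
  rw [← adj.transpose_r_mul, ← mul_assoc, ← hx, mul_assoc, adj.r_e_mul_m, mul_one]

/-- The unit `m` as an intertwiner from `ρ` to `ρλρ`. -/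
def unit : intertwiner r (r.comp (l.comp r)) := ⟨adj.m, fun b => adj.m_mul (r b)⟩

end RingAdjunction

theorem endRing_comm (h : endRing (r.comp l)) (a : A) : h.1 * r (l a) = r (l a) * h.1 := h.2 a

/-- An element `h` of `End(ρλ)` is recovered from its transpose `ρ(e) h` as `ρ(e) h ρλ(m)`, because
it commutes with `ρλ(m)` and `ρ(e) ρλ(m) = 1`. -/
theorem r_e_mul_cancel {h h' : endRing (r.comp l)} (H : r adj.e * h.1 = r adj.e * h'.1) :
    h = h' := by
  have key : ∀ k : endRing (r.comp l), r adj.e * k.1 * r (l adj.m) = k.1 := fun k => by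
    rw [mul_assoc, endRing_comm, ← mul_assoc, adj.r_e_mul_r_l_m, one_mul]
  exact Subtype.ext (by rw [← key h, H, key])

/-! ## The bialgebroid `End(ρλ)` -/

/-- The source `r ↦ r` of `End(ρλ)`. -/
def endSource (l : A →+* B) (r : B →+* A) : endRing r →+* endRing (r.comp l) :=
  Subring.inclusion fun _ hx a => hx (l a)

/-- The target `r ↦ ρ(e λ(r m))` of `End(ρλ)`. -/
def endTarget : (endRing r)ᵐᵒᵖ →+* endRing (r.comp l) where
  toFun x := ⟨r (adj.e * l (x.unop.1 * adj.m)), fun a => by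
    change _ * r (l a) = r (l a) * _
    rw [← map_mul, adj.transpose_mul_l, map_mul]⟩
  map_one' := Subtype.ext (by
    change r (adj.e * l (1 * adj.m)) = 1
    rw [one_mul, adj.e_mul_l_m, map_one])
  map_zero' := Subtype.ext (by
    change r (adj.e * l (0 * adj.m)) = 0
    simp)
  map_add' x y := Subtype.ext (by
    change r (adj.e * l ((x.unop.1 + y.unop.1) * adj.m)) = r _ + r _
    rw [add_mul, map_add, mul_add, map_add])
  map_mul' x y := Subtype.ext (by
    change r (adj.e * l (y.unop.1 * x.unop.1 * adj.m)) = r _ * r _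
    have hy : y.unop.1 * r (adj.e * l (x.unop.1 * adj.m)) =
      r (adj.e * l (x.unop.1 * adj.m)) * y.unop.1 := y.unop.2 _
    -- With `c = e λ(x m)`, one has `c · e λ(y m) = e λ(ρ(c) y m) = e λ(y ρ(c) m) = e λ(y x m)`.
    -- Moving `ρ(c)` past `y` is what reverses the order.
    rw [← map_mul, ← adj.transpose_r_mul, ← mul_assoc, ← hy, mul_assoc y.unop.1 (r _),
      adj.transpose_mul_m, mul_assoc])

theorem endTarget_val (x : endRing r) :
    (endTarget adj (op x)).1 = r (adj.e * l (x.1 * adj.m)) := rfl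

/-- The target has values in `ρ(B)`, and `End(ρ)` is the commutant of `ρ(B)`. -/
theorem endSource_mul_endTarget (x y : endRing r) :
    endSource l r x * endTarget adj (op y) = endTarget adj (op y) * endSource l r x :=
  Subtype.ext (x.2 _)

/-- Behind `ρ(e)`, the target of `x` acts as `ρλ(x)` by `e_mul_transpose`, and `ρλ(x)` commutes with
`h`. The right `R`-action on `End(ρλ)` thus becomes right multiplication by `ρλ(x)`, which makes
`endTensorEmb` balanced. -/
theorem r_e_mul_endTarget (x : endRing r) (h : endRing (r.comp l)) :
    r adj.e * ((endTarget adj (op x)).1 * h.1) = r adj.e * h.1 * r (l x.1) := by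
  rw [endTarget_val, ← mul_assoc, ← map_mul, adj.e_mul_transpose, map_mul, mul_assoc, mul_assoc,
    endRing_comm]

/-- The underlying bimodule of the bialgebroid `End(ρλ)`. -/
abbrev endBimodule : Bimodule (endRing r) (endRing (r.comp l)) :=
  leftBimodule (endSource l r) (endTarget adj) (endSource_mul_endTarget adj)

/-- The functional `h ↦ ρ(e) h q` on `End(ρλ)`. -/
def endPairing (q : intertwiner r (r.comp (l.comp r))) : endRing (r.comp l) →+ endRing r :=
  AddMonoidHom.mk' (fun h => ⟨r adj.e * h.1 * q.1, fun b => by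
      have hq : q.1 * r b = r (l (r b)) * q.1 := q.2 b
      rw [mul_assoc, hq, ← mul_assoc, mul_assoc (r adj.e), endRing_comm, ← mul_assoc,
        adj.r_e_mul, mul_assoc, mul_assoc, mul_assoc]⟩)
    (fun h h' => Subtype.ext (by
      change r adj.e * (h.1 + h'.1) * q.1 = r adj.e * h.1 * q.1 + r adj.e * h'.1 * q.1
      rw [mul_add, add_mul]))

theorem endPairing_val (q : intertwiner r (r.comp (l.comp r))) (h : endRing (r.comp l)) :
    (endPairing adj q h).1 = r adj.e * h.1 * q.1 := rfl

theorem endPairing_left (q : intertwiner r (r.comp (l.comp r))) (x : endRing r)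
    (h : endRing (r.comp l)) :
    endPairing adj q ((endBimodule adj).left.act x h) = x * endPairing adj q h :=
  Subtype.ext (by
    have hx : x.1 * r adj.e = r adj.e * x.1 := x.2 adj.e
    change r adj.e * (x.1 * h.1) * q.1 = x.1 * (r adj.e * h.1 * q.1)
    rw [← mul_assoc, ← hx]
    simp only [mul_assoc])

/-! ### The dual basis of `End(ρλ)` and the embedding of its tensor square in `A` -/

variable {n : ℕ} {p : Fin n → intertwiner (r.comp (l.comp r)) r}
  {q : Fin n → intertwiner r (r.comp (l.comp r))}

/-- The intertwiner property turns `ρ(e) f` into `f ρλρ(e)`, and `ρ(e) m = 1`. So `f ↦ f ρλ(m)` and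
`h ↦ ρ(e) h` are inverse bijections between `Hom(ρλρ, ρ)` and `End(ρλ)`. -/
theorem r_e_mul_comulSnd (f : intertwiner (r.comp (l.comp r)) r) :
    r adj.e * (comulSnd adj f).1 = f.1 := by
  have hf : f.1 * r (l (r adj.e)) = r adj.e * f.1 := f.2 adj.e
  change r adj.e * (f.1 * r (l adj.m)) = f.1
  rw [← mul_assoc, ← hf, mul_assoc, ← map_mul, ← map_mul, adj.r_e_mul_m, map_one, map_one,
    mul_one]

/-- This is the finite dual basis of `End(ρλ)` over `R`, and the point where the direct summand
diagram of `λρ` enters. Multiplied by `ρ(e)` from the left, the sum becomes `ρ(e) h ∑ q i p i`. -/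
theorem sum_endPairing (hpq : IsSummandDiagram p q) (h : endRing (r.comp l)) :
    ∑ i, (endBimodule adj).left.act (endPairing adj (q i) h) (comulSnd adj (p i)) = h := by
  refine r_e_mul_cancel adj ?_
  rw [AddSubmonoidClass.coe_finsetSum, Finset.mul_sum]
  have hi : ∀ i, r adj.e * ((endBimodule adj).left.act (endPairing adj (q i) h)
      (comulSnd adj (p i))).1 = r adj.e * h.1 * (q i * p i) := fun i => by
    change r adj.e * ((endPairing adj (q i) h).1 * (comulSnd adj (p i)).1) = _
    have hx : (endPairing adj (q i) h).1 * r adj.e = r adj.e * (endPairing adj (q i) h).1 :=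
      (endPairing adj (q i) h).2 adj.e
    rw [← mul_assoc, ← hx, mul_assoc, r_e_mul_comulSnd, endPairing_val, mul_assoc]
  rw [Finset.sum_congr rfl fun i _ => hi i, ← Finset.mul_sum]
  exact (congrArg _ hpq).trans (mul_one _)

/-- The map `End(ρλ) ⊗_R End(ρλ) → A`, `h ⊗ h' ↦ ρ(e) h ρλ(h')`. -/
def endTensorEmb : BalTensor (endBimodule adj).right.act (endBimodule adj).left.act →+ A :=
  BalTensor.lift
    (AddMonoidHom.mk' (fun h => AddMonoidHom.mk' (fun h' => r adj.e * h.1 * r (l h'.1))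
      (fun k k' => by
        change r adj.e * h.1 * r (l (k.1 + k'.1)) = _
        rw [map_add, map_add, mul_add]))
      (fun k k' => by
        ext h'
        change r adj.e * (k.1 + k'.1) * r (l h'.1) = _
        rw [mul_add, add_mul]
        rfl))
    (fun x h h' => by
      change r adj.e * ((endTarget adj (op x)).1 * h.1) * r (l h'.1) =
        r adj.e * h.1 * r (l (x.1 * h'.1))
      rw [r_e_mul_endTarget, map_mul, map_mul, mul_assoc])

theorem endTensorEmb_tmul (h h' : endRing (r.comp l)) :
    endTensorEmb adj (BalTensor.tmul _ _ h h') = r adj.e * h.1 * r (l h'.1) := rfl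

/-- If `w` is the image of a tensor and `c i` its `i`-th coefficient, then `ρ(e) c i = ρ(e) w ρλ(q
i)`, and `ρ(e)` can be cancelled in front of elements of `End(ρλ)`. -/
theorem endTensorEmb_injective (hpq : IsSummandDiagram p q) :
    Function.Injective (endTensorEmb adj) := by
  intro z w hzw
  refine BalTensor.ext_coeff _ _ (fun i => endPairing adj (q i))
    (fun i => endPairing_left adj (q i)) (fun i => comulSnd adj (p i))
    (sum_endPairing adj hpq) fun i => r_e_mul_cancel adj ?_
  have key : ∀ z, r adj.e * (BalTensor.coeff (endBimodule adj).right (endBimodule adj).left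
      (endPairing adj (q i)) (endPairing_left adj (q i)) z).1 =
      r adj.e * endTensorEmb adj z * r (l (q i).1) := by
    intro z
    induction z using BalTensor.induction_on with
    | zero => simp
    | add z w hz hw =>
      rw [map_add, map_add, mul_add, add_mul, ← hz, ← hw, ← mul_add]
      rfl
    | tmul h h' =>
      rw [BalTensor.coeff_tmul, endTensorEmb_tmul]
      refine (r_e_mul_endTarget adj _ h).trans ?_
      rw [endPairing_val, map_mul, map_mul, map_mul, map_mul]
      have hc : r adj.e * h.1 * r (l (r adj.e)) = r adj.e * (r adj.e * h.1) := by
        rw [mul_assoc, endRing_comm, ← mul_assoc, adj.r_e_mul, mul_assoc]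
      rw [← mul_assoc, ← mul_assoc, hc]
      simp only [mul_assoc]
  rw [key, key, hzw]

/-- The coproduct of `End(ρλ)` given by a direct summand diagram. -/
def endComul (p : Fin n → intertwiner (r.comp (l.comp r)) r)
    (q : Fin n → intertwiner r (r.comp (l.comp r))) :
    endRing (r.comp l) →+ BalTensor (endBimodule adj).right.act (endBimodule adj).left.act :=
  AddMonoidHom.mk'
    (fun h => ∑ i, BalTensor.tmul _ _ (comulFst adj h (q i)) (comulSnd adj (p i)))
    (fun h h' => by
      rw [← Finset.sum_add_distrib]
      refine Finset.sum_congr rfl fun i _ => ?_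
      rw [← BalTensor.add_tmul]
      congr 1
      refine Subtype.ext ?_
      change r adj.e * (h.1 + h'.1) * _ = r adj.e * h.1 * _ + r adj.e * h'.1 * _
      rw [mul_add, add_mul])

theorem endComul_apply (h : endRing (r.comp l)) : endComul adj p q h =
    ∑ i, BalTensor.tmul _ _ (comulFst adj h (q i)) (comulSnd adj (p i)) := rfl

/-- `ρ(e) ρ(e) h ρ(e λ(q m)) = ρ(e) h ρ(e λ(q))`. -/
theorem r_e_mul_comulFst (h : endRing (r.comp l)) (x : intertwiner r (r.comp (l.comp r))) :
    r adj.e * (comulFst adj h x).1 = r adj.e * h.1 * r (adj.e * l x.1) := by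
  have hx : x.1 * r adj.e = r (l (r adj.e)) * x.1 := x.2 adj.e
  change r adj.e * (r adj.e * h.1 * r (adj.e * l (x.1 * adj.m))) = _
  have hc : r adj.e * (r adj.e * h.1) = r adj.e * h.1 * r (l (r adj.e)) := by
    rw [mul_assoc (r adj.e) h.1, endRing_comm, ← mul_assoc, ← mul_assoc, adj.r_e_mul]
  rw [← mul_assoc, hc, mul_assoc, ← map_mul, ← adj.transpose_r_mul, ← mul_assoc (r _) x.1, ← hx,
    mul_assoc x.1, adj.r_e_mul_m, mul_one]

/-- The diagram disappears through `∑ q i p i = 1`, so by injectivity the coproduct does not depend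
on it. -/
theorem endTensorEmb_endComul (hpq : IsSummandDiagram p q) (h : endRing (r.comp l)) :
    endTensorEmb adj (endComul adj p q h) = h.1 * r adj.e := by
  have hi : ∀ i, endTensorEmb adj (BalTensor.tmul _ _ (comulFst adj h (q i))
      (comulSnd adj (p i))) = r adj.e * h.1 * r (adj.e * l (q i * p i)) * r (l (r (l adj.m))) := by
    intro i
    rw [endTensorEmb_tmul, r_e_mul_comulFst]
    change _ * r (l ((p i).1 * r (l adj.m))) = _
    simp only [map_mul, mul_assoc]
  rw [endComul_apply, map_sum, Finset.sum_congr rfl fun i _ => hi i, ← Finset.sum_mul,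
    ← Finset.mul_sum, ← map_sum, ← Finset.mul_sum, ← map_sum]
  refine (congrArg (fun y => r adj.e * h.1 * r (adj.e * l y) * r (l (r (l adj.m)))) hpq).trans ?_
  -- What remains is `ρ(e) h ρ(e) ρλρλ(m)`. Here `ρ(e) ρλρλ(m) = ρλ(m) ρ(e)`, then `ρλ(m)` moves
  -- past `h` and cancels against the first `ρ(e)`.
  rw [map_one, mul_one, mul_assoc, adj.r_e_mul, mul_assoc, ← mul_assoc h.1, endRing_comm,
    mul_assoc, ← mul_assoc, adj.r_e_mul_r_l_m, one_mul]

theorem endTensorEmb_left (x : endRing r)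
    (z : BalTensor (endBimodule adj).right.act (endBimodule adj).left.act) :
    endTensorEmb adj ((LeftAction.tensor (endBimodule adj) (endBimodule adj).left).act x z) =
      x.1 * endTensorEmb adj z := by
  induction z using BalTensor.induction_on with
  | zero => simp
  | add z w hz hw => simp only [map_add, hz, hw, mul_add]
  | tmul h h' =>
    have hx : x.1 * r adj.e = r adj.e * x.1 := x.2 adj.e
    change r adj.e * (x.1 * h.1) * r (l h'.1) = x.1 * (r adj.e * h.1 * r (l h'.1))
    rw [← mul_assoc, ← hx]
    simp only [mul_assoc]

/-- The action multiplies the second factor by the target of `x`, an element `ρ(b)`. It reaches the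
front because `ρλρ(b)` commutes with the first factor and `ρ(e) ρλρ(b) = ρ(b) ρ(e)`. -/
theorem endTensorEmb_right (x : endRing r)
    (z : BalTensor (endBimodule adj).right.act (endBimodule adj).left.act) :
    endTensorEmb adj (((endBimodule adj).right.tensor (endBimodule adj)).act x z) =
      (endTarget adj (op x)).1 * endTensorEmb adj z := by
  induction z using BalTensor.induction_on with
  | zero => simp
  | add z w hz hw => simp only [map_add, hz, hw, mul_add]
  | tmul h h' =>
    change r adj.e * h.1 * r (l (r (adj.e * l (x.1 * adj.m)) * h'.1)) =
      r (adj.e * l (x.1 * adj.m)) * (r adj.e * h.1 * r (l h'.1))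
    rw [map_mul l, map_mul r (l _), ← mul_assoc, mul_assoc (r adj.e) h.1, endRing_comm,
      ← mul_assoc (r adj.e), adj.r_e_mul]
    simp only [mul_assoc]

/-- The factorwise product does not descend to the balanced tensor product, so representatives are
used. Right multiplication by `k ⊗ k'` multiplies the image by `k ρλ(k')`. If the image of `z` ends
in `ρ(e)`, this `ρ(e)` completes `k ρλ(k')` to the image of `k ⊗ k'`. -/
theorem endTensorEmb_proj_mul (z z' : endRing (r.comp l) ⊗[ℤ] endRing (r.comp l)) (a : A)
    (h : endRing (r.comp l))
    (ha : endTensorEmb adj (BalTensor.proj _ _ z) = a * r adj.e)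
    (hz' : endTensorEmb adj (BalTensor.proj _ _ z') = h.1 * r adj.e) :
    endTensorEmb adj (BalTensor.proj _ _ (z * z')) = a * h.1 * r adj.e := by
  suffices H : ∀ z', endTensorEmb adj (BalTensor.proj _ _ (z * z')) =
      a * endTensorEmb adj (BalTensor.proj _ _ z') by rw [H, hz', mul_assoc]
  intro z'
  induction z' using TensorProduct.induction_on with
  | zero => simp
  | add x y hx hy => rw [mul_add, map_add, map_add, hx, hy, map_add, map_add, mul_add]
  | tmul k k' =>
    suffices H : ∀ z : endRing (r.comp l) ⊗[ℤ] endRing (r.comp l),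
        endTensorEmb adj (BalTensor.proj _ _ (z * k ⊗ₜ[ℤ] k')) =
          endTensorEmb adj (BalTensor.proj _ _ z) * (k.1 * r (l k'.1)) by
      rw [H, ha]
      change _ = a * (r adj.e * k.1 * r (l k'.1))
      simp only [mul_assoc]
    intro z
    induction z using TensorProduct.induction_on with
    | zero => simp
    | add x y hx hy => rw [add_mul, map_add, map_add, hx, hy, map_add, map_add, add_mul]
    | tmul h h' =>
      rw [Algebra.TensorProduct.tmul_mul_tmul]
      change r adj.e * (h.1 * k.1) * r (l (h'.1 * k'.1)) =
        r adj.e * h.1 * r (l h'.1) * (k.1 * r (l k'.1))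
      have hk := endRing_comm k h'.1
      rw [map_mul, map_mul, ← mul_assoc, ← mul_assoc, mul_assoc (r adj.e * h.1) k.1, hk]
      simp only [mul_assoc]

/-- Right multiplication `h ↦ ρ(e) h ρ(e λ(q m))`, as an additive map. -/
def comulFstHom (x : intertwiner r (r.comp (l.comp r))) :
    endRing (r.comp l) →+ endRing (r.comp l) :=
  AddMonoidHom.mk' (fun h => comulFst adj h x) fun h h' => Subtype.ext (by
    change r adj.e * (h.1 + h'.1) * _ = r adj.e * h.1 * _ + r adj.e * h'.1 * _
    rw [mul_add, add_mul])

theorem comulFstHom_left (x : intertwiner r (r.comp (l.comp r))) (s : endRing r)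
    (h : endRing (r.comp l)) : comulFstHom adj x ((endBimodule adj).left.act s h) =
      (endBimodule adj).left.act s (comulFstHom adj x h) := Subtype.ext (by
  have hs : s.1 * r adj.e = r adj.e * s.1 := s.2 adj.e
  change r adj.e * (s.1 * h.1) * r _ = s.1 * (r adj.e * h.1 * r _)
  rw [← mul_assoc, ← hs]
  simp only [mul_assoc])

/-- This is coassociativity in the form required by `coassoc_of_components`. In `A` both sides are
`ρ(e) h ρ(e λ(x m)) ρ(e)`. -/
theorem endComul_comulFst (hpq : IsSummandDiagram p q) (h : endRing (r.comp l))
    (x : intertwiner r (r.comp (l.comp r))) :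
    endComul adj p q (comulFst adj h x) =
      BalTensor.mapRight _ (comulFstHom adj x) (comulFstHom_left adj x)
        (endComul adj p q h) := by
  refine endTensorEmb_injective adj hpq ?_
  have key : ∀ z, endTensorEmb adj (BalTensor.mapRight _ (comulFstHom adj x)
      (comulFstHom_left adj x) z) =
      r adj.e * endTensorEmb adj z * r (l (r (adj.e * l (x.1 * adj.m)))) := by
    intro z
    induction z using BalTensor.induction_on with
    | zero => simp
    | add z w hz hw => simp only [map_add, hz, hw, mul_add, add_mul]
    | tmul k k' =>
      change r adj.e * k.1 * r (l (r adj.e * k'.1 * r (adj.e * l (x.1 * adj.m)))) =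
        r adj.e * (r adj.e * k.1 * r (l k'.1)) * r (l (r (adj.e * l (x.1 * adj.m))))
      have hc : r adj.e * k.1 * r (l (r adj.e)) = r adj.e * (r adj.e * k.1) := by
        rw [mul_assoc, endRing_comm, ← mul_assoc, adj.r_e_mul, mul_assoc]
      rw [map_mul l (r adj.e * k'.1), map_mul l (r adj.e), map_mul r (l _ * l _),
        map_mul r (l (r _)), ← mul_assoc, ← mul_assoc (r adj.e * k.1), hc]
      simp only [mul_assoc]
  rw [key, endTensorEmb_endComul adj hpq, endTensorEmb_endComul adj hpq]
  change r adj.e * h.1 * r _ * r adj.e = r adj.e * (h.1 * r adj.e) * r _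
  rw [mul_assoc, ← adj.r_e_mul]
  simp only [mul_assoc]

/-- The structure of a coring on `End(ρλ)`. -/
def endCoring (hpq : IsSummandDiagram p q) : Coring (endBimodule adj) where
  comul := endComul adj p q
  comul_left x h := by
    refine endTensorEmb_injective adj hpq ?_
    rw [endTensorEmb_left, endTensorEmb_endComul adj hpq, endTensorEmb_endComul adj hpq,
      ← mul_assoc]
    rfl
  comul_right x h := by
    refine endTensorEmb_injective adj hpq ?_
    rw [endTensorEmb_right, endTensorEmb_endComul adj hpq, endTensorEmb_endComul adj hpq,
      ← mul_assoc]
    rfl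
  counit := endPairing adj adj.unit
  counit_left := endPairing_left adj adj.unit
  counit_right x h := Subtype.ext (by
    change r adj.e * ((endTarget adj (op x)).1 * h.1) * adj.m = r adj.e * h.1 * adj.m * x.1
    rw [r_e_mul_endTarget, mul_assoc, ← adj.m_mul, ← mul_assoc])
  coassoc h := coassoc_of_components (fun i => comulSnd adj (p i))
    (fun i k => comulFst adj k (q i)) (fun i => comulFstHom adj (q i))
    (fun i => comulFstHom_left adj (q i)) (endComul_apply adj) (endComul_apply adj) _ _
    (fun i k => endComul_comulFst adj hpq k (q i)) h
  counit_comul h := by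
    rw [endComul_apply, map_sum]
    conv_rhs => rw [← sum_endPairing adj hpq h]
    refine Finset.sum_congr rfl fun i _ => ?_
    rw [BalTensor.lift_tmul]
    change (endBimodule adj).left.act (endPairing adj adj.unit (comulFst adj h (q i))) _ = _
    -- The counit of the first component `ρ(e) h ρ(e λ(q i m))` is the dual basis coefficient `ρ(e)
    -- h q i`, so the sum is the expansion of `h`.
    congr 2
    refine Subtype.ext ?_
    rw [endPairing_val, endPairing_val, r_e_mul_comulFst]
    exact (mul_assoc _ _ _).trans (congrArg _ (adj.transpose_mul_m _))
  comul_counit h := by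
    rw [endComul_apply, map_sum]
    -- Behind `ρ(e)` the `i`-th term becomes `ρ(e) h ρ(e λ(q i p i m))`; summation leaves `e λ(m) =
    -- 1`.
    refine r_e_mul_cancel adj ?_
    rw [AddSubmonoidClass.coe_finsetSum, Finset.mul_sum]
    have hi : ∀ i, r adj.e * (BalTensor.lift (ra := (endBimodule adj).right.act)
      (la := (endBimodule adj).left.act) (AddMonoidHom.mk' (fun h => (endBimodule adj).right.act
        (endPairing adj adj.unit h)) (fun h h' => by
          ext k; simp [(endBimodule adj).right.act_add])).flip
        (fun r h k => by simp [endPairing_left, (endBimodule adj).right.act_mul])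
        (BalTensor.tmul _ _ (comulFst adj h (q i)) (comulSnd adj (p i)))).1 =
        r adj.e * h.1 * r (adj.e * l (q i * p i * adj.m)) := by
      intro i
      rw [BalTensor.lift_tmul]
      refine (r_e_mul_endTarget adj _ _).trans ?_
      rw [r_e_mul_comulFst, endPairing_val, r_e_mul_comulSnd]
      change _ * r (l ((p i).1 * adj.m)) = _
      rw [mul_assoc (q i).1]
      simp only [map_mul, mul_assoc]
    rw [Finset.sum_congr rfl fun i _ => hi i, ← Finset.mul_sum, ← map_sum, ← Finset.mul_sum,
      ← map_sum, ← Finset.sum_mul]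
    refine (congrArg (fun y => r adj.e * h.1 * r (adj.e * l (y * adj.m))) hpq).trans ?_
    rw [one_mul, adj.e_mul_l_m, map_one, mul_one]

/-- `ε(h) m = h m` for `h` in `End(ρλ)`. -/
theorem endPairing_unit_mul_m (h : endRing (r.comp l)) :
    (endPairing adj adj.unit h).1 * adj.m = h.1 * adj.m := by
  change r adj.e * h.1 * adj.m * adj.m = h.1 * adj.m
  rw [mul_assoc (r adj.e * h.1), adj.m_mul, ← mul_assoc, mul_assoc (r adj.e), endRing_comm,
    ← mul_assoc, adj.r_e_mul_r_l_m, one_mul]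

/-- The left bialgebroid `End(ρλ)` over `End(ρ)`. -/
def endBialgebroid (hpq : IsSummandDiagram p q) :
    LeftBialgebroid (endRing r) (endRing (r.comp l)) where
  source := endSource l r
  target := endTarget adj
  source_target := endSource_mul_endTarget adj
  coring := endCoring adj hpq
  takeuchi h z hz x := by
    refine endTensorEmb_injective adj hpq ?_
    have h₁ : ∀ z : endRing (r.comp l) ⊗[ℤ] endRing (r.comp l),
        endTensorEmb adj (BalTensor.proj _ _ (z * (endTarget adj (op x) ⊗ₜ[ℤ] 1))) =
        endTensorEmb adj (BalTensor.proj _ _ z) * (endTarget adj (op x)).1 := by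
      intro z
      induction z using TensorProduct.induction_on with
      | zero => simp
      | add x y hx hy => rw [add_mul, map_add, map_add, hx, hy, map_add, map_add, add_mul]
      | tmul k k' =>
        rw [Algebra.TensorProduct.tmul_mul_tmul, mul_one]
        change r adj.e * (k.1 * (endTarget adj (op x)).1) * r (l k'.1) =
          r adj.e * k.1 * r (l k'.1) * (endTarget adj (op x)).1
        rw [mul_assoc (r adj.e * k.1), ← endRing_comm]
        simp only [mul_assoc]
    have h₂ : ∀ z : endRing (r.comp l) ⊗[ℤ] endRing (r.comp l),
        endTensorEmb adj (BalTensor.proj _ _ (z * (1 ⊗ₜ[ℤ] endSource l r x))) =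
        endTensorEmb adj (BalTensor.proj _ _ z) * r (l x.1) := by
      intro z
      induction z using TensorProduct.induction_on with
      | zero => simp
      | add x y hx hy => rw [add_mul, map_add, map_add, hx, hy, map_add, map_add, add_mul]
      | tmul k k' =>
        rw [Algebra.TensorProduct.tmul_mul_tmul, mul_one]
        change r adj.e * k.1 * r (l (k'.1 * x.1)) = r adj.e * k.1 * r (l k'.1) * r (l x.1)
        rw [map_mul, map_mul, mul_assoc]
        simp only [mul_assoc]
    have hz' : endTensorEmb adj (BalTensor.proj _ _ z) = h.1 * r adj.e :=
      (congrArg _ hz).trans (endTensorEmb_endComul adj hpq h)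
    -- On images, the two sides of the Takeuchi condition are `h ρ(e) ρ(e λ(x m))` and `h ρ(e)
    -- ρλ(x)`, which agree by `e_mul_transpose`.
    rw [h₁, h₂, hz', endTarget_val, mul_assoc, ← map_mul, adj.e_mul_transpose, map_mul, mul_assoc]
  comul_one := by
    refine endTensorEmb_injective adj hpq ((endTensorEmb_endComul adj hpq 1).trans ?_)
    rw [endTensorEmb_tmul]
    change 1 * r adj.e = r adj.e * 1 * r (l 1)
    simp
  comul_mul h h' z z' hz hz' := by
    refine endTensorEmb_injective adj hpq ((endTensorEmb_endComul adj hpq _).trans ?_)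
    exact (endTensorEmb_proj_mul adj z z' h.1 h'
      ((congrArg _ hz).trans (endTensorEmb_endComul adj hpq h))
      ((congrArg _ hz').trans (endTensorEmb_endComul adj hpq h'))).symm
  counit_one := Subtype.ext (by
    change r adj.e * 1 * adj.m = 1
    rw [mul_one, adj.r_e_mul_m])
  counit_mul_source h h' := Subtype.ext (by
    change r adj.e * (h.1 * (endPairing adj adj.unit h').1) * adj.m =
      r adj.e * (h.1 * h'.1) * adj.m
    rw [mul_assoc, mul_assoc h.1, endPairing_unit_mul_m]
    simp only [mul_assoc])
  counit_mul_target h h' := Subtype.ext (by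
    change r adj.e * (h.1 * r (adj.e * l ((endPairing adj adj.unit h').1 * adj.m))) * adj.m =
      r adj.e * (h.1 * h'.1) * adj.m
    rw [mul_assoc, mul_assoc h.1, adj.transpose_mul_m, endPairing_unit_mul_m]
    simp only [mul_assoc])

/-- The coproduct formula is required for every diagram, not only for the one used in the
construction; both give the image `h ρ(e)`. -/
theorem endBialgebroid_isEndBialgebroid (hpq : IsSummandDiagram p q) :
    IsEndBialgebroid adj (endBialgebroid adj hpq) where
  source _ := rfl
  target _ := rfl
  counit _ := rfl
  comul _ _ _ hpq' h := endTensorEmb_injective adj hpq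
    ((endTensorEmb_endComul adj hpq h).trans (endTensorEmb_endComul adj hpq' h).symm)

/-! ## The coaction of `End(ρλ)` on `A` -/

/-- The map `A ⊗_R End(ρλ) → A`, `a ⊗ h ↦ a ρ(e) h`. -/
def coactionEmb :
    BalTensor (ringRightAction (endRing r).subtype).act (endBimodule adj).left.act →+ A :=
  BalTensor.lift
    (AddMonoidHom.mk' (fun a => (AddMonoidHom.mulLeft (a * r adj.e)).comp
        (endRing (r.comp l)).subtype.toAddMonoidHom)
      (fun a a' => by
        ext h
        change (a + a') * r adj.e * h.1 = a * r adj.e * h.1 + a' * r adj.e * h.1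
        rw [add_mul, add_mul]))
    (fun x a h => by
      have hx : x.1 * r adj.e = r adj.e * x.1 := x.2 adj.e
      change a * x.1 * r adj.e * h.1 = a * r adj.e * (x.1 * h.1)
      rw [mul_assoc a, hx]
      simp only [mul_assoc])

theorem coactionEmb_tmul (a : A) (h : endRing (r.comp l)) :
    coactionEmb adj (BalTensor.tmul _ _ a h) = a * r adj.e * h.1 := rfl

/-- The `i`-th coefficient of a tensor is its image times `q i`. -/
theorem coactionEmb_injective (hpq : IsSummandDiagram p q) :
    Function.Injective (coactionEmb adj) := by
  intro z w hzw
  refine BalTensor.ext_coeff _ _ (fun i => endPairing adj (q i))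
    (fun i => endPairing_left adj (q i)) (fun i => comulSnd adj (p i))
    (sum_endPairing adj hpq) fun i => ?_
  have key : ∀ z, BalTensor.coeff (ringRightAction (endRing r).subtype) (endBimodule adj).left
      (endPairing adj (q i)) (endPairing_left adj (q i)) z = coactionEmb adj z * (q i).1 := by
    intro z
    induction z using BalTensor.induction_on with
    | zero => simp
    | add z w hz hw => rw [map_add, map_add, add_mul, ← hz, ← hw]
    | tmul a h =>
      rw [BalTensor.coeff_tmul, coactionEmb_tmul]
      change a * (r adj.e * h.1 * (q i).1) = _
      simp only [mul_assoc]
  rw [key, key, hzw]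

/-- The coaction of `End(ρλ)` on `A` given by a direct summand diagram. -/
def endCoact (p : Fin n → intertwiner (r.comp (l.comp r)) r)
    (q : Fin n → intertwiner r (r.comp (l.comp r))) :
    A →+ BalTensor (ringRightAction (endRing r).subtype).act (endBimodule adj).left.act :=
  AddMonoidHom.mk'
    (fun a => ∑ i, BalTensor.tmul _ _ (r (adj.e * l a) * (q i).1) (comulSnd adj (p i)))
    (fun a a' => by
      rw [← Finset.sum_add_distrib]
      refine Finset.sum_congr rfl fun i _ => ?_
      rw [← BalTensor.add_tmul, map_add l, mul_add, map_add, add_mul])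

theorem endCoact_apply (a : A) : endCoact adj p q a =
    ∑ i, BalTensor.tmul _ _ (r (adj.e * l a) * (q i).1) (comulSnd adj (p i)) := rfl

/-- Here `ρ(e) p i ρλ(m) = p i`, so the sum collapses. In `A` the coaction is the transposition `a ↦
ρ(e λ(a))`, independent of the diagram. -/
theorem coactionEmb_endCoact (hpq : IsSummandDiagram p q) (a : A) :
    coactionEmb adj (endCoact adj p q a) = r (adj.e * l a) := by
  have hi : ∀ i, coactionEmb adj (BalTensor.tmul _ _ (r (adj.e * l a) * (q i).1)
      (comulSnd adj (p i))) = r (adj.e * l a) * (q i * p i) := by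
    intro i
    rw [coactionEmb_tmul, mul_assoc, r_e_mul_comulSnd, mul_assoc]
  rw [endCoact_apply, map_sum, Finset.sum_congr rfl fun i _ => hi i, ← Finset.mul_sum]
  exact (congrArg _ hpq).trans (mul_one _)

theorem coactionEmb_leftMul (a : A)
    (z : BalTensor (ringRightAction (endRing r).subtype).act (endBimodule adj).left.act) :
    coactionEmb adj (leftMul _ _ a z) = a * coactionEmb adj z := by
  induction z using BalTensor.induction_on with
  | zero => simp
  | add z w hz hw => simp only [map_add, hz, hw, mul_add]
  | tmul a' h =>
    change a * a' * r adj.e * h.1 = a * (a' * r adj.e * h.1)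
    simp only [mul_assoc]

/-- This is the input of `coassoc_of_components` for the coaction. In `A` both sides are `ρ(e λ(a))
ρ(e λ(x))`. -/
theorem endCoact_component (hpq : IsSummandDiagram p q) (a : A)
    (x : intertwiner r (r.comp (l.comp r))) :
    endCoact adj p q (r (adj.e * l a) * x.1) =
      BalTensor.mapRight _ (comulFstHom adj x) (comulFstHom_left adj x) (endCoact adj p q a) := by
  refine coactionEmb_injective adj hpq ?_
  have key : ∀ z, coactionEmb adj (BalTensor.mapRight _ (comulFstHom adj x)
      (comulFstHom_left adj x) z) = coactionEmb adj z * r (adj.e * l x.1) := by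
    intro z
    induction z using BalTensor.induction_on with
    | zero => simp
    | add z w hz hw => simp only [map_add, hz, hw, add_mul]
    | tmul a h =>
      rw [BalTensor.mapRight_tmul, coactionEmb_tmul, coactionEmb_tmul, mul_assoc]
      refine (congrArg (a * ·) (r_e_mul_comulFst adj h x)).trans ?_
      simp only [mul_assoc]
  rw [key, coactionEmb_endCoact adj hpq, coactionEmb_endCoact adj hpq, ← map_mul,
    adj.transpose_r_mul]

/-- The comodule `A` over the coring `End(ρλ)`. -/
def endComodule (hpq : IsSummandDiagram p q) :
    Comodule (endCoring adj hpq) (ringRightAction (endRing r).subtype) where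
  coact := endCoact adj p q
  coact_right x a := by
    refine coactionEmb_injective adj hpq ?_
    -- In `A` the right action of `x` is right multiplication by `ρλ(x)`, and `e λ(a) λ(x) = e λ(a
    -- x)`.
    have key : ∀ z, coactionEmb adj (((ringRightAction (endRing r).subtype).tensor
        (endBimodule adj)).act x z) = coactionEmb adj z * r (l x.1) := by
      intro z
      induction z using BalTensor.induction_on with
      | zero => simp
      | add z w hz hw => simp only [map_add, hz, hw, add_mul]
      | tmul a h =>
        change a * r adj.e * ((endTarget adj (op x)).1 * h.1) = a * r adj.e * h.1 * r (l x.1)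
        rw [mul_assoc, r_e_mul_endTarget]
        simp only [mul_assoc]
    refine Eq.trans (coactionEmb_endCoact adj hpq (a * x.1)) (Eq.trans ?_ (key _).symm)
    rw [coactionEmb_endCoact adj hpq, ← map_mul, mul_assoc, ← map_mul]
  coassoc a := coassoc_of_components (fun i => comulSnd adj (p i))
    (fun i a => r (adj.e * l a) * (q i).1) (fun i => comulFstHom adj (q i))
    (fun i => comulFstHom_left adj (q i)) (endCoact_apply adj) (endComul_apply adj) _ _
    (fun i k => endCoact_component adj hpq k (q i)) a
  coact_counit a := by
    refine (congrArg _ (endCoact_apply adj a)).trans ((map_sum _ _ _).trans ?_)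
    -- The counit of `p i ρλ(m)` is `p i m`, so the sum is `ρ(e λ(a)) m = a`.
    have hi : ∀ i, r (adj.e * l a) * (q i).1 * (r adj.e * (comulSnd adj (p i)).1 * adj.m) =
        r (adj.e * l a) * (q i * p i) * adj.m := fun i => by
      rw [r_e_mul_comulSnd]
      simp only [mul_assoc]
    refine (Finset.sum_congr rfl fun i _ => hi i).trans ?_
    rw [← Finset.sum_mul, ← Finset.mul_sum]
    refine (congrArg (fun y => r (adj.e * l a) * y * adj.m) hpq).trans ?_
    rw [mul_one, adj.transpose_mul_m]
/-- The comodule algebra `A` over `End(ρλ)`. -/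
def endComoduleAlgebra (hpq : IsSummandDiagram p q) :
    (endBialgebroid adj hpq).ComoduleAlgebra (endRing r).subtype where
  __ := endComodule adj hpq
  takeuchi a z hz x := by
    refine coactionEmb_injective adj hpq ?_
    have h₁ : ∀ z : A ⊗[ℤ] endRing (r.comp l),
        coactionEmb adj (BalTensor.proj _ _ (((endRing r).subtype x ⊗ₜ[ℤ] 1) * z)) =
        x.1 * coactionEmb adj (BalTensor.proj _ _ z) := by
      intro z
      induction z using TensorProduct.induction_on with
      | zero => simp
      | add x y hx hy => rw [mul_add, map_add, map_add, hx, hy, map_add, map_add, mul_add]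
      | tmul k k' =>
        rw [Algebra.TensorProduct.tmul_mul_tmul, one_mul]
        change x.1 * k * r adj.e * k'.1 = x.1 * (k * r adj.e * k'.1)
        simp only [mul_assoc]
    have h₂ : ∀ z : A ⊗[ℤ] endRing (r.comp l),
        coactionEmb adj (BalTensor.proj _ _ (z * (1 ⊗ₜ[ℤ] endSource l r x))) =
        coactionEmb adj (BalTensor.proj _ _ z) * x.1 := by
      intro z
      induction z using TensorProduct.induction_on with
      | zero => simp
      | add x y hx hy => rw [add_mul, map_add, map_add, hx, hy, map_add, map_add, add_mul]
      | tmul k k' =>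
        rw [Algebra.TensorProduct.tmul_mul_tmul, mul_one]
        change k * r adj.e * (k'.1 * x.1) = k * r adj.e * k'.1 * x.1
        simp only [mul_assoc]
    have hz' : coactionEmb adj (BalTensor.proj _ _ z) = r (adj.e * l a) :=
      (congrArg _ hz).trans (coactionEmb_endCoact adj hpq a)
    refine (h₁ z).trans (Eq.trans ?_ (h₂ z).symm)
    rw [hz']
    -- The image `ρ(e λ(a))` of the coaction lies in `ρ(B)`, hence commutes with `x`.
    exact (x.2 _)
  coact_one := by
    refine coactionEmb_injective adj hpq ((coactionEmb_endCoact adj hpq 1).trans ?_)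
    refine Eq.trans ?_ (coactionEmb_tmul adj 1 1).symm
    change _ = 1 * r adj.e * 1
    simp
  coact_mul a a' z z' hz hz' := by
    refine coactionEmb_injective adj hpq ((coactionEmb_endCoact adj hpq (a * a')).trans ?_)
    have hz₁ : coactionEmb adj (BalTensor.proj _ _ z) = r (adj.e * l a) :=
      (congrArg _ hz).trans (coactionEmb_endCoact adj hpq a)
    have hz₂ : coactionEmb adj (BalTensor.proj _ _ z') = r (adj.e * l a') :=
      (congrArg _ hz').trans (coactionEmb_endCoact adj hpq a')
    -- The twisted product with `c ⊗ h` on the left encloses the image of `z'` between `c` and `h`.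
    -- With `ρ(e λ(a')) = ρ(e) ρλ(a')` in the middle, `ρλ(a')` moves past `h` to the right end.
    have h₁ : ∀ (c : A) (h : endRing (r.comp l)) (z' : A ⊗[ℤ] endRing (r.comp l)),
        coactionEmb adj (BalTensor.proj _ _ (twistedMul _ _ (c ⊗ₜ[ℤ] h) z')) =
          c * coactionEmb adj (BalTensor.proj _ _ z') * h.1 := by
      intro c h z'
      induction z' using TensorProduct.induction_on with
      | zero => simp
      | add x y hx hy => rw [map_add, map_add, map_add, hx, hy, map_add, map_add, mul_add, add_mul]
      | tmul k k' =>
        rw [twistedMul_tmul_tmul]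
        change c * k * r adj.e * (k'.1 * h.1) = c * (k * r adj.e * k'.1) * h.1
        simp only [mul_assoc]
    have h₂ : ∀ z : A ⊗[ℤ] endRing (r.comp l),
        coactionEmb adj (BalTensor.proj _ _ (twistedMul _ _ z z')) =
          coactionEmb adj (BalTensor.proj _ _ z) * r (l a') := by
      intro z
      induction z using TensorProduct.induction_on with
      | zero => simp
      | add x y hx hy =>
        rw [map_add, LinearMap.add_apply, map_add, map_add, hx, hy, map_add, map_add, add_mul]
      | tmul k k' =>
        rw [h₁, hz₂]
        change k * r (adj.e * l a') * k'.1 = k * r adj.e * k'.1 * r (l a')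
        rw [mul_assoc (k * r adj.e), endRing_comm, map_mul]
        simp only [mul_assoc]
    refine Eq.trans ?_ (h₂ z).symm
    rw [hz₁, map_mul l, ← mul_assoc, map_mul r]

theorem endComoduleAlgebra_isEndCoaction (hpq : IsSummandDiagram p q) :
    IsEndCoaction adj (endBialgebroid adj hpq) (endComoduleAlgebra adj hpq) :=
  fun _ _ _ hpq' a => coactionEmb_injective adj hpq
    ((coactionEmb_endCoact adj hpq a).trans (coactionEmb_endCoact adj hpq' a).symm)

/-- The Galois map `A ⊗_B A → A ⊗_R End(ρλ)`. -/
def galoisMap (p : Fin n → intertwiner (r.comp (l.comp r)) r)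
    (q : Fin n → intertwiner r (r.comp (l.comp r))) (hpq : IsSummandDiagram p q) :
    BalTensor (fun b : B => AddMonoidHom.mulRight (r b))
      (fun b : B => AddMonoidHom.mulLeft (r b)) →+
    BalTensor (ringRightAction (endRing r).subtype).act (endBimodule adj).left.act :=
  BalTensor.lift
    (AddMonoidHom.mk' (fun a => (leftMul _ _ a).comp (endCoact adj p q))
      (fun a a' => by
        ext c
        refine coactionEmb_injective adj hpq ?_
        rw [AddMonoidHom.add_apply, map_add]
        simp only [AddMonoidHom.comp_apply, coactionEmb_leftMul, add_mul]))
    -- In `A` the two sides are `a ρ(b) ρ(e λ(a'))` and `a ρ(e λ(ρ(b) a'))`, equal because `a' ↦ e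
    -- λ(a')` is left `B`-linear.
    (fun b a a' => by
      refine coactionEmb_injective adj hpq ?_
      simp only [AddMonoidHom.mk'_apply, AddMonoidHom.comp_apply, coactionEmb_leftMul,
        coactionEmb_endCoact adj hpq, AddMonoidHom.coe_mulRight, AddMonoidHom.coe_mulLeft,
        adj.transpose_r_mul, map_mul r, mul_assoc])

theorem coactionEmb_galoisMap (hpq : IsSummandDiagram p q) (a a' : A) :
    coactionEmb adj (galoisMap adj p q hpq (BalTensor.tmul _ _ a a')) =
      a * r (adj.e * l a') := by
  refine (coactionEmb_leftMul adj a (endCoact adj p q a')).trans ?_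
  rw [coactionEmb_endCoact adj hpq]

/-- The inverse sends `z` to its image in `A` tensored with `m`. Indeed `a ρ(e λ(a')) ⊗_B m = a ⊗_B
ρ(e λ(a')) m = a ⊗_B a'`, and in the other direction `e λ(m) = 1`. -/
theorem galoisMap_bijective (hpq : IsSummandDiagram p q) :
    Function.Bijective (galoisMap adj p q hpq) := by
  constructor
  · refine Function.LeftInverse.injective (g := fun z => BalTensor.tmulHom _ _
      (coactionEmb adj z) adj.m) fun z => ?_
    induction z using BalTensor.induction_on with
    | zero => simp
    | add z w hz hw =>
      dsimp only at hz hw ⊢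
      rw [map_add, map_add, map_add, AddMonoidHom.add_apply, hz, hw]
    | tmul a a' =>
      dsimp only
      rw [coactionEmb_galoisMap, BalTensor.tmulHom_apply]
      refine (BalTensor.tmul_balanced (ra := fun b : B => AddMonoidHom.mulRight (r b))
        (la := fun b : B => AddMonoidHom.mulLeft (r b)) (adj.e * l a') a adj.m).trans ?_
      exact congrArg _ (adj.transpose_mul_m a')
  · intro z
    refine ⟨BalTensor.tmul _ _ (coactionEmb adj z) adj.m, coactionEmb_injective adj hpq ?_⟩
    rw [coactionEmb_galoisMap, adj.e_mul_l_m, map_one, mul_one]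

/-- `ρ` is a Galois extension over `End(ρλ)`. -/
theorem endComoduleAlgebra_isGalois (hpq : IsSummandDiagram p q) :
    IsGalois r (endComoduleAlgebra adj hpq).coact := by
  constructor
  · ext a
    have h₁ : a ∈ coinvariants (endComoduleAlgebra adj hpq).coact ↔
        r (adj.e * l a) = a * r adj.e := by
      have e₁ := coactionEmb_endCoact adj hpq a
      have e₂ : coactionEmb adj (BalTensor.tmul _ _ a 1) = a * r adj.e :=
        (coactionEmb_tmul adj a 1).trans (mul_one _)
      rw [← e₁, ← e₂]
      exact (coactionEmb_injective adj hpq).eq_iff.symm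
    rw [h₁]
    constructor
    · intro h
      -- Multiplying `ρ(e λ(a)) = a ρ(e)` on the right by `ρλ(m)` gives `ρ(e λ(a m)) = a`.
      refine ⟨adj.e * l (a * adj.m), ?_⟩
      rw [map_mul l, ← mul_assoc, map_mul r, h, mul_assoc, adj.r_e_mul_r_l_m, mul_one]
    · rintro ⟨b, rfl⟩
      rw [adj.e_mul, map_mul]
  · exact ⟨galoisMap adj p q hpq, fun _ _ => rfl, galoisMap_bijective adj hpq⟩

end Adjunction

/-! ## The fiber functor and the field algebra -/

/-- The implementation formula at `b = 1` is the diagram. Nothing is lost, since `f i ρ(b) = ρσ(b) f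
i` gives the formula for all `b` back. -/
theorem Implementable.exists_isSummandDiagram {ρ : B →+* A} {σ : B →+* B}
    (h : Implementable ρ σ) : ∃ (n : ℕ) (p : Fin n → intertwiner (ρ.comp σ) ρ)
      (q : Fin n → intertwiner ρ (ρ.comp σ)), IsSummandDiagram p q := by
  obtain ⟨n, f, f', hf⟩ := h
  refine ⟨n, f', f, ?_⟩
  have h1 := hf 1
  simp only [map_one, mul_one] at h1
  exact h1.symm

section FiberFunctor

variable (adj : RingAdjunction l r) {C : ObjectProperty (EndCat B)}

/-- The arrow `e λ(x) : λρ → α` corresponding to `x` in `Hom(ρ, ρα)`. -/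
def transposeHom (hγ : C ⟨l.comp r⟩) (α : C.FullSubcategory)
    (x : intertwiner r (r.comp α.obj.hom)) :
    (⟨⟨l.comp r⟩, hγ⟩ : C.FullSubcategory) ⟶ α :=
  ObjectProperty.homMk ⟨adj.e * l x.1, fun b => by
    have hx : x.1 * r b = r (α.obj.hom b) * x.1 := x.2 b
    change adj.e * l x.1 * l (r b) = α.obj.hom b * (adj.e * l x.1)
    rw [mul_assoc, ← map_mul, hx, adj.transpose_r_mul]⟩

/-- By the triangle identity, `m` is a universal element of `F` at `λρ`. -/
theorem fiberFunctor_map_transposeHom (hγ : C ⟨l.comp r⟩) (α : C.FullSubcategory)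
    (x : intertwiner r (r.comp α.obj.hom)) :
    (fiberFunctor C r).map (transposeHom adj hγ α x) adj.unit = x :=
  Subtype.ext (adj.transpose_mul_m x.1)

theorem fiberFunctor_additive : (fiberFunctor C r).Additive where
  map_add {α β t s} := by
    ext x
    refine Subtype.ext ?_
    change r (t.hom.1 + s.hom.1) * x.1 = r t.hom.1 * x.1 + r s.hom.1 * x.1
    rw [map_add, add_mul]

/-- Every element of a tensor product with the fiber functor is concentrated at the representing
object `λρ`. -/
theorem coendTensor_mk_eq (hγ : C ⟨l.comp r⟩) (G : C.FullSubcategoryᵒᵖ ⥤ AddCommGrpCat.{u})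
    (α : C.FullSubcategory) (y : G.obj (Opposite.op α))
    (x : intertwiner r (r.comp α.obj.hom)) :
    CoendTensor.mk G (fiberFunctor C r) α y x =
      CoendTensor.mk G (fiberFunctor C r) ⟨⟨l.comp r⟩, hγ⟩
        (G.map (transposeHom adj hγ α x).op y) adj.unit := by
  refine Eq.trans ?_ (CoendTensor.mk_rel (F := fiberFunctor C r) (transposeHom adj hγ α x) y
    adj.unit).symm
  rw [fiberFunctor_map_transposeHom]

/-! ### The isomorphism with `A`, the unit, essential strongness and representability -/

variable [C.IsMonoidal]

theorem fieldCounit_comp_fieldExt :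
    (fieldCounit C r).comp (fieldExt C (fiberFunctor C r)) = r := by
  ext b
  refine (fieldCounit_mk C r (𝟙_ C.FullSubcategory) b _).trans ?_
  exact mul_one (r b)

/-- The map `a ↦ e λ(a) ⊗_{λρ} m` from `A` to the field algebra. -/
noncomputable def fieldCounitInv (hγ : C ⟨l.comp r⟩) : A →+ FieldAlgebra C (fiberFunctor C r) :=
  ((CoendTensor.mkHom (basicPresheaf C) (fiberFunctor C r) ⟨⟨l.comp r⟩, hγ⟩).flip adj.unit).comp
    ((AddMonoidHom.mulLeft adj.e).comp l.toAddMonoidHom)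

theorem fieldCounitInv_apply (hγ : C ⟨l.comp r⟩) (a : A) : fieldCounitInv adj hγ a =
    fieldMk C (fiberFunctor C r) ⟨⟨l.comp r⟩, hγ⟩ (adj.e * l a) adj.unit := rfl

/-- Concentrated at `λρ`, the element `b ⊗_α x` is `b e λ(x) ⊗ m = e λ(ρ(b) x) ⊗ m`, which depends
only on `ρ(b) x`. -/
theorem fieldCounit_bijective (adj : RingAdjunction l r) (hγ : C ⟨l.comp r⟩) :
    Function.Bijective (fieldCounit C r) := by
  refine Function.bijective_iff_has_inverse.2 ⟨fieldCounitInv adj hγ, fun z => ?_, fun a => ?_⟩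
  · have h : (fieldCounitInv adj hγ).comp (fieldCounitHom C r) = AddMonoidHom.id _ := by
      refine CoendTensor.hom_ext fun α (b : B) x => ?_
      refine (congrArg (fieldCounitInv adj hγ) (fieldCounitHom_mk C r α b x)).trans ?_
      refine Eq.trans ?_ (coendTensor_mk_eq adj hγ (basicPresheaf C) α b x).symm
      rw [fieldCounitInv_apply, adj.transpose_r_mul]
      rfl
    exact DFunLike.congr_fun h z
  · rw [fieldCounitInv_apply, fieldCounit_mk]
    exact adj.transpose_mul_m a

/-- The isomorphism `Υ ⊗_C F ≅ A`. -/
noncomputable def fieldCounitEquiv (hγ : C ⟨l.comp r⟩) :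
    FieldAlgebra C (fiberFunctor C r) ≃+* A :=
  RingEquiv.ofBijective (fieldCounit C r) (fieldCounit_bijective adj hγ)

theorem fieldCounitEquiv_mk (hγ : C ⟨l.comp r⟩) (α : C.FullSubcategory) (b : B)
    (x : intertwiner r (r.comp α.obj.hom)) :
    fieldCounitEquiv adj hγ (fieldMk C (fiberFunctor C r) α b x) = r b * x.1 :=
  fieldCounit_mk C r α b x

theorem fieldUnit_isMonoidalNat : IsMonoidalNat (fieldUnit C (fiberFunctor C r)) := by
  refine ⟨fun α β x y => Subtype.ext ?_, rfl⟩
  change fieldMk C (fiberFunctor C r) (α ⊗ β) 1 _ =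
    fieldMk C (fiberFunctor C r) α 1 x * fieldMk C (fiberFunctor C r) β 1 y
  refine Eq.trans ?_ (CoendTensor.mk_mul_mk (G := basicPresheaf C) (F := fiberFunctor C r)
    α β (1 : B) x (1 : B) y).symm
  have h : (1 : B) = 1 * α.obj.hom 1 := by rw [map_one, mul_one]
  exact congrArg (fun b : B => fieldMk C (fiberFunctor C r) (α ⊗ β) b _) h

/-- The isomorphism `ε_ρ` carries `ρ_F` to `ρ`, hence intertwiners of `ρ_F` to intertwiners of `ρ`.
It sends `1 ⊗_α x` to `x`, so it inverts `η_F` at each object. -/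
theorem fieldUnit_isIso (adj : RingAdjunction l r) (hγ : C ⟨l.comp r⟩) :
    IsIso (fieldUnit C (fiberFunctor C r)) := by
  have hinj := (fieldCounit_bijective adj hγ).1
  have hη : ∀ (α : C.FullSubcategory) (x : intertwiner r (r.comp α.obj.hom)),
      fieldCounit C r (fieldMk C (fiberFunctor C r) α 1 x) = x.1 := fun α x => by
    rw [fieldCounit_mk, map_one, one_mul]
  have hext : ∀ b, fieldCounit C r (fieldExt C (fiberFunctor C r) b) = r b :=
    DFunLike.congr_fun fieldCounit_comp_fieldExt
  have : ∀ α, IsIso ((fieldUnit C (fiberFunctor C r)).app α) := fun α => by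
    rw [ConcreteCategory.isIso_iff_bijective]
    constructor
    · intro x y hxy
      refine Subtype.ext ?_
      have h := congrArg (fun z : intertwiner (fieldExt C (fiberFunctor C r))
        ((fieldExt C (fiberFunctor C r)).comp α.obj.hom) => fieldCounit C r z.1) hxy
      exact (hη α x).symm.trans (h.trans (hη α y))
    · intro y
      have hy : ∀ b, y.1 * fieldExt C (fiberFunctor C r) b =
        fieldExt C (fiberFunctor C r) (α.obj.hom b) * y.1 := y.2
      refine ⟨⟨fieldCounit C r y.1, fun b => ?_⟩, Subtype.ext (hinj (hη α _))⟩
      change fieldCounit C r y.1 * r b = r (α.obj.hom b) * fieldCounit C r y.1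
      rw [← hext b, ← map_mul, hy, map_mul, hext]
  exact NatIso.isIso_of_isIso_app _

/-- The multiplication `F α ⊗_R F β → F (αβ)` has the inverse `w ↦ ∑ q i ⊗ p i w`. -/
theorem fiberFunctor_essentiallyStrong
    (hC : ∀ σ : EndCat B, C σ → Implementable r σ.hom) :
    EssentiallyStrong (fiberFunctor C r) := by
  intro α β
  -- Only the first object needs a diagram: `p i w` lies in `F(β)` for `w` in `F(αβ)`, and `p i x`
  -- lies in `R` for `x` in `F(α)`.
  obtain ⟨n, p, q, hpq⟩ := (hC α.obj α.property).exists_isSummandDiagram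
  refine ⟨BalTensor.lift (AbMonoidal.μ α β) ?_, fun _ _ => rfl,
    BalTensor.lift_bijective _ _ q
      (fun i => AddMonoidHom.mk' (fun w => (⟨(p i).1 * w.1, fun b => by
        have hw : w.1 * r b = r (α.obj.hom (β.obj.hom b)) * w.1 := w.2 b
        have hp : (p i).1 * r (α.obj.hom (β.obj.hom b)) = r (β.obj.hom b) * (p i).1 :=
          (p i).2 (β.obj.hom b)
        change (p i).1 * w.1 * r b = r (β.obj.hom b) * ((p i).1 * w.1)
        rw [mul_assoc, hw, ← mul_assoc, hp, mul_assoc]⟩ :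
        intertwiner r (r.comp β.obj.hom)))
        (fun w w' => Subtype.ext (mul_add _ _ _)))
      (fun i x => (⟨(p i).1 * x.1, fun b => by
        have hx : x.1 * r b = r (α.obj.hom b) * x.1 := x.2 b
        have hp : (p i).1 * r (α.obj.hom b) = r b * (p i).1 := (p i).2 b
        change (p i).1 * x.1 * r b = r b * ((p i).1 * x.1)
        rw [mul_assoc, hx, ← mul_assoc, hp, mul_assoc]⟩ :
        intertwiner r (r.comp (RingHom.id B))))
      (fun w => Subtype.ext ?_) (fun i x y => Subtype.ext ?_) (fun x => Subtype.ext ?_)⟩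
  · intro s x y
    refine Subtype.ext ?_
    change r 1 * (x.1 * s.1) * y.1 = x.1 * (r 1 * (s.1 * y.1))
    simp [mul_assoc]
  · refine (AddSubmonoidClass.coe_finsetSum _ _).trans ?_
    change ∑ i, (q i).1 * ((p i).1 * w.1) = w.1
    simp only [← mul_assoc]
    rw [← Finset.sum_mul]
    exact (congrArg (· * w.1) hpq).trans (one_mul _)
  · change (p i).1 * (x.1 * y.1) = r 1 * ((p i).1 * x.1 * y.1)
    rw [map_one, one_mul, mul_assoc]
  · refine (AddSubmonoidClass.coe_finsetSum _ _).trans ?_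
    change ∑ i, r 1 * ((q i).1 * ((p i).1 * x.1)) = x.1
    simp only [map_one, one_mul, ← mul_assoc]
    rw [← Finset.sum_mul]
    exact (congrArg (· * x.1) hpq).trans (one_mul _)

/-- The comonoid structure on `λρ`, with coproduct `λ(m)` and counit `e`. -/
abbrev adjunctionComon (hγ : C ⟨l.comp r⟩) :
    ComonObj (⟨⟨l.comp r⟩, hγ⟩ : C.FullSubcategory) where
  counit := ObjectProperty.homMk ⟨adj.e, adj.e_mem⟩
  comul := ObjectProperty.homMk ⟨l adj.m, fun b => by
    change l adj.m * l (r b) = l (r (l (r b))) * l adj.m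
    rw [← map_mul, adj.m_mul, map_mul]⟩
  counit_comul := ObjectProperty.hom_ext _ (EndCat.hom_ext (by
    change adj.e * l adj.m = 1
    exact adj.e_mul_l_m))
  comul_counit := ObjectProperty.hom_ext _ (EndCat.hom_ext (by
    change l (r adj.e) * l adj.m = 1
    rw [← map_mul, adj.r_e_mul_m, map_one]))
  comul_assoc := ObjectProperty.hom_ext _ (EndCat.hom_ext (by
    change l (r (l adj.m)) * l adj.m = 1 * l adj.m * l adj.m
    rw [one_mul, ← map_mul, ← map_mul, adj.m_mul]))

/-- The bijection `Hom(ρ, ρα) ≅ Hom(λρ, α)`, `x ↦ e λ(x)`. -/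
def transposeEquiv (hγ : C ⟨l.comp r⟩) (α : C.FullSubcategory) :
    intertwiner r (r.comp α.obj.hom) ≃+ ((⟨⟨l.comp r⟩, hγ⟩ : C.FullSubcategory) ⟶ α) where
  toFun := transposeHom adj hγ α
  invFun t := (fiberFunctor C r).map t adj.unit
  left_inv := fiberFunctor_map_transposeHom adj hγ α
  right_inv t := ObjectProperty.hom_ext _ (EndCat.hom_ext (by
    change adj.e * l (r t.hom.1 * adj.m) = t.hom.1
    rw [adj.transpose_r_mul, adj.e_mul_l_m, mul_one]))
  map_add' x y := ObjectProperty.hom_ext _ (EndCat.hom_ext (by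
    change adj.e * l (x.1 + y.1) = adj.e * l x.1 + adj.e * l y.1
    rw [map_add, mul_add]))

/-- The natural isomorphism `Hom(ρ, ρ-) ≅ Hom(λρ, -)`. -/
def transposeNatIso (hγ : C ⟨l.comp r⟩) : fiberFunctor C r ≅
    preadditiveCoyoneda.obj (Opposite.op (⟨⟨l.comp r⟩, hγ⟩ : C.FullSubcategory)) :=
  NatIso.ofComponents
    (fun α => (transposeEquiv adj hγ α).toAddCommGrpIso)
    (fun {α β} t => by
      ext x
      refine ObjectProperty.hom_ext _ (EndCat.hom_ext ?_)
      change adj.e * l (r t.hom.1 * x.1) = t.hom.1 * (adj.e * l x.1)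
      exact adj.transpose_r_mul _ _)

/-- The transposition `x ↦ e λ(x)` is monoidal because `y = ρ(e λ(y)) m` can be substituted in `e
λ(x y)`, which produces the comultiplication `λ(m)`. -/
theorem fiberFunctor_isRepresentedBy (adj : RingAdjunction l r) (hγ : C ⟨l.comp r⟩) :
    IsRepresentedBy (fiberFunctor C r) (⟨⟨l.comp r⟩, hγ⟩ : C.FullSubcategory) := by
  refine ⟨adjunctionComon adj hγ, transposeNatIso adj hγ, fun α β x y => ?_, ?_⟩
  · refine ObjectProperty.hom_ext _ (EndCat.hom_ext ?_)
    change adj.e * l (x.1 * y.1) = adj.e * l x.1 * l (r (adj.e * l y.1)) * l adj.m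
    rw [mul_assoc, ← map_mul, adj.transpose_mul_m, mul_assoc, ← map_mul]
  · refine ObjectProperty.hom_ext _ (EndCat.hom_ext ?_)
    change adj.e * l 1 = adj.e
    rw [map_one, mul_one]

end FiberFunctor

/-! ## The isomorphism of `F^l ⊗_C F` with the opposite of `End(ρλ)` -/

section DualCoend

variable (adj : RingAdjunction l r)

/-- The element `f ρ(e λ(x m))` of `End(ρλ)`. -/
def dualEndElem (α : B →+* B) (f : intertwiner (r.comp α) r) (x : intertwiner r (r.comp α)) :
    endRing (r.comp l) :=
  ⟨f.1 * r (adj.e * l (x.1 * adj.m)), fun a => by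
    have hf : f.1 * r (α (l a)) = r (l a) * f.1 := f.2 (l a)
    have hx : x.1 * r (l a) = r (α (l a)) * x.1 := x.2 (l a)
    change f.1 * r (adj.e * l (x.1 * adj.m)) * r (l a) =
      r (l a) * (f.1 * r (adj.e * l (x.1 * adj.m)))
    rw [mul_assoc, ← map_mul, mul_assoc, ← map_mul, mul_assoc, adj.m_mul, ← mul_assoc x.1, hx,
      mul_assoc (r _), adj.transpose_r_mul, map_mul r, ← mul_assoc, hf, mul_assoc]⟩

/-- `ρ(e) f ρ(e λ(x m)) = f ρ(e λ(x))`. -/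
theorem r_e_mul_dualEndElem (α : B →+* B) (f : intertwiner (r.comp α) r)
    (x : intertwiner r (r.comp α)) :
    r adj.e * (dualEndElem adj α f x).1 = f.1 * r (adj.e * l x.1) := by
  have hf : f.1 * r (α adj.e) = r adj.e * f.1 := f.2 adj.e
  have hx : x.1 * r adj.e = r (α adj.e) * x.1 := x.2 adj.e
  change r adj.e * (f.1 * r (adj.e * l (x.1 * adj.m))) = _
  rw [← mul_assoc, ← hf, mul_assoc, ← map_mul, ← adj.transpose_r_mul, ← mul_assoc (r _), ← hx,
    mul_assoc x.1, adj.r_e_mul_m, mul_one]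

/-- Put `c = e λ(y m)`. Past `f`, the factor `ρ(c)` becomes `ρα(c)`; it enters the argument of `λ`,
passes `x` to become `ρ(c)` again, and `ρ(c) m = y m`. -/
theorem dualEndElem_mul (α β : B →+* B) (f : intertwiner (r.comp α) r)
    (x : intertwiner r (r.comp α)) (g : intertwiner (r.comp β) r)
    (y : intertwiner r (r.comp β)) :
    dualEndElem adj (α.comp β) (mulDual r α β f g) (mulFiber r α β x y) =
      dualEndElem adj β g y * dualEndElem adj α f x := Subtype.ext (by
  have hf : f.1 * r (α (adj.e * l (y.1 * adj.m))) = r (adj.e * l (y.1 * adj.m)) * f.1 := f.2 _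
  have hx : x.1 * r (adj.e * l (y.1 * adj.m)) = r (α (adj.e * l (y.1 * adj.m))) * x.1 := x.2 _
  change g.1 * f.1 * r (adj.e * l (x.1 * y.1 * adj.m)) =
    g.1 * r (adj.e * l (y.1 * adj.m)) * (f.1 * r (adj.e * l (x.1 * adj.m)))
  rw [mul_assoc g.1 (r _), ← mul_assoc (r _) f.1, ← hf, mul_assoc f.1, ← map_mul,
    ← adj.transpose_r_mul, ← mul_assoc (r _) x.1, ← hx, mul_assoc x.1 (r _),
    adj.transpose_mul_m, mul_assoc x.1, mul_assoc])

/-! ### Coproduct and coaction for diagrams of arbitrary objects -/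

variable {n k : ℕ} {p : Fin n → intertwiner (r.comp (l.comp r)) r}
  {q : Fin n → intertwiner r (r.comp (l.comp r))}

/-- This matches the coproduct of `End(ρλ)` with that of `F^l ⊗_C F` at any `α`. In `A` both sides
are `f ρ(e λ(x m)) ρ(e)`, since `∑ q' i p' i = 1`. -/
theorem endComul_dualEndElem (hpq : IsSummandDiagram p q) {α : B →+* B}
    {p' : Fin k → intertwiner (r.comp α) r} {q' : Fin k → intertwiner r (r.comp α)}
    (hpq' : IsSummandDiagram p' q') (f : intertwiner (r.comp α) r)
    (x : intertwiner r (r.comp α)) :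
    endComul adj p q (dualEndElem adj α f x) = ∑ i, BalTensor.tmul _ _
      (dualEndElem adj α f (q' i)) (dualEndElem adj α (p' i) x) := by
  refine endTensorEmb_injective adj hpq ((endTensorEmb_endComul adj hpq _).trans ?_)
  have hi : ∀ i, endTensorEmb adj (BalTensor.tmul _ _ (dualEndElem adj α f (q' i))
      (dualEndElem adj α (p' i) x)) =
      f.1 * r (adj.e * l (q' i * p' i)) * r (l (r (adj.e * l (x.1 * adj.m)))) := fun i => by
    rw [endTensorEmb_tmul, r_e_mul_dualEndElem]
    change _ * r (l ((p' i).1 * r (adj.e * l (x.1 * adj.m)))) = _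
    rw [map_mul l (p' i).1, map_mul r (l (p' i).1), ← mul_assoc, mul_assoc f.1, ← map_mul r,
      mul_assoc adj.e, ← map_mul l]
  rw [map_sum, Finset.sum_congr rfl fun i _ => hi i, ← Finset.sum_mul,
    ← Finset.mul_sum, ← map_sum, ← Finset.mul_sum, ← map_sum]
  refine Eq.trans ?_ (congrArg (fun y => f.1 * r (adj.e * l y) *
    r (l (r (adj.e * l (x.1 * adj.m))))) hpq').symm
  rw [map_one, mul_one, mul_assoc, adj.r_e_mul, ← mul_assoc]
  rfl

/-- This is the coaction formula for `b ⊗_α x`, read in `A ⊗_R End(ρλ)`. Both sides have image `ρ(b)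
ρ(e λ(x))`. -/
theorem endCoact_r_mul (hpq : IsSummandDiagram p q) {α : B →+* B}
    {p' : Fin k → intertwiner (r.comp α) r} {q' : Fin k → intertwiner r (r.comp α)}
    (hpq' : IsSummandDiagram p' q') (b : B) (x : intertwiner r (r.comp α)) :
    endCoact adj p q (r b * x.1) = ∑ i, BalTensor.tmul _ _
      (r b * (q' i).1) (dualEndElem adj α (p' i) x) := by
  refine coactionEmb_injective adj hpq ((coactionEmb_endCoact adj hpq _).trans ?_)
  have hi : ∀ i, coactionEmb adj (BalTensor.tmul _ _ (r b * (q' i).1)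
      (dualEndElem adj α (p' i) x)) =
      r b * (q' i * p' i) * r (adj.e * l x.1) := fun i => by
    rw [coactionEmb_tmul, mul_assoc, r_e_mul_dualEndElem]
    simp only [mul_assoc]
  rw [map_sum, Finset.sum_congr rfl fun i _ => hi i, ← Finset.sum_mul, ← Finset.mul_sum]
  refine Eq.trans ?_ (congrArg (fun y => r b * y * r (adj.e * l x.1)) hpq').symm
  rw [mul_one, ← map_mul, adj.transpose_r_mul]

/-! ### The ring isomorphism and the transported structures -/

variable {C : ObjectProperty (EndCat B)} [C.IsMonoidal]

/-- The map `F^l ⊗_C F → End(ρλ)`, `f ⊗_α x ↦ f ρ(e λ(x m))`. -/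
noncomputable def dualEndHom : DualCoend C r →+ endRing (r.comp l) :=
  CoendTensor.lift (G := dualFunctor C r) (F := fiberFunctor C r)
    (fun α => AddMonoidHom.mk' (fun f => AddMonoidHom.mk' (dualEndElem adj α.obj.hom f)
      (fun x y => Subtype.ext (by
        change f.1 * r (adj.e * l ((x.1 + y.1) * adj.m)) = f.1 * r _ + f.1 * r _
        rw [add_mul, map_add, mul_add, map_add, mul_add])))
      (fun f g => AddMonoidHom.ext fun x => Subtype.ext (add_mul _ _ _)))
    (fun α β t f x => Subtype.ext (by
      change f.1 * r t.hom.1 * r (adj.e * l (x.1 * adj.m)) =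
        f.1 * r (adj.e * l (r t.hom.1 * x.1 * adj.m))
      rw [mul_assoc (r _), adj.transpose_r_mul, map_mul r t.hom.1, mul_assoc]))

theorem dualEndHom_mk (α : C.FullSubcategory) (f : intertwiner (r.comp α.obj.hom) r)
    (x : intertwiner r (r.comp α.obj.hom)) :
    dualEndHom adj (dualMk C r α f x) = dualEndElem adj α.obj.hom f x :=
  CoendTensor.lift_mk (G := dualFunctor C r) (F := fiberFunctor C r) _ _ α f x

/-- The element `ρ(e) h` of `Hom(ρλρ, ρ)`. -/
def endDualElem : endRing (r.comp l) →+ intertwiner (r.comp (l.comp r)) r :=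
  AddMonoidHom.mk' (fun h => ⟨r adj.e * h.1, fun b => by
      change r adj.e * h.1 * r (l (r b)) = r b * (r adj.e * h.1)
      rw [mul_assoc, endRing_comm, ← mul_assoc, adj.r_e_mul, mul_assoc]⟩)
    (fun h h' => Subtype.ext (mul_add _ _ _))

/-- The map `End(ρλ) → F^l ⊗_C F`, `h ↦ ρ(e) h ⊗_{λρ} m`. -/
noncomputable def endDualHom (hγ : C ⟨l.comp r⟩) : endRing (r.comp l) →+ DualCoend C r :=
  ((CoendTensor.mkHom (dualFunctor C r) (fiberFunctor C r) ⟨⟨l.comp r⟩, hγ⟩).flip adj.unit).comp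
    (endDualElem adj)

theorem endDualHom_apply (hγ : C ⟨l.comp r⟩) (h : endRing (r.comp l)) : endDualHom adj hγ h =
    dualMk C r ⟨⟨l.comp r⟩, hγ⟩ (endDualElem adj h) adj.unit := rfl

/-- Concentrated at `λρ`, the element `f ⊗_α x` is `f ρ(e λ(x)) ⊗ m`, whose first factor is `ρ(e)`
times the element of `End(ρλ)` attached to `f ⊗_α x`. -/
theorem endDualHom_dualEndHom (hγ : C ⟨l.comp r⟩) (z : DualCoend C r) :
    endDualHom adj hγ (dualEndHom adj z) = z := by
  have h : (endDualHom adj hγ).comp (dualEndHom adj) = AddMonoidHom.id _ := by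
    refine CoendTensor.hom_ext fun α f x => ?_
    refine (congrArg (endDualHom adj hγ) (dualEndHom_mk adj α f x)).trans ?_
    refine Eq.trans ?_ (coendTensor_mk_eq adj hγ (dualFunctor C r) α f x).symm
    rw [endDualHom_apply]
    refine congrArg (fun y => dualMk C r ⟨⟨l.comp r⟩, hγ⟩ y adj.unit) (Subtype.ext ?_)
    exact r_e_mul_dualEndElem adj α.obj.hom f x
  exact DFunLike.congr_fun h z

theorem dualEndHom_endDualHom (hγ : C ⟨l.comp r⟩) (h : endRing (r.comp l)) :
    dualEndHom adj (endDualHom adj hγ h) = h := by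
  rw [endDualHom_apply, dualEndHom_mk]
  refine r_e_mul_cancel adj ((r_e_mul_dualEndElem adj _ _ _).trans ?_)
  change r adj.e * h.1 * r (adj.e * l adj.m) = _
  rw [adj.e_mul_l_m, map_one, mul_one]

theorem dualEndHom_mul (z w : DualCoend C r) :
    dualEndHom adj (z * w) = dualEndHom adj w * dualEndHom adj z := by
  have h : (CoendTensor.mulHom).compr₂ (dualEndHom (C := C) adj) =
      (AddMonoidHom.mul.flip.comp (dualEndHom (C := C) adj)).compl₂ (dualEndHom adj) := by
    refine CoendTensor.hom_ext fun α f x => CoendTensor.hom_ext fun β g y => ?_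
    change dualEndHom adj (CoendTensor.mulHom (dualMk C r α f x) (dualMk C r β g y)) =
      dualEndHom adj (dualMk C r β g y) * dualEndHom adj (dualMk C r α f x)
    refine Eq.trans ?_ (congrArg₂ (· * ·) (dualEndHom_mk adj β g y) (dualEndHom_mk adj α f x)).symm
    refine (congrArg (dualEndHom adj) (CoendTensor.mulHom_mk α β _ _ _ _)).trans ?_
    exact (dualEndHom_mk adj (α ⊗ β) _ _).trans
      (dualEndElem_mul adj α.obj.hom β.obj.hom f x g y)
  exact DFunLike.congr_fun (DFunLike.congr_fun h z) w

/-- The ring isomorphism of `F^l ⊗_C F` with the opposite of `End(ρλ)`. -/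
noncomputable def dualEndEquiv (hγ : C ⟨l.comp r⟩) :
    DualCoend C r ≃+* (endRing (r.comp l))ᵐᵒᵖ where
  toFun z := MulOpposite.op (dualEndHom adj z)
  invFun h := endDualHom adj hγ h.unop
  left_inv := endDualHom_dualEndHom adj hγ
  right_inv h := congrArg MulOpposite.op (dualEndHom_endDualHom adj hγ h.unop)
  map_mul' z w := congrArg MulOpposite.op (dualEndHom_mul adj z w)
  map_add' z w := congrArg MulOpposite.op (map_add (dualEndHom adj) z w)

theorem dualEndEquiv_mk (hγ : C ⟨l.comp r⟩) (α : C.FullSubcategory)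
    (f : intertwiner (r.comp α.obj.hom) r) (x : intertwiner r (r.comp α.obj.hom)) :
    dualEndEquiv adj hγ (dualMk C r α f x) = MulOpposite.op (dualEndElem adj α.obj.hom f x) :=
  congrArg MulOpposite.op (dualEndHom_mk adj α f x)

/-- The right bialgebroid `F^l ⊗_C F`. -/
noncomputable def dualBialgebroid (hγ : C ⟨l.comp r⟩) (hpq : IsSummandDiagram p q) :
    RightBialgebroid (endRing r) (DualCoend C r) :=
  (endBialgebroid adj hpq).opposite (dualEndEquiv adj hγ)

theorem dualBialgebroid_isDualBialgebroid (hγ : C ⟨l.comp r⟩) (hpq : IsSummandDiagram p q) :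
    IsDualBialgebroid C r (dualBialgebroid adj hγ hpq) where
  -- The isomorphism sends `1 ⊗ x` to `ρ(e λ(x m))`, the target of `End(ρλ)`, and in the next field
  -- `x ⊗ 1` to `x`, its source.
  source x := by
    change (dualEndEquiv adj hγ).symm _ = _
    rw [RingEquiv.symm_apply_eq, dualEndEquiv_mk]
    refine congrArg MulOpposite.op (Subtype.ext ?_)
    exact (one_mul _).symm
  target x := by
    change (dualEndEquiv adj hγ).symm _ = _
    rw [RingEquiv.symm_apply_eq, dualEndEquiv_mk]
    refine congrArg MulOpposite.op (Subtype.ext ?_)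
    change x.1 = x.1 * r (adj.e * l (1 * adj.m))
    rw [one_mul, adj.e_mul_l_m, map_one, mul_one]
  counit α f x := by
    change r adj.e * (dualEndHom adj (dualMk C r α f x)).1 * adj.m = f.1 * x.1
    rw [dualEndHom_mk, r_e_mul_dualEndElem, mul_assoc, adj.transpose_mul_m]
  comul α k p' q' hpq' f x := by
    refine tensorHom_injective
      ((endBialgebroid adj hpq).oppositeIso (dualEndEquiv adj hγ)).toRightIso
      ((endBialgebroid adj hpq).oppositeIso (dualEndEquiv adj hγ)) ?_
    refine ((endBialgebroid adj hpq).opposite_tensorHom_comul _ _).trans ?_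
    rw [dualEndEquiv_mk]
    refine (endComul_dualEndElem adj hpq hpq' f x).trans (Eq.trans ?_ (map_sum _ _ _).symm)
    refine Finset.sum_congr rfl fun i _ => ?_
    exact congrArg₂ (BalTensor.tmul _ _) (dualEndHom_mk adj α f (q' i)).symm
      (dualEndHom_mk adj α (p' i) x).symm

theorem fieldCounitEquiv_fieldBase (hγ : C ⟨l.comp r⟩) (x : endRing r) :
    fieldCounitEquiv adj hγ (fieldBase C r x) = (endRing r).subtype x := by
  refine (fieldCounitEquiv_mk adj hγ (𝟙_ C.FullSubcategory) 1 _).trans ?_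
  change r 1 * x.1 = x.1
  rw [map_one, one_mul]

/-- The comodule algebra `Υ ⊗_C F` over `F^l ⊗_C F`. -/
noncomputable def fieldComoduleAlgebra (hγ : C ⟨l.comp r⟩) (hpq : IsSummandDiagram p q) :
    (dualBialgebroid adj hγ hpq).ComoduleAlgebra (fieldBase C r) :=
  (endComoduleAlgebra adj hpq).transport (dualEndEquiv adj hγ) (fieldCounitEquiv adj hγ)
    (fieldCounitEquiv_fieldBase adj hγ)

theorem fieldComoduleAlgebra_isFieldCoaction (hγ : C ⟨l.comp r⟩) (hpq : IsSummandDiagram p q) :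
    IsFieldCoaction C r (dualBialgebroid adj hγ hpq) (fieldComoduleAlgebra adj hγ hpq) := by
  intro α k p' q' hpq' b x
  refine tensorHom_injective
    (ringRightIso (fieldCounitEquiv adj hγ) (fieldCounitEquiv_fieldBase adj hγ))
    ((endBialgebroid adj hpq).oppositeIso (dualEndEquiv adj hγ)) ?_
  refine ((endComoduleAlgebra adj hpq).tensorHom_transport _ _ _ _).trans ?_
  rw [fieldCounitEquiv_mk]
  refine (endCoact_r_mul adj hpq hpq' b x).trans (Eq.trans ?_ (map_sum _ _ _).symm)
  refine Finset.sum_congr rfl fun i _ => ?_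
  exact congrArg₂ (BalTensor.tmul _ _) (fieldCounitEquiv_mk adj hγ α b (q' i)).symm
    (dualEndHom_mk adj α (p' i) x).symm

theorem fieldComoduleAlgebra_isGalois (hγ : C ⟨l.comp r⟩) (hpq : IsSummandDiagram p q) :
    IsGalois (fieldExt C (fiberFunctor C r)) (fieldComoduleAlgebra adj hγ hpq).coact :=
  (endComoduleAlgebra adj hpq).isGalois_transport (dualEndEquiv adj hγ) (fieldCounitEquiv adj hγ)
    (fieldCounitEquiv_fieldBase adj hγ) (DFunLike.congr_fun fieldCounit_comp_fieldExt)
    (endComoduleAlgebra_isGalois adj hpq)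

end DualCoend

end FieldAlg

theorem mainTheorem4 {A B : Type u} [Ring A] [Ring B] {l : A →+* B} {r : B →+* A}
    (adj : FieldAlg.RingAdjunction l r)
    (C : ObjectProperty (FieldAlg.EndCat B)) [C.IsMonoidal]
    (hC : ∀ σ : FieldAlg.EndCat B, C σ → FieldAlg.Implementable r σ.hom)
    (hγ : C ⟨l.comp r⟩) :
    -- `F = Hom(ρ, ρ-)` is representable, essentially strong, and `η_F` is an isomorphism
    ((FieldAlg.fiberFunctor C r).Additive ∧
      FieldAlg.IsRepresentedBy (FieldAlg.fiberFunctor C r)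
        (⟨⟨l.comp r⟩, hγ⟩ : C.FullSubcategory) ∧
      FieldAlg.EssentiallyStrong (FieldAlg.fiberFunctor C r) ∧
      FieldAlg.IsMonoidalNat (FieldAlg.fieldUnit C (FieldAlg.fiberFunctor C r)) ∧
      IsIso (FieldAlg.fieldUnit C (FieldAlg.fiberFunctor C r))) ∧
    -- the counit is an isomorphism of extensions of `B` from `ρ_F` to `ρ`
    ((FieldAlg.fieldCounit C r).comp (FieldAlg.fieldExt C (FieldAlg.fiberFunctor C r)) = r ∧
      Function.Bijective (FieldAlg.fieldCounit C r)) ∧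
    -- the bialgebroids `F^l ⊗_C F` and `End(ρλ)`
    ∃ (K : FieldAlg.RightBialgebroid (FieldAlg.endRing r) (FieldAlg.DualCoend C r))
      (L : FieldAlg.LeftBialgebroid (FieldAlg.endRing r) (FieldAlg.endRing (r.comp l))),
      FieldAlg.IsDualBialgebroid C r K ∧ FieldAlg.IsEndBialgebroid adj L ∧
      -- `F^l ⊗_C F` is the opposite of `End(ρλ)`
      (∃ Φ : FieldAlg.DualCoend C r ≃+* (FieldAlg.endRing (r.comp l))ᵐᵒᵖ,
        FieldAlg.IsIsoToOpposite K L Φ) ∧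
      -- `ρ_F` is a Galois extension over `F^l ⊗_C F` with coinvariants `ρ_F(B)`
      (∃ δ : K.ComoduleAlgebra (FieldAlg.fieldBase C r),
        FieldAlg.IsFieldCoaction C r K δ ∧
        FieldAlg.IsGalois (FieldAlg.fieldExt C (FieldAlg.fiberFunctor C r)) δ.coact) ∧
      -- `ρ` is a Galois extension over `End(ρλ)` with coinvariants `ρ(B)`
      (∃ δ : L.ComoduleAlgebra (FieldAlg.endRing r).subtype,
        FieldAlg.IsEndCoaction adj L δ ∧ FieldAlg.IsGalois r δ.coact) := by
  -- One diagram for `λρ` serves to construct both bialgebroids and both coactions.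
  obtain ⟨n, p, q, hpq⟩ := (hC _ hγ).exists_isSummandDiagram
  exact ⟨⟨FieldAlg.fiberFunctor_additive, FieldAlg.fiberFunctor_isRepresentedBy adj hγ,
      FieldAlg.fiberFunctor_essentiallyStrong hC, FieldAlg.fieldUnit_isMonoidalNat,
      FieldAlg.fieldUnit_isIso adj hγ⟩,
    ⟨FieldAlg.fieldCounit_comp_fieldExt, FieldAlg.fieldCounit_bijective adj hγ⟩,
    FieldAlg.dualBialgebroid adj hγ hpq, FieldAlg.endBialgebroid adj hpq,
    FieldAlg.dualBialgebroid_isDualBialgebroid adj hγ hpq,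
    FieldAlg.endBialgebroid_isEndBialgebroid adj hpq,
    ⟨FieldAlg.dualEndEquiv adj hγ,
      FieldAlg.LeftBialgebroid.opposite_isIsoToOpposite _ _⟩,
    ⟨FieldAlg.fieldComoduleAlgebra adj hγ hpq,
      FieldAlg.fieldComoduleAlgebra_isFieldCoaction adj hγ hpq,
      FieldAlg.fieldComoduleAlgebra_isGalois adj hγ hpq⟩,
    ⟨FieldAlg.endComoduleAlgebra adj hpq,
      FieldAlg.endComoduleAlgebra_isEndCoaction adj hpq,
      FieldAlg.endComoduleAlgebra_isGalois adj hpq⟩⟩
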